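/- **Setting.** Let $N\ge 0$ and $k\ge 0$ real. A permutation $w\in S_N$ acts on polynomials in $\mathbb R[x_1,\dots,x_N]$ by $(wf)(x)=f(xw)$, $(xw)_i=x_{w(i)}$, and on compositions $\alpha\in\mathbb Z_{\ge0}^N$ by $(w\alpha)_i=\alpha_{w^{-1}(i)}$. Let $$T_i=\frac{\partial}{\partial x_i}+k\sum_{j\ne i}\frac{1-(ij)}{x_i-x_j},\qquad U_i=T_ix_i+k-k\sum_{j<i}(ij),$$ $$\kappa_i(\alpha)=Nk-k\bigl(\#\{s:\alpha_s>\alpha_i\}+\#\{s<i:\alpha_s=\alpha_i\}\bigr)+\alpha_i+1 .$$ Let $|\alpha|=\sum_i\alpha_i$, let $\alpha^+$ be the weakly decreasing rearrangement of $\alpha$, and write $\alpha\succ\beta$ if $\alpha\ne\beta$ and $\sum_{i\le j}\alpha_i\ge\sum_{i\le j}\beta_i$ for $1\le j\le N$. Define $p_\alpha$ by $$\sum_\alpha p_\alpha(x)y^\alpha=\prod_{i=1}^N\Bigl\{(1-x_iy_i)^{-1}\prod_{j=1}^N(1-x_iy_j)^{-k}\Bigr\}.$$ For a partition $\lambda$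 with at most $N$ nonzero parts (a weakly decreasing $\lambda\in\mathbb Z_{\ge0}^N$), $\omega_\lambda$ is the polynomial with $U_i\omega_\lambda=\kappa_i(\lambda)\omega_\lambda$ for all $i$ and $\omega_\lambda\in p_\lambda+\operatorname{span}\{p_\beta:|\beta|=|\lambda|,\ \beta^+\succ\lambda\}$; put $\omega_{w\lambda}=w\omega_\lambda$ for $w\in S_N$. The nonsymmetric Jack polynomial $\zeta_\alpha$ is the polynomial with $U_i\zeta_\alpha=\kappa_i(\alpha)\zeta_\alpha$ for all $i$ and $\zeta_\alpha\in\omega_\alpha+\operatorname{span}\{\omega_\beta:\beta^+=\alpha^+,\ \beta\succ\alpha\}$. Let $\langle\cdot,\cdot\rangle$ be any inner product (or merely symmetric bilinear form) on polynomials such that each operator $T_ix_i$ is self-adjoint and $\langle wf,g\rangle=\langle f,w^{-1}g\rangle$ for $w\in S_N$; write $\|f\|^2=\langle f,f\rangle$. Let $1^N=(1,\dots,1)$. Let $I=[\ell+1,\ell+m]$ with $\ell,m\ge 0$ and $\ell+m\le N$, and let $S_I$ be the group of permutations $w\in S_N$ that fix every index outside $I$. Say that $\alpha$ satisfies $(\ge,I)$,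 respectively $(>,I)$, if $\alpha_i\ge\alpha_j$, respectively $\alpha_i>\alpha_j$, for all $i<j$ in $I$. For $\varepsilon=\pm$ put $$\mathcal E_\varepsilon(\beta;I)=\prod\Bigl\{1+\frac{\varepsilon k}{\kappa_j(\beta)-\kappa_i(\beta)}:\ i,j\in I,\ i<j,\ \beta_i<\beta_j\Bigr\},$$ and let $\alpha^R$ be obtained from $\alpha$ by reversing the order of the entries $\alpha_{\ell+1},\dots,\alpha_{\ell+m}$. **Theorem.** Let $\alpha$ satisfy $(\ge,I)$, let $X=\operatorname{span}\{\zeta_{w\alpha}:w\in S_I\}$, let $g_{w\alpha}=w\zeta_\alpha$ for $w\in S_I$ (this depends only on $w\alpha$), and let $$j_{\alpha;I}=\mathcal E_+(\alpha^R;I)\sum_{\beta\in S_I\alpha}\frac{1}{\mathcal E_+(\beta;I)}\,\zeta_\beta .$$ Then $j_{\alpha;I}$ is a nonzero element of $X$ with $wj_{\alpha;I}=j_{\alpha;I}$ for all $w\in S_I$, every $S_I$-invariant element of $X$ is a scalar multiple of it, and 1. $\|j_{\alpha;I}\|^2=(\#S_I\alpha)\,\mathcal E_+(\alpha^R;I)\,\|\zeta_\alpha\|^2$;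 2. $j_{\alpha;I}(1^N)=(\#S_I\alpha)\,\zeta_\alpha(1^N)$; 3. $j_{\alpha;I}=\sum_{\beta\in S_I\alpha}g_\beta$. If moreover $\alpha$ satisfies $(>,I)$, let $$a_{\alpha;I}=\mathcal E_-(\alpha^R;I)\sum_{w\in S_I}\frac{\operatorname{sgn}(w)}{\mathcal E_-(w\alpha;I)}\,\zeta_{w\alpha}.$$ Then $a_{\alpha;I}$ is a nonzero element of $X$ with $wa_{\alpha;I}=\operatorname{sgn}(w)\,a_{\alpha;I}$ for all $w\in S_I$, every $f\in X$ with $wf=\operatorname{sgn}(w)f$ for all $w\in S_I$ is a scalar multiple of it, and 4. $\|a_{\alpha;I}\|^2=(\#S_I)\,\mathcal E_-(\alpha^R;I)\,\|\zeta_\alpha\|^2$; 5. $a_{\alpha;I}=\sum_{w\in S_I}\operatorname{sgn}(w)\,g_{w\alpha}$. -/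

import Mathlib

namespace NSJack

open MvPolynomial

/-- Polynomials in `x_1, …, x_N` with real coefficients (variables indexed by `Fin N`). -/
abbrev Poly (N : ℕ) : Type := MvPolynomial (Fin N) ℝ

/-- Compositions `α = (α_1, …, α_N)` of nonnegative integers. -/
abbrev Comp (N : ℕ) : Type := Fin N → ℕ

variable {N : ℕ}

/-- The action of a permutation on polynomials, `(w f)(x) = f(xw)` with `(xw)_i = x_{w(i)}`;
that is, `w` sends the variable `x_i` to `x_{w(i)}`. -/
noncomputable def perm (w : Equiv.Perm (Fin N)) : Poly N →ₗ[ℝ] Poly N :=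
  (rename (w : Fin N → Fin N)).toLinearMap

/-- The action of a permutation on compositions, `(wα)_i = α_{w⁻¹(i)}`. -/
def act (w : Equiv.Perm (Fin N)) (α : Comp N) : Comp N := fun i => α (w⁻¹ i)

theorem sub_dvd_sub_perm_swap (i j : Fin N) (f : Poly N) :
    (X i - X j : Poly N) ∣ f - perm (Equiv.swap i j) f := by
  have key : ∀ g : Poly N, (X i - X j : Poly N) ∣ g - rename (Equiv.swap i j : Fin N → Fin N) g := by
    intro g
    induction g using MvPolynomial.induction_on with
    | C a => simp
    | add p q hp hq =>
      have h := dvd_add hp hq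
      rw [map_add]
      convert h using 1
      ring
    | mul_X p n hp =>
      have hX : (X i - X j : Poly N) ∣ X n - X (Equiv.swap i j n) := by
        by_cases h1 : n = i
        · subst h1; simp
        · by_cases h2 : n = j
          · subst h2
            rw [Equiv.swap_apply_right]
            exact ⟨-1, by ring⟩
          · rw [Equiv.swap_apply_of_ne_of_ne h1 h2]; simp
      have h := dvd_add (Dvd.dvd.mul_right hp (X n))
        (Dvd.dvd.mul_left hX (rename (Equiv.swap i j : Fin N → Fin N) p))
      rw [map_mul, rename_X]
      convert h using 1
      ring
  exact key f

/-- The polynomial `(f - (ij)f) / (x_i - x_j)`. -/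
noncomputable def divDiff (i j : Fin N) (f : Poly N) : Poly N :=
  Classical.choose (sub_dvd_sub_perm_swap i j f)

theorem divDiff_spec (i j : Fin N) (f : Poly N) :
    f - perm (Equiv.swap i j) f = (X i - X j) * divDiff i j f :=
  Classical.choose_spec (sub_dvd_sub_perm_swap i j f)

/-- The Dunkl operator of type `A`,
`T_i f = ∂f/∂x_i + k ∑_{j ≠ i} (f - (ij)f) / (x_i - x_j)`. -/
noncomputable def dunkl (k : ℝ) (i : Fin N) (f : Poly N) : Poly N :=
  pderiv i f + k • ∑ j ∈ Finset.univ.erase i, divDiff i j f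

/-- The Cherednik-type operator `U_i = T_i x_i + k - k ∑_{j < i} (ij)`. -/
noncomputable def opU (k : ℝ) (i : Fin N) (f : Poly N) : Poly N :=
  dunkl k i (X i * f) + k • f - k • ∑ j ∈ Finset.Iio i, perm (Equiv.swap i j) f

/-- The eigenvalue `κ_i(α) = Nk - k(#{s : α_s > α_i} + #{s : s < i, α_s = α_i}) + α_i + 1`. -/
noncomputable def kappa (k : ℝ) (α : Comp N) (i : Fin N) : ℝ :=
  (N : ℝ) * k
    - k * (((Finset.univ.filter fun s => α i < α s).card : ℝ)
        + ((Finset.univ.filter fun s => s < i ∧ α s = α i).card : ℝ))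
    + (α i : ℝ) + 1

/-- The expansion `∑_n (t)_n / n! x_i^n y_j^n` of `(1 - x_i y_j)^{-t}`, as a power series in the
variables `y` with coefficients polynomials in the variables `x`. -/
noncomputable def binomSeries (t : ℝ) (i j : Fin N) : MvPowerSeries (Fin N) (Poly N) :=
  fun m =>
    if m = Finsupp.single j (m j) then
      C ((ascPochhammer ℝ (m j)).eval t / (Nat.factorial (m j) : ℝ)) * X i ^ (m j)
    else 0

/-- The generating function
`F_k(x, y) = ∏_i ((1 - x_i y_i)^{-1} ∏_j (1 - x_i y_j)^{-k})`. -/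
noncomputable def genFun (N : ℕ) (k : ℝ) : MvPowerSeries (Fin N) (Poly N) :=
  ∏ i : Fin N, (binomSeries 1 i i * ∏ j : Fin N, binomSeries k i j)

/-- The polynomial `p_α(x)`, the coefficient of `y^α` in `F_k(x, y)`. -/
noncomputable def pPoly (k : ℝ) (α : Comp N) : Poly N :=
  MvPowerSeries.coeff (Finsupp.equivFunOnFinite.symm α) (genFun N k)

/-- A permutation sorting `α` into weakly decreasing order. -/
def sortPerm (α : Comp N) : Equiv.Perm (Fin N) :=
  Tuple.sort fun i => OrderDual.toDual (α i)

/-- The partition `α⁺`, the weakly decreasing rearrangement of `α`; note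
`act (sortPerm α) α⁺ = α`. -/
def plus (α : Comp N) : Comp N := fun i => α (sortPerm α i)

/-- Strict dominance `α ≻ β`: all partial sums satisfy
`α_1 + … + α_j ≥ β_1 + … + β_j`, and `α ≠ β`. -/
def SDom (α β : Comp N) : Prop :=
  (∀ j : Fin N, ∑ i ∈ Finset.Iic j, β i ≤ ∑ i ∈ Finset.Iic j, α i) ∧ α ≠ β

/-- `f` is the polynomial `ω_lam` of the partition `lam`: the simultaneous eigenfunction of the
`U_i` with eigenvalues `κ_i(lam)` (that is, the multiple of the nonsymmetric Jack polynomial)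
of the form `p_lam + ∑ {B(β) p_β : |β| = |lam|, β⁺ ≻ lam}`. -/
def IsOmega (k : ℝ) (lam : Comp N) (f : Poly N) : Prop :=
  (∀ i, opU k i f = kappa k lam i • f) ∧
  f - pPoly k lam ∈ Submodule.span ℝ
    {q : Poly N | ∃ β : Comp N, ∑ i, β i = ∑ i, lam i ∧ SDom (plus β) lam ∧ q = pPoly k β}

/-- The polynomial `ω_α`, equal to `w ω_{α⁺}` where `w α⁺ = α`. -/
noncomputable def omega (k : ℝ) (α : Comp N) : Poly N :=
  perm (sortPerm α) (Classical.epsilon (IsOmega k (plus α)))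

/-- `f` is the nonsymmetric Jack polynomial `ζ_α`: the simultaneous eigenfunction of the `U_i`
with eigenvalues `κ_i(α)` of the form `ω_α + ∑ {B(β) ω_β : β⁺ = α⁺, β ≻ α}`. -/
def IsZeta (k : ℝ) (α : Comp N) (f : Poly N) : Prop :=
  (∀ i, opU k i f = kappa k α i • f) ∧
  f - omega k α ∈ Submodule.span ℝ
    {q : Poly N | ∃ β : Comp N, plus β = plus α ∧ SDom β α ∧ q = omega k β}

/-- The nonsymmetric Jack polynomial `ζ_α`. -/
noncomputable def zeta (k : ℝ) (α : Comp N) : Poly N :=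
  Classical.epsilon (IsZeta k α)

/-- The interval `I = [ℓ+1, ℓ+m]`, in zero-based indices. -/
def interval (N l m : ℕ) : Finset (Fin N) :=
  Finset.univ.filter fun i => l ≤ (i : ℕ) ∧ (i : ℕ) < l + m

/-- The group `S_I` of the permutations that fix every index outside `I`. -/
def symI (I : Finset (Fin N)) : Finset (Equiv.Perm (Fin N)) :=
  Finset.univ.filter fun w => ∀ i, i ∉ I → w i = i

/-- The orbit `S_I α`. -/
def orbitI (I : Finset (Fin N)) (α : Comp N) : Finset (Comp N) :=
  (symI I).image fun w => act w α

/-- Condition `(≥, I)`. -/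
def GeI (I : Finset (Fin N)) (α : Comp N) : Prop :=
  ∀ i ∈ I, ∀ j ∈ I, i < j → α j ≤ α i

/-- Condition `(>, I)`. -/
def GtI (I : Finset (Fin N)) (α : Comp N) : Prop :=
  ∀ i ∈ I, ∀ j ∈ I, i < j → α j < α i

/-- `α^R`: the entries of `α` at the positions in `[ℓ+1, ℓ+m]` are put in reverse order. The
bound in the condition always holds there when `ℓ + m ≤ N`. -/
def revI (l m : ℕ) (α : Comp N) : Comp N := fun i =>
  if h : (l ≤ (i : ℕ) ∧ (i : ℕ) < l + m) ∧ 2 * l + m - 1 - (i : ℕ) < N then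
    α ⟨2 * l + m - 1 - (i : ℕ), h.2⟩
  else α i

/-- `E_ε(β; I) = ∏ {1 + ε k / (κ_j(β) - κ_i(β)) : i, j ∈ I, i < j, β_i < β_j}`, to be used
with `ε = 1` and `ε = -1`. -/
noncomputable def calE (k ε : ℝ) (I : Finset (Fin N)) (β : Comp N) : ℝ :=
  ∏ q ∈ (I ×ˢ I).filter (fun q => q.1 < q.2 ∧ β q.1 < β q.2),
    (1 + ε * k / (kappa k β q.2 - kappa k β q.1))

/-- The sign of a permutation as a real number. -/
def sgn (w : Equiv.Perm (Fin N)) : ℝ := ((Equiv.Perm.sign w : ℤ) : ℝ)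

/-- The polynomials `g_β`, `β ∈ S_I α`, given by `g_{wα} = w ζ_α` for `w ∈ S_I`. -/
noncomputable def gPoly (k : ℝ) (I : Finset (Fin N)) (α β : Comp N) : Poly N :=
  perm (Classical.epsilon fun w : Equiv.Perm (Fin N) => w ∈ symI I ∧ act w α = β) (zeta k α)

/-- `X = span {ζ_{wα} : w ∈ S_I}`. -/
noncomputable def spaceX (k : ℝ) (I : Finset (Fin N)) (α : Comp N) : Submodule ℝ (Poly N) :=
  Submodule.span ℝ {q : Poly N | ∃ w ∈ symI I, q = zeta k (act w α)}

/-- `j_{α;I} = E_+(α^R; I) ∑_{β ∈ S_I α} E_+(β; I)⁻¹ ζ_β` for `I = [ℓ+1, ℓ+m]`. -/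
noncomputable def jPoly (k : ℝ) (l m : ℕ) (α : Comp N) : Poly N :=
  calE k 1 (interval N l m) (revI l m α) •
    ∑ β ∈ orbitI (interval N l m) α, (1 / calE k 1 (interval N l m) β) • zeta k β

/-- `a_{α;I} = E_-(α^R; I) ∑_{w ∈ S_I} sgn(w) E_-(wα; I)⁻¹ ζ_{wα}` for `I = [ℓ+1, ℓ+m]`. -/
noncomputable def aPoly (k : ℝ) (l m : ℕ) (α : Comp N) : Poly N :=
  calE k (-1) (interval N l m) (revI l m α) •
    ∑ w ∈ symI (interval N l m),
      (sgn w / calE k (-1) (interval N l m) (act w α)) • zeta k (act w α)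

/-- The inner products considered: symmetric bilinear forms on polynomials for which every
operator `f ↦ T_i (x_i f)` is self-adjoint and which are invariant under permutations.
Positivity is not required, so the genuine inner products are included. -/
structure IsPermissible (k : ℝ) (B : LinearMap.BilinForm ℝ (Poly N)) : Prop where
  symm : ∀ f g, B f g = B g f
  selfAdjoint : ∀ (i : Fin N) (f g), B (dunkl k i (X i * f)) g = B f (dunkl k i (X i * g))
  invariant : ∀ (w : Equiv.Perm (Fin N)) (f g), B (perm w f) g = B f (perm w⁻¹ g)

/-- Evaluation at the point `1^N = (1, …, 1)`. -/
noncomputable def evalOne (f : Poly N) : ℝ := eval (fun _ => (1 : ℝ)) f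

end NSJack

namespace NSJack

open MvPolynomial

variable {N : ℕ}

/-! ### The permutation action and the operators -/

/-! The polynomials `ζ_β`, `β ∈ S_I α`, behave like a seminormal basis. Let `s` exchange adjacent
indices `i`, `i'` in `I`. If `β_i > β_{i'}`, then `s` preserves the plane of `ζ_β` and `ζ_{sβ}` and
acts there by an explicit matrix in `c = k / (κ_i(β) - κ_{i'}(β))`. If the two entries agree, `s`
fixes `ζ_β`. See `perm_swap_monic`, `perm_swap_monic_act` and `perm_swap_monic_of_eq`. Passing from
`β` to `sβ` multiplies `E_ε` by exactly `1 + εc` (`calE_act_swap`), which is what makes the weighted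
pair of `ζ_β` and `ζ_{sβ}` an `ε`-eigenvector of `s` (`perm_swap_pair`). Summing over such pairs
gives the invariance of `j` and the antisymmetry of `a`.

Uniqueness is a cyclicity statement: `0 ≤ c < 1`, so each `ζ_{wα}` is a combination of translates of
`ζ_α` (`spaceX_le_transSpan`), and symmetrising or antisymmetrising these translates yields at most
a line (`exists_equivariant_generator`). The expansions in the `g_β` then follow by comparing a
single coefficient, that of `p_{α^R}`: it occurs with coefficient one in `ζ_{α^R}` and in `w ζ_α`
with `wα = α^R`, and in no other term of either sum. The value at `1^N` is read off from that
expansion. For the norm, one factor is written as a sum of translates of `ζ_α`. Equivariance moves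
each translation to the other factor, and orthogonality leaves only the coefficient of `ζ_α` there.

All this rests on the joint spectrum of the `U_i` being simple. The kernel `F_k(x, y)` is unchanged
when `x` and `y` are exchanged, and so is its image under each `T_i x_i`. Hence the matrix of `U_i`
in the `p_β` is the transpose of its matrix in the monomials (`pBasis_repr_linU`). The latter is
triangular for the order `DomLE` with diagonal `κ_i(β)` (`linU_mono`). Since `α ↦ κ(α)` is
injective, a joint eigenfunction is determined up to a scalar by its eigenvalues, which form some
`κ(α)`, and `p_α` is its least term (`jointEigen_support`). That the `p_β` form a basis comes from
positive definiteness of the kernel (`pairing_genFun_pos`).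

Existence does not use commutativity of the `U_i`: eigenfunctions are built from `1` by a raising
operator and by intertwiners attached to adjacent transpositions (`exists_jointEigen`). The
eigenfunction normalised at `p_α` is then identified with `ζ_α` (`zeta_eq_monic`). -/

theorem perm_def (w : Equiv.Perm (Fin N)) (f : Poly N) :
    perm w f = rename (w : Fin N → Fin N) f := rfl

@[simp] theorem perm_X (w : Equiv.Perm (Fin N)) (i : Fin N) :
    perm w (X i : Poly N) = X (w i) := by simp [perm_def]

theorem perm_mul (w : Equiv.Perm (Fin N)) (f g : Poly N) :
    perm w (f * g) = perm w f * perm w g := by simp [perm_def]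

theorem perm_comp (v w : Equiv.Perm (Fin N)) (f : Poly N) :
    perm (v * w) f = perm v (perm w f) := by
  simp [perm_def, rename_rename, Equiv.Perm.coe_mul]

@[simp] theorem perm_one (f : Poly N) : perm 1 f = f := by
  simp [perm_def]

@[simp] theorem perm_inv_perm (w : Equiv.Perm (Fin N)) (f : Poly N) :
    perm w⁻¹ (perm w f) = f := by
  rw [← perm_comp]; simp

@[simp] theorem perm_perm_inv (w : Equiv.Perm (Fin N)) (f : Poly N) :
    perm w (perm w⁻¹ f) = f := by
  rw [← perm_comp]; simp

@[simp] theorem perm_swap_swap (i j : Fin N) (f : Poly N) :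
    perm (Equiv.swap i j) (perm (Equiv.swap i j) f) = f := by
  rw [← perm_comp]; simp

theorem X_sub_X_ne_zero {i j : Fin N} (h : i ≠ j) : (X i - X j : Poly N) ≠ 0 :=
  sub_ne_zero.2 fun e => h (X_injective e)

theorem divDiff_eq {i j : Fin N} (h : i ≠ j) {f g : Poly N}
    (e : f - perm (Equiv.swap i j) f = (X i - X j) * g) : divDiff i j f = g :=
  mul_left_cancel₀ (X_sub_X_ne_zero h) ((divDiff_spec i j f).symm.trans e)

theorem divDiff_add {i j : Fin N} (h : i ≠ j) (f g : Poly N) :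
    divDiff i j (f + g) = divDiff i j f + divDiff i j g := by
  apply divDiff_eq h
  rw [mul_add, ← divDiff_spec, ← divDiff_spec, map_add]; ring

theorem divDiff_smul {i j : Fin N} (h : i ≠ j) (c : ℝ) (f : Poly N) :
    divDiff i j (c • f) = c • divDiff i j f := by
  apply divDiff_eq h
  rw [mul_smul_comm, ← divDiff_spec, map_smul, smul_sub]

theorem divDiff_perm {i j : Fin N} (h : i ≠ j) (w : Equiv.Perm (Fin N)) (f : Poly N) :
    divDiff (w i) (w j) (perm w f) = perm w (divDiff i j f) := by
  apply divDiff_eq (w.injective.ne h)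
  have e : Equiv.swap (w i) (w j) * w = w * Equiv.swap i j := by
    rw [Equiv.swap_apply_apply]; group
  rw [← perm_comp, e, perm_comp, ← map_sub, divDiff_spec, perm_mul, map_sub, perm_X, perm_X]

theorem divDiff_X_mul_left {i j : Fin N} (h : i ≠ j) (f : Poly N) :
    divDiff i j (X i * f) = X i * divDiff i j f + perm (Equiv.swap i j) f := by
  apply divDiff_eq h
  have e := divDiff_spec i j f
  rw [perm_mul, perm_X, Equiv.swap_apply_left]
  linear_combination X i * e

theorem divDiff_X_mul_right {i j : Fin N} (h : i ≠ j) (f : Poly N) :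
    divDiff i j (X j * f) = X j * divDiff i j f - perm (Equiv.swap i j) f := by
  apply divDiff_eq h
  have e := divDiff_spec i j f
  rw [perm_mul, perm_X, Equiv.swap_apply_right]
  linear_combination X j * e

theorem divDiff_X_mul_of_ne {i j l : Fin N} (h : i ≠ j) (hi : l ≠ i) (hj : l ≠ j) (f : Poly N) :
    divDiff i j (X l * f) = X l * divDiff i j f := by
  apply divDiff_eq h
  have e := divDiff_spec i j f
  rw [perm_mul, perm_X, Equiv.swap_apply_of_ne_of_ne hi hj]
  linear_combination X l * e

theorem dunkl_add (k : ℝ) (i : Fin N) (f g : Poly N) :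
    dunkl k i (f + g) = dunkl k i f + dunkl k i g := by
  simp only [dunkl]
  rw [Finset.sum_congr rfl fun j hj => divDiff_add (Finset.ne_of_mem_erase hj).symm f g,
    Finset.sum_add_distrib, map_add, smul_add]
  abel

theorem dunkl_smul (k : ℝ) (i : Fin N) (c : ℝ) (f : Poly N) :
    dunkl k i (c • f) = c • dunkl k i f := by
  simp only [dunkl]
  rw [Finset.sum_congr rfl fun j hj => divDiff_smul (Finset.ne_of_mem_erase hj).symm c f,
    ← Finset.smul_sum, Derivation.map_smul, smul_add, smul_comm k c]

/-- The operator `f ↦ T_i (x_i f)` as a linear map. -/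
noncomputable def dunklX (k : ℝ) (i : Fin N) : Poly N →ₗ[ℝ] Poly N where
  toFun f := dunkl k i (X i * f)
  map_add' f g := by rw [mul_add, dunkl_add]
  map_smul' c f := by rw [mul_smul_comm, dunkl_smul]; rfl

theorem dunklX_apply (k : ℝ) (i : Fin N) (f : Poly N) :
    dunklX k i f = dunkl k i (X i * f) := rfl

/-- `U_i` as a linear map. -/
noncomputable def linU (k : ℝ) (i : Fin N) : Poly N →ₗ[ℝ] Poly N :=
  dunklX k i + k • LinearMap.id - k • ∑ j ∈ Finset.Iio i, perm (Equiv.swap i j)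

theorem linU_apply (k : ℝ) (i : Fin N) (f : Poly N) : linU k i f = opU k i f := by
  simp [linU, opU, dunklX_apply]

theorem pderiv_perm (w : Equiv.Perm (Fin N)) (i : Fin N) (f : Poly N) :
    pderiv (w i) (perm w f) = perm w (pderiv i f) := by
  rw [perm_def, perm_def, pderiv_rename w.injective]

theorem dunkl_perm (k : ℝ) (w : Equiv.Perm (Fin N)) (i : Fin N) (f : Poly N) :
    dunkl k (w i) (perm w f) = perm w (dunkl k i f) := by
  simp only [dunkl, map_add, map_smul, map_sum, pderiv_perm]
  congr 2
  symm
  refine Finset.sum_nbij' (fun j => w j) (fun j => w⁻¹ j) ?_ ?_ ?_ ?_ ?_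
  · intro j hj; simpa using hj
  · intro j hj
    simp only [Finset.mem_erase, Finset.mem_univ, and_true] at hj ⊢
    rintro rfl; simp at hj
  · intro j _; simp
  · intro j _; simp
  · intro j hj
    rw [divDiff_perm (Finset.ne_of_mem_erase hj).symm]

theorem dunklX_perm (k : ℝ) (w : Equiv.Perm (Fin N)) (i : Fin N) (f : Poly N) :
    dunklX k (w i) (perm w f) = perm w (dunklX k i f) := by
  rw [dunklX_apply, dunklX_apply, ← dunkl_perm, perm_mul, perm_X]

theorem dunkl_X_mul_self (k : ℝ) (i : Fin N) (f : Poly N) :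
    dunkl k i (X i * f) = X i * dunkl k i f + f
      + k • ∑ j ∈ Finset.univ.erase i, perm (Equiv.swap i j) f := by
  simp only [dunkl]
  rw [Finset.sum_congr rfl fun j hj => divDiff_X_mul_left (Finset.ne_of_mem_erase hj).symm f,
    Finset.sum_add_distrib, ← Finset.mul_sum, Derivation.leibniz, pderiv_X_self]
  simp only [smul_add, smul_eq_mul, mul_add, mul_smul_comm]
  ring

theorem dunkl_X_mul_of_ne (k : ℝ) {i l : Fin N} (h : l ≠ i) (f : Poly N) :
    dunkl k i (X l * f) = X l * dunkl k i f - k • perm (Equiv.swap i l) f := by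
  simp only [dunkl]
  have hl : l ∈ Finset.univ.erase i := by simp [h]
  have e : ∀ j ∈ (Finset.univ.erase i).erase l,
      divDiff i j (X l * f) = X l * divDiff i j f := by
    intro j hj
    simp only [Finset.mem_erase] at hj
    exact divDiff_X_mul_of_ne (Ne.symm hj.2.1) h (Ne.symm hj.1) f
  rw [← Finset.add_sum_erase _ _ hl, ← Finset.add_sum_erase _ _ hl, Finset.sum_congr rfl e,
    ← Finset.mul_sum, Derivation.leibniz, pderiv_X_of_ne h, divDiff_X_mul_right h.symm]
  simp only [smul_add, smul_sub, smul_eq_mul, mul_add, mul_smul_comm, mul_zero]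
  ring

/-! ### Adjacent transpositions and the raising operator -/

/-- Joint eigenfunctions of the `U_i`. -/
def JointEigen (k : ℝ) (μ : Fin N → ℝ) (f : Poly N) : Prop :=
  ∀ i, linU k i f = μ i • f

theorem JointEigen.smul {k : ℝ} {μ : Fin N → ℝ} {f : Poly N} (h : JointEigen k μ f) (c : ℝ) :
    JointEigen k μ (c • f) := fun i => by rw [map_smul, h i, smul_comm]

theorem JointEigen.sub {k : ℝ} {μ : Fin N → ℝ} {f g : Poly N} (h : JointEigen k μ f)
    (h' : JointEigen k μ g) : JointEigen k μ (f - g) := fun i => by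
  rw [map_sub, h i, h' i, smul_sub]

theorem linU_eq (k : ℝ) (i : Fin N) (f : Poly N) :
    linU k i f = dunklX k i f + k • f - k • ∑ j ∈ Finset.Iio i, perm (Equiv.swap i j) f := by
  simp [linU]

theorem swap_conj_swap (i i' j : Fin N) (f : Poly N) :
    perm (Equiv.swap i i') (perm (Equiv.swap i j) (perm (Equiv.swap i i') f))
      = perm (Equiv.swap (Equiv.swap i i' i) (Equiv.swap i i' j)) f := by
  rw [← perm_comp, ← perm_comp, Equiv.swap_apply_apply]
  simp [mul_assoc]

theorem Iio_adjacent {i i' : Fin N} (h : (i : ℕ) + 1 = i') :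
    Finset.Iio i' = insert i (Finset.Iio i) := by
  ext j; simp only [Finset.mem_Iio, Finset.mem_insert, Fin.lt_def, Fin.ext_iff]; omega

/-- Conjugation carries `T_i x_i` to `T_{i'} x_{i'}`. The transposition sum in `U_{i'}` has one term
more than that in `U_i`, namely `j = i`, which accounts for the correction. This is the degenerate
affine Hecke relation. -/
theorem perm_swap_linU {i i' : Fin N} (h : (i : ℕ) + 1 = i') (k : ℝ) (f : Poly N) :
    perm (Equiv.swap i i') (linU k i (perm (Equiv.swap i i') f))
      = linU k i' f + k • perm (Equiv.swap i i') f := by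
  have e := dunklX_perm k (Equiv.swap i i') i (perm (Equiv.swap i i') f)
  rw [Equiv.swap_apply_left, perm_swap_swap] at e
  have e2 : ∀ j ∈ Finset.Iio i, perm (Equiv.swap i i') (perm (Equiv.swap i j)
      (perm (Equiv.swap i i') f)) = perm (Equiv.swap i' j) f := by
    intro j hj
    have hj' : (j : ℕ) < i := by simpa using hj
    rw [swap_conj_swap, Equiv.swap_apply_left, Equiv.swap_apply_of_ne_of_ne]
    · intro e; simp [e] at hj'
    · intro e; rw [e] at hj'; omega
  rw [linU_eq, linU_eq, Iio_adjacent h, Finset.sum_insert (by simp), map_sub, map_add, ← e,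
    map_smul, map_smul, map_sum, Finset.sum_congr rfl e2, perm_swap_swap, Equiv.swap_comm i' i,
    smul_add]
  abel

theorem linU_left_perm_swap {i i' : Fin N} (h : (i : ℕ) + 1 = i') (k : ℝ) (f : Poly N) :
    linU k i (perm (Equiv.swap i i') f) = perm (Equiv.swap i i') (linU k i' f) + k • f := by
  have e := congrArg (perm (Equiv.swap i i')) (perm_swap_linU h k f)
  rwa [perm_swap_swap, map_add, map_smul, perm_swap_swap] at e

theorem linU_right_perm_swap {i i' : Fin N} (h : (i : ℕ) + 1 = i') (k : ℝ) (f : Poly N) :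
    linU k i' (perm (Equiv.swap i i') f) = perm (Equiv.swap i i') (linU k i f) - k • f := by
  have e := perm_swap_linU h k (perm (Equiv.swap i i') f)
  rw [perm_swap_swap] at e
  rw [e]; abel

theorem linU_perm_swap_of_ne {i i' : Fin N} (h : (i : ℕ) + 1 = i') (k : ℝ) {t : Fin N}
    (ht : t ≠ i) (ht' : t ≠ i') (f : Poly N) :
    linU k t (perm (Equiv.swap i i') f) = perm (Equiv.swap i i') (linU k t f) := by
  have e := dunklX_perm k (Equiv.swap i i') t f
  have hst : Equiv.swap i i' t = t := Equiv.swap_apply_of_ne_of_ne ht ht'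
  rw [hst] at e
  rw [linU_eq, linU_eq, e, map_sub, map_add, map_smul, map_smul, map_sum]
  congr 2
  refine Finset.sum_nbij' (fun j => Equiv.swap i i' j) (fun j => Equiv.swap i i' j)
    ?_ ?_ ?_ ?_ ?_
  · intro j hj
    simp only [Finset.mem_Iio, Fin.lt_def, Equiv.swap_apply_def, Fin.ext_iff, ne_eq] at *
    split_ifs <;> omega
  · intro j hj
    simp only [Finset.mem_Iio, Fin.lt_def, Equiv.swap_apply_def, Fin.ext_iff, ne_eq] at *
    split_ifs <;> omega
  · intro j _; simp
  · intro j _; simp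
  · intro j _
    rw [← perm_comp, ← perm_comp]
    congr 2
    conv_rhs => rw [show Equiv.swap t (Equiv.swap i i' j)
      = Equiv.swap (Equiv.swap i i' t) (Equiv.swap i i' j) by rw [hst], Equiv.swap_apply_apply]
    simp [mul_assoc]

/-- The intertwiner: the term `k f` absorbs the correction in the Hecke relation. The result may
vanish, so nonvanishing is a separate matter. -/
theorem JointEigen.swap {k : ℝ} {μ : Fin N → ℝ} {f : Poly N} (hf : JointEigen k μ f)
    {i i' : Fin N} (h : (i : ℕ) + 1 = i') :
    JointEigen k (μ ∘ Equiv.swap i i') ((μ i - μ i') • perm (Equiv.swap i i') f - k • f) := by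
  intro t
  rw [map_sub, map_smul, map_smul, hf t]
  by_cases h1 : t = i
  · subst h1
    rw [linU_left_perm_swap h, hf i']
    simp only [Function.comp, Equiv.swap_apply_left, map_smul]
    module
  by_cases h2 : t = i'
  · subst h2
    rw [linU_right_perm_swap h, hf i]
    simp only [Function.comp, Equiv.swap_apply_right, map_smul]
    module
  · rw [linU_perm_swap_of_ne h k h1 h2, hf t]
    simp only [Function.comp, Equiv.swap_apply_of_ne_of_ne h1 h2, map_smul]
    module

/-- The raising operator `f(x_1, …, x_N) ↦ x_N f(x_N, x_1, …, x_{N-1})`. -/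
noncomputable def raise {n : ℕ} (f : Poly (n + 1)) : Poly (n + 1) :=
  X (Fin.last n) * perm (finRotate (n + 1))⁻¹ f

theorem finRotate_inv_zero (n : ℕ) : (finRotate (n + 1))⁻¹ 0 = Fin.last n := by
  rw [Equiv.Perm.inv_eq_iff_eq, finRotate_last]

theorem finRotate_inv_succ {n : ℕ} (i : Fin n) : (finRotate (n + 1))⁻¹ i.succ = i.castSucc := by
  rw [Equiv.Perm.inv_eq_iff_eq, finRotate_apply]; simp

theorem raise_ne_zero {n : ℕ} {f : Poly (n + 1)} (hf : f ≠ 0) : raise f ≠ 0 := by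
  refine mul_ne_zero (X_ne_zero _) fun e => hf ?_
  rw [← perm_perm_inv (finRotate (n+1))⁻¹⁻¹ f, inv_inv, e, map_zero]

/-- For the last index the condition `j ≠ i` is the condition `j < i`, so the transpositions
produced by commuting `T_N` past `x_N` cancel those subtracted in `U_N`. -/
theorem linU_last_raise {n : ℕ} (k : ℝ) (f : Poly (n + 1)) :
    linU k (Fin.last n) (raise f) = raise (linU k 0 f + f) := by
  set π := (finRotate (n + 1))⁻¹ with hπ
  have e := dunklX_perm k π 0 f
  rw [hπ, finRotate_inv_zero, ← hπ, dunklX_apply] at e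
  have hI : (Finset.univ.erase (Fin.last n)) = Finset.Iio (Fin.last n) := by
    ext j; simp only [Finset.mem_erase, Finset.mem_univ, and_true, Finset.mem_Iio,
      Fin.lt_last_iff_ne_last, ne_eq]
  have hI0 : Finset.Iio (0 : Fin (n + 1)) = ∅ := by ext j; simp
  rw [linU_eq, linU_eq, hI0, Finset.sum_empty, smul_zero, sub_zero, raise, raise, ← hπ,
    dunklX_apply, dunkl_X_mul_self, e, hI, map_add, map_add, map_smul]
  rw [mul_add, mul_add, mul_smul_comm]
  abel

/-- Commuting `T_i` past `x_N` leaves one transposition with the last index. It is the rotated image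
of the term of `U_{i+1}` that involves the first index, which the sum over smaller indices has lost.
-/
theorem linU_castSucc_raise {n : ℕ} (k : ℝ) (i : Fin n) (f : Poly (n + 1)) :
    linU k i.castSucc (raise f) = raise (linU k i.succ f) := by
  set π := (finRotate (n + 1))⁻¹ with hπ
  have e := dunklX_perm k π i.succ f
  rw [hπ, finRotate_inv_succ, ← hπ, dunklX_apply] at e
  have hne : Fin.last n ≠ i.castSucc := (Fin.castSucc_lt_last i).ne'
  have hsum : perm π (∑ j ∈ Finset.Iio i.succ, perm (Equiv.swap i.succ j) f)
      = perm (Equiv.swap i.castSucc (Fin.last n)) (perm π f)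
        + ∑ j ∈ Finset.Iio i.castSucc, perm (Equiv.swap i.castSucc j) (perm π f) := by
    have hc : ∀ j, perm π (perm (Equiv.swap i.succ j) f)
        = perm (Equiv.swap i.castSucc (π j)) (perm π f) := by
      intro j
      rw [← perm_comp, ← perm_comp, ← finRotate_inv_succ, ← hπ, Equiv.swap_apply_apply]
      simp [mul_assoc]
    rw [map_sum, Finset.sum_congr rfl fun j _ => hc j]
    have hs : Finset.Iio i.succ = insert 0 ((Finset.Iio i).map (Fin.succEmb n)) := by
      ext j; refine Fin.cases ?_ (fun j => ?_) j <;> simp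
    have hs' : Finset.Iio i.castSucc = (Finset.Iio i).map Fin.castSuccEmb := by
      simp
    rw [hs, Finset.sum_insert (by simp), hs', Finset.sum_map, Finset.sum_map,
      hπ, finRotate_inv_zero]
    simp [finRotate_inv_succ, -Fin.map_castSuccEmb_Iio]
  have hfix : ∀ j ∈ Finset.Iio i.castSucc, perm (Equiv.swap i.castSucc j)
      (X (Fin.last n) * perm π f) = X (Fin.last n) * perm (Equiv.swap i.castSucc j) (perm π f) := by
    intro j hj
    have : j < i.castSucc := by simpa using hj
    rw [perm_mul, perm_X, Equiv.swap_apply_of_ne_of_ne hne]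
    exact (this.trans (Fin.castSucc_lt_last i)).ne'
  rw [linU_eq, linU_eq, raise, raise, ← hπ, dunklX_apply,
    show X i.castSucc * (X (Fin.last n) * perm π f) = X (Fin.last n) * (X i.castSucc * perm π f) by
      ring, dunkl_X_mul_of_ne k hne, e, map_sub, map_add, map_smul, map_smul, hsum,
    perm_mul, perm_X, Equiv.swap_apply_left, Finset.sum_congr rfl hfix, ← Finset.mul_sum]
  simp only [smul_add, mul_add, mul_sub, mul_smul_comm]
  abel

theorem raise_smul {n : ℕ} (c : ℝ) (f : Poly (n + 1)) : raise (c • f) = c • raise f := by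
  rw [raise, raise, map_smul, mul_smul_comm]

theorem JointEigen.raise {n : ℕ} {k : ℝ} {μ : Fin (n + 1) → ℝ} {f : Poly (n + 1)}
    (hf : JointEigen k μ f) :
    JointEigen k (Fin.snoc (fun i : Fin n => μ i.succ) (μ 0 + 1)) (raise f) := by
  intro i
  refine Fin.lastCases ?_ (fun i => ?_) i
  · rw [linU_last_raise, hf 0, Fin.snoc_last, ← raise_smul, add_smul, one_smul]
  · rw [linU_castSucc_raise, hf, Fin.snoc_castSucc, raise_smul]

/-! ### Ranks and the eigenvalues `κ` -/

/-- `s` comes strictly before `i` when the positions of `α` are sorted by decreasing entry. -/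
def Prec (α : Comp N) (s i : Fin N) : Prop := α i < α s ∨ (s < i ∧ α s = α i)

instance (α : Comp N) (s i : Fin N) : Decidable (Prec α s i) := by
  unfold Prec; infer_instance

/-- The number of positions before `i` in the sorted order. -/
def rank (α : Comp N) (i : Fin N) : ℕ := (Finset.univ.filter fun s => Prec α s i).card

theorem kappa_eq_rank (k : ℝ) (α : Comp N) (i : Fin N) :
    kappa k α i = N * k - k * rank α i + α i + 1 := by
  have : rank α i = (Finset.univ.filter fun s => α i < α s).card
      + (Finset.univ.filter fun s => s < i ∧ α s = α i).card := by
    rw [← Finset.card_union_of_disjoint]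
    · rw [← Finset.filter_or]; rfl
    · rw [Finset.disjoint_filter]
      rintro s _ h ⟨_, h'⟩
      omega
  rw [kappa, this]; push_cast; ring

theorem Prec.trans {α : Comp N} {s t i : Fin N} (h : Prec α s t) (h' : Prec α t i) :
    Prec α s i := by
  rcases h with h | ⟨h1, h2⟩ <;> rcases h' with h' | ⟨h3, h4⟩
  · exact Or.inl (h'.trans h)
  · exact Or.inl (by omega)
  · exact Or.inl (by omega)
  · exact Or.inr ⟨h1.trans h3, by omega⟩

theorem Prec.irrefl (α : Comp N) (i : Fin N) : ¬ Prec α i i := by simp [Prec]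

theorem Prec.total (α : Comp N) {s i : Fin N} (h : s ≠ i) : Prec α s i ∨ Prec α i s := by
  unfold Prec
  rcases lt_or_gt_of_ne h with h | h <;> rcases lt_trichotomy (α s) (α i) with h' | h' | h' <;>
    simp [h, h']

theorem Prec.le {α : Comp N} {s i : Fin N} (h : Prec α s i) : α i ≤ α s := by
  rcases h with h | ⟨_, h⟩ <;> omega

theorem Prec.rank_lt {α : Comp N} {s i : Fin N} (h : Prec α s i) : rank α s < rank α i := by
  apply Finset.card_lt_card
  rw [Finset.ssubset_iff_of_subset]
  · exact ⟨s, by simp [h], by simp [Prec.irrefl]⟩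
  · intro t ht
    simp only [Finset.mem_filter, Finset.mem_univ, true_and] at *
    exact ht.trans h

/-- The entries differ by at least one and the ranks by at least one. This gap keeps every factor of
`E_ε` positive and every intertwiner nonzero. -/
theorem kappa_sub_ge {k : ℝ} (hk : 0 ≤ k) {α : Comp N} {s i : Fin N} (h : α i < α s) :
    1 + k ≤ kappa k α s - kappa k α i := by
  have h1 : (rank α s : ℝ) + 1 ≤ rank α i := by
    exact_mod_cast (Prec.rank_lt (Or.inl h) : rank α s < rank α i)
  have h2 : (α i : ℝ) + 1 ≤ α s := by exact_mod_cast h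
  rw [kappa_eq_rank, kappa_eq_rank]
  nlinarith

theorem kappa_lt_of_prec {k : ℝ} (hk : 0 < k) {α : Comp N} {s i : Fin N} (h : Prec α s i) :
    kappa k α i < kappa k α s := by
  have h1 : (rank α s : ℝ) + 1 ≤ rank α i := by exact_mod_cast h.rank_lt
  have h2 : (α i : ℝ) ≤ α s := by exact_mod_cast h.le
  rw [kappa_eq_rank, kappa_eq_rank]
  nlinarith

theorem prec_iff_kappa_lt {k : ℝ} (hk : 0 < k) {α : Comp N} {s i : Fin N} :
    Prec α s i ↔ kappa k α i < kappa k α s := by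
  refine ⟨kappa_lt_of_prec hk, fun h => ?_⟩
  have hne : s ≠ i := by rintro rfl; exact lt_irrefl _ h
  exact (Prec.total α hne).resolve_right fun h' => lt_asymm h (kappa_lt_of_prec hk h')

/-- For `k > 0` the values `κ` are strictly decreasing along the sorted order, so they determine the
ranks and hence the entries. The permutation is allowed so that eigenvalue lists known only after an
exchange of indices can be recognised. -/
theorem eq_of_kappa_eq {k : ℝ} (hk : 0 ≤ k) {α β : Comp N} (w : Equiv.Perm (Fin N))
    (h : ∀ i, kappa k β i = kappa k α (w i)) (i : Fin N) : β i = α (w i) := by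
  have hr : k * rank β i = k * rank α (w i) := by
    -- At `k = 0` the ranks cannot be recovered, but they also do not enter `κ`.
    rcases hk.eq_or_lt with rfl | hk
    · simp
    · congr 2
      apply Finset.card_nbij' w w.symm
      · intro s hs
        simpa [prec_iff_kappa_lt hk, h] using hs
      · intro s hs
        simpa [prec_iff_kappa_lt hk, h] using hs
      · intro s _; simp
      · intro s _; simp
  have e := h i
  rw [kappa_eq_rank, kappa_eq_rank, hr] at e
  have : (β i : ℝ) = α (w i) := by linarith
  exact_mod_cast this

theorem kappa_injective {k : ℝ} (hk : 0 ≤ k) {α β : Comp N} (h : kappa k α = kappa k β) :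
    α = β := funext fun i => eq_of_kappa_eq hk 1 (fun i => by simp [h]) i

theorem kappa_adjacent_of_eq (k : ℝ) {α : Comp N} {i i' : Fin N} (h : (i : ℕ) + 1 = i')
    (e : α i = α i') : kappa k α i - kappa k α i' = k := by
  have : rank α i' = rank α i + 1 := by
    unfold rank
    rw [← Finset.card_insert_of_notMem (a := i)]
    · congr 1
      ext s
      simp only [Prec, Finset.mem_filter, Finset.mem_univ, true_and, Finset.mem_insert, Fin.lt_def,
        Fin.ext_iff, e]
      constructor
      · rintro (h1 | ⟨h1, h2⟩)
        · tauto
        · rcases Nat.lt_or_ge s i with h3 | h3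
          · tauto
          · left; omega
      · rintro (h1 | h1 | h1)
        · right; exact ⟨by omega, by rw [Fin.ext h1, e]⟩
        · tauto
        · right; exact ⟨by omega, h1.2⟩
    · simp only [Finset.mem_filter, Finset.mem_univ, true_and, Prec, e]
      simp
  rw [kappa_eq_rank, kappa_eq_rank, this, e]; push_cast; ring

theorem act_swap_apply (i j : Fin N) (α : Comp N) (t : Fin N) :
    act (Equiv.swap i j) α t = α (Equiv.swap i j t) := by simp [act]

/-- Exchanging adjacent positions alters only the relative order of those two, and unequal entries
are compared without regard to position. -/
theorem rank_act_swap {α : Comp N} {i i' : Fin N} (h : (i : ℕ) + 1 = i') (e : α i ≠ α i')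
    (t : Fin N) : rank (act (Equiv.swap i i') α) t = rank α (Equiv.swap i i' t) := by
  have key : ∀ s t, Prec α (Equiv.swap i i' s) (Equiv.swap i i' t) ↔
      Prec (act (Equiv.swap i i') α) s t := by
    intro s t
    simp only [Prec, act_swap_apply]
    refine or_congr Iff.rfl (and_congr_left fun hst => ?_)
    simp only [Equiv.swap_apply_def] at hst ⊢
    split_ifs at hst ⊢ with h1 h2 h3 h4 h5 h6 h7 <;> subst_vars <;>
      simp only [Fin.lt_def, Fin.ext_iff] at * <;> omega
  apply Finset.card_nbij' (Equiv.swap i i') (Equiv.swap i i')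
  · intro s hs; simpa [key] using hs
  · intro s hs; simpa [← key] using hs
  · intro s _; simp
  · intro s _; simp

theorem kappa_act_swap (k : ℝ) {α : Comp N} {i i' : Fin N} (h : (i : ℕ) + 1 = i')
    (e : α i ≠ α i') : kappa k (act (Equiv.swap i i') α) = kappa k α ∘ Equiv.swap i i' := by
  funext t
  simp only [Function.comp]
  rw [kappa_eq_rank, kappa_eq_rank, rank_act_swap h e, act_swap_apply]

/-- The first position wins all ties. Moved to the end it would lose them, but raising its entry by
one turns those ties into strict inequalities, so no rank changes. -/
theorem kappa_snoc {n : ℕ} (k : ℝ) (α : Comp (n + 1)) :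
    kappa k (Fin.snoc (fun i : Fin n => α i.succ) (α 0 + 1) : Comp (n + 1))
      = Fin.snoc (fun i : Fin n => kappa k α i.succ) (kappa k α 0 + 1) := by
  have hr : ∀ i : Fin n,
      rank (Fin.snoc (fun i : Fin n => α i.succ) (α 0 + 1) : Comp (n + 1)) i.castSucc
        = rank α i.succ := by
    intro i
    simp only [rank, Finset.card_filter]
    rw [Fin.sum_univ_castSucc, Fin.sum_univ_succ, add_comm]
    simp only [Prec, Fin.snoc_castSucc (α := fun _ => ℕ), Fin.snoc_last (α := fun _ => ℕ),
      Fin.castSucc_lt_castSucc_iff, Fin.succ_lt_succ_iff, Fin.succ_pos, true_and]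
    congr 1
    simp only [(Fin.castSucc_lt_last i).not_gt, false_and, or_false]
    exact if_congr (by omega) rfl rfl
  have hl : rank (Fin.snoc (fun i : Fin n => α i.succ) (α 0 + 1) : Comp (n + 1)) (Fin.last n)
      = rank α 0 := by
    simp only [rank, Finset.card_filter]
    rw [Fin.sum_univ_castSucc, Fin.sum_univ_succ, add_comm]
    simp only [Prec, Fin.snoc_castSucc (α := fun _ => ℕ), Fin.snoc_last (α := fun _ => ℕ)]
    congr 1
    · simp
    · refine Finset.sum_congr rfl fun x _ => ?_
      simp only [Fin.castSucc_lt_last, true_and, Fin.not_lt_zero, false_and, or_false]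
      exact if_congr (by omega) rfl rfl
  funext i
  refine Fin.lastCases ?_ (fun i => ?_) i
  · rw [Fin.snoc_last, kappa_eq_rank, kappa_eq_rank, hl, Fin.snoc_last (α := fun _ => ℕ)]
    push_cast; ring
  · rw [Fin.snoc_castSucc, kappa_eq_rank, kappa_eq_rank, hr, Fin.snoc_castSucc (α := fun _ => ℕ)]

/-! ### Power series in `y` with coefficients in the polynomials in `x` -/

/-- Power series in `y` over the polynomials in `x`. -/
abbrev Kern (N : ℕ) : Type := MvPowerSeries (Fin N) (Poly N)

namespace Kern

/-- Apply a map to all coefficients. -/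
noncomputable def cmap (φ : Poly N → Poly N) (F : Kern N) : Kern N := fun m => φ (MvPowerSeries.coeff m F)

@[simp] theorem coeff_cmap (φ : Poly N → Poly N) (F : Kern N) (m : Fin N →₀ ℕ) :
    MvPowerSeries.coeff m (cmap φ F) = φ (MvPowerSeries.coeff m F) := rfl

theorem coeff_smul_real (c : ℝ) (F : Kern N) (m : Fin N →₀ ℕ) :
    MvPowerSeries.coeff m (c • F) = c • MvPowerSeries.coeff m F := rfl

/-- The monomial `x_i y_j`. -/
noncomputable def z (i j : Fin N) : Kern N := MvPowerSeries.monomial (Finsupp.single j 1) (X i)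

theorem z_eq (i j : Fin N) : z i j = MvPowerSeries.C (X i) * MvPowerSeries.X j := by
  ext1 m
  rw [z, MvPowerSeries.coeff_C_mul, MvPowerSeries.coeff_X, MvPowerSeries.coeff_monomial]
  split_ifs <;> simp

theorem coeff_z_mul (i j : Fin N) (F : Kern N) (m : Fin N →₀ ℕ) :
    MvPowerSeries.coeff m (z i j * F)
      = if 1 ≤ m j then X i * MvPowerSeries.coeff (m - Finsupp.single j 1) F else 0 := by
  rw [z, MvPowerSeries.coeff_monomial_mul]
  simp only [Finsupp.single_le_iff]

/-- The series `∑_n g_n y_j^n`. -/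
noncomputable def line (j : Fin N) (g : ℕ → Poly N) : Kern N :=
  fun m => if m = Finsupp.single j (m j) then g (m j) else 0

theorem coeff_line (j : Fin N) (g : ℕ → Poly N) (m : Fin N →₀ ℕ) :
    MvPowerSeries.coeff m (line j g) = if m = Finsupp.single j (m j) then g (m j) else 0 := rfl

theorem z_mul_line (i j : Fin N) (g : ℕ → Poly N) :
    z i j * line j g = line j fun n => if n = 0 then 0 else X i * g (n - 1) := by
  ext1 m
  rw [coeff_z_mul, coeff_line, coeff_line]
  by_cases h : 1 ≤ m j
  · have e : (m - Finsupp.single j 1 = Finsupp.single j ((m - Finsupp.single j 1 : Fin N →₀ ℕ) j))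
        ↔ m = Finsupp.single j (m j) := by
      constructor
      · intro e
        ext t
        have := DFunLike.congr_fun e t
        by_cases ht : t = j
        · subst ht; simp
        · simpa [Finsupp.single_apply, Ne.symm ht] using this
      · intro e
        rw [e]; ext t; by_cases ht : t = j
        · subst ht; simp
        · simp [Ne.symm ht]
    rw [if_pos h]
    simp only [e, mul_ite, mul_zero, if_neg (show m j ≠ 0 by omega)]
    simp
  · rw [if_neg h, if_pos (show m j = 0 by omega), ite_self]

theorem one_eq_line (j : Fin N) : (1 : Kern N) = line j fun n => if n = 0 then 1 else 0 := by
  ext1 m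
  rw [coeff_line, MvPowerSeries.coeff_one]
  by_cases h : m = 0
  · subst h; simp
  · rw [if_neg h]
    split_ifs with h1 h2
    · rw [h2] at h1; simp at h1; exact absurd h1 h
    · rfl
    · rfl

theorem line_sub (j : Fin N) (g h : ℕ → Poly N) : line j g - line j h = line j (g - h) := by
  ext1 m
  rw [map_sub, coeff_line, coeff_line, coeff_line]
  split_ifs <;> simp

theorem line_smul (j : Fin N) (c : ℝ) (g : ℕ → Poly N) : c • line j g = line j (c • g) := by
  ext1 m
  rw [coeff_smul_real, coeff_line, coeff_line]
  split_ifs <;> simp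

theorem cmap_line (j : Fin N) {φ : Poly N → Poly N} (h0 : φ 0 = 0) (g : ℕ → Poly N) :
    cmap φ (line j g) = line j (φ ∘ g) := by
  ext1 m
  rw [coeff_cmap, coeff_line, coeff_line]
  split_ifs <;> simp [h0]

/-- The binomial coefficients `(t)_n / n!`. -/
noncomputable def bc (t : ℝ) (n : ℕ) : ℝ :=
  (ascPochhammer ℝ n).eval t / (Nat.factorial n : ℝ)

theorem bc_zero (t : ℝ) : bc t 0 = 1 := by simp [bc]

theorem bc_succ (t : ℝ) (n : ℕ) : (n + 1 : ℝ) * bc t (n + 1) = (t + n) * bc t n := by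
  have : (Nat.factorial n : ℝ) ≠ 0 := by exact_mod_cast Nat.factorial_ne_zero n
  rw [bc, bc, ascPochhammer_succ_eval, Nat.factorial_succ]
  push_cast
  field_simp

theorem bc_one (n : ℕ) : bc 1 n = 1 := by
  induction n with
  | zero => exact bc_zero 1
  | succ n ih =>
    have h := bc_succ 1 n
    rw [ih, mul_one, add_comm (1 : ℝ)] at h
    exact mul_left_cancel₀ (by positivity) (h.trans (mul_one _).symm)

theorem binomSeries_eq_line (t : ℝ) (i j : Fin N) :
    binomSeries t i j = line j fun n => C (bc t n) * X i ^ n := rfl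

/-- The geometric series `(1 - x_i y_j)^{-1}`. -/
noncomputable abbrev u (i j : Fin N) : Kern N := binomSeries 1 i j

theorem u_eq (i j : Fin N) : u i j = 1 + z i j * u i j := by
  rw [← sub_eq_iff_eq_add, u, binomSeries_eq_line, z_mul_line, line_sub, one_eq_line j]
  congr 1
  funext n
  rcases n with _ | n
  · simp [bc_one]
  · simp [bc_one, pow_succ']

theorem u_mul (i j : Fin N) : u i j * (1 - z i j) = 1 := by
  linear_combination u_eq i j

/-! ### Logarithmic derivatives and the action of `T_i x_i` on the kernel -/

/-- The operator `x_i ∂/∂x_i`. -/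
noncomputable def theta (i : Fin N) (f : Poly N) : Poly N := X i * pderiv i f

theorem theta_zero (i : Fin N) : theta i (0 : Poly N) = 0 := by simp [theta]

theorem cmap_theta_mul (i : Fin N) (F G : Kern N) :
    cmap (theta i) (F * G) = cmap (theta i) F * G + F * cmap (theta i) G := by
  classical
  ext1 m
  rw [coeff_cmap, map_add, MvPowerSeries.coeff_mul, MvPowerSeries.coeff_mul,
    MvPowerSeries.coeff_mul, ← Finset.sum_add_distrib, theta, map_sum, Finset.mul_sum]
  refine Finset.sum_congr rfl fun q _ => ?_
  rw [Derivation.leibniz, coeff_cmap, coeff_cmap, theta, theta, smul_eq_mul, smul_eq_mul]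
  ring

/-- After multiplication by `1 - x_i y_j` this is the recurrence `bc_succ` for the binomial
coefficients, term by term; the geometric series then inverts that factor. -/
theorem cmap_theta_binomSeries (t : ℝ) (i j : Fin N) :
    cmap (theta i) (binomSeries t i j) = binomSeries t i j * (t • (z i j * u i j)) := by
  have h : cmap (theta i) (binomSeries t i j) * (1 - z i j) = t • (z i j * binomSeries t i j) := by
    rw [binomSeries_eq_line, cmap_line j (theta_zero i), mul_comm, sub_mul, one_mul, z_mul_line,
      line_sub, z_mul_line, line_smul]
    congr 1
    funext n
    rcases n with _ | n
    · simp [theta, -C_mul]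
    · have e := congrArg (C (σ := Fin N)) (bc_succ t n)
      simp only [theta, Pi.sub_apply, Pi.smul_apply, Function.comp, Derivation.leibniz,
        Derivation.leibniz_pow, pderiv_C, pderiv_X_self, smul_eq_mul, mul_one,
        Nat.add_sub_cancel, nsmul_eq_mul, MvPolynomial.smul_eq_C_mul,
        Nat.succ_ne_zero, if_false]
      rw [C_mul, C_mul, C_add, C_add, C_1] at e
      have hn : (C (n : ℝ) : Poly N) = (n : Poly N) := by simp
      rw [hn] at e
      rcases n with _ | n
      · push_cast at e ⊢; simp only [pow_zero, mul_zero, mul_one] at e ⊢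
        linear_combination (X i * 1) * e
      · push_cast at e ⊢
        linear_combination (X i ^ (n + 2)) * e
  have e := u_mul i j
  calc cmap (theta i) (binomSeries t i j)
      = cmap (theta i) (binomSeries t i j) * (u i j * (1 - z i j)) := by rw [e, mul_one]
    _ = cmap (theta i) (binomSeries t i j) * (1 - z i j) * u i j := by ring
    _ = t • (z i j * binomSeries t i j) * u i j := by rw [h]
    _ = _ := by rw [smul_mul_assoc, mul_smul_comm]; congr 1; ring

theorem cmap_theta_binomSeries_of_ne (t : ℝ) {i s : Fin N} (h : s ≠ i) (j : Fin N) :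
    cmap (theta i) (binomSeries t s j) = 0 := by
  rw [binomSeries_eq_line, cmap_line j (theta_zero i)]
  ext1 m
  rw [coeff_line]
  simp [theta, Derivation.leibniz, Derivation.leibniz_pow, pderiv_X_of_ne h]

/-- `g` is the logarithmic derivative of `F` for `x_i ∂/∂x_i`. -/
def LogDer (i : Fin N) (F g : Kern N) : Prop := cmap (theta i) F = F * g

theorem LogDer.mul {i : Fin N} {F G f g : Kern N} (h : LogDer i F f) (h' : LogDer i G g) :
    LogDer i (F * G) (f + g) := by
  unfold LogDer at *
  rw [cmap_theta_mul, h, h']; ring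

theorem LogDer.prod {ι : Type*} {i : Fin N} (s : Finset ι) {F f : ι → Kern N}
    (h : ∀ a ∈ s, LogDer i (F a) (f a)) : LogDer i (∏ a ∈ s, F a) (∑ a ∈ s, f a) := by
  classical
  induction s using Finset.induction_on with
  | empty =>
    unfold LogDer
    ext1 m
    rw [Finset.prod_empty, Finset.sum_empty, mul_zero, coeff_cmap, MvPowerSeries.coeff_one]
    split_ifs <;> simp [theta]
  | insert a s ha ih =>
    rw [Finset.prod_insert ha, Finset.sum_insert ha]
    exact (h a (by simp)).mul (ih fun b hb => h b (by simp [hb]))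

theorem logDer_binomSeries (t : ℝ) (i s j : Fin N) :
    LogDer i (binomSeries t s j) (if s = i then t • (z i j * u i j) else 0) := by
  unfold LogDer
  split_ifs with h
  · subst h; exact cmap_theta_binomSeries t s j
  · rw [cmap_theta_binomSeries_of_ne t h, mul_zero]

theorem theta_genFun (k : ℝ) (i : Fin N) :
    cmap (theta i) (genFun N k)
      = genFun N k * (z i i * u i i + k • ∑ j, z i j * u i j) := by
  have h : LogDer i (genFun N k) _ := LogDer.prod Finset.univ fun s _ =>
    (logDer_binomSeries 1 i s s).mul
      (LogDer.prod Finset.univ fun j _ => logDer_binomSeries k i s j)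
  rw [LogDer, Finset.sum_add_distrib] at h
  rw [h]
  congr 2
  · simp
  · rw [Finset.sum_comm, Finset.smul_sum]; simp

theorem map_perm_binomSeries (w : Equiv.Perm (Fin N)) (t : ℝ) (i j : Fin N) :
    cmap (perm w) (binomSeries t i j) = binomSeries t (w i) j := by
  rw [binomSeries_eq_line, binomSeries_eq_line, cmap_line j (map_zero _)]
  congr 1
  funext n
  simp [perm_def]

theorem cmap_perm_eq_map (w : Equiv.Perm (Fin N)) (F : Kern N) :
    cmap (perm w) F = MvPowerSeries.map
      ((rename (w : Fin N → Fin N) : Poly N →ₐ[ℝ] Poly N) : Poly N →+* Poly N) F := by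
  ext1 m; rw [coeff_cmap, MvPowerSeries.coeff_map]; rfl

theorem cmap_perm_genFun (k : ℝ) (w : Equiv.Perm (Fin N)) :
    cmap (perm w) (genFun N k) = (∏ i, u (w i) i) * ∏ i, ∏ j, binomSeries k i j := by
  rw [cmap_perm_eq_map, genFun, map_prod]
  simp only [map_mul, map_prod, ← cmap_perm_eq_map, map_perm_binomSeries]
  rw [Finset.prod_mul_distrib]
  congr 1
  exact Equiv.prod_comp w fun i => ∏ j, binomSeries k i j

theorem genFun_eq (k : ℝ) :
    genFun N k = (∏ i, u i i) * ∏ i, ∏ j, binomSeries k i j := by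
  rw [genFun, Finset.prod_mul_distrib]

/-- The double product with exponent `-k` is symmetric in `x`, so only the two diagonal factors at
`i` and `j` move. -/
theorem cmap_swap_genFun (k : ℝ) {i j : Fin N} (h : i ≠ j) :
    cmap (perm (Equiv.swap i j)) (genFun N k)
      = genFun N k * ((1 - z i i) * (1 - z j j) * u i j * u j i) := by
  rw [cmap_perm_genFun, genFun_eq]
  have hj : j ∈ Finset.univ.erase i := by simp [h.symm]
  rw [← Finset.mul_prod_erase _ _ (Finset.mem_univ i), ← Finset.mul_prod_erase _ _ hj,
    ← Finset.mul_prod_erase _ (fun i => u i i) (Finset.mem_univ i),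
    ← Finset.mul_prod_erase _ (fun i => u i i) hj, Equiv.swap_apply_left, Equiv.swap_apply_right]
  have e : ∏ t ∈ (Finset.univ.erase i).erase j, u (Equiv.swap i j t) t
      = ∏ t ∈ (Finset.univ.erase i).erase j, u t t := by
    refine Finset.prod_congr rfl fun t ht => ?_
    simp only [Finset.mem_erase] at ht
    rw [Equiv.swap_apply_of_ne_of_ne ht.2.1 ht.1]
  rw [e]
  generalize (∏ i, ∏ j, binomSeries k i j : Kern N) = S
  generalize (∏ t ∈ (Finset.univ.erase i).erase j, u t t : Kern N) = A
  have h1 := u_mul i i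
  have h2 := u_mul j j
  calc u j i * (u i j * A) * S = (u i i * (1 - z i i)) * (u j j * (1 - z j j)) *
        (u j i * (u i j * A) * S) := by rw [h1, h2]; ring
    _ = _ := by ring

theorem cmap_divDiff_genFun (k : ℝ) {i j : Fin N} (h : i ≠ j) :
    cmap (fun f => divDiff i j (X i * f)) (genFun N k)
      = genFun N k * ((1 - z j j) * u j i * u i j) - genFun N k * (z i j * u i j) := by
  have hne : (MvPowerSeries.C (X i - X j : Poly N) : Kern N) ≠ 0 := fun e => by
    have := congrArg (MvPowerSeries.coeff 0) e
    rw [MvPowerSeries.coeff_zero_C, map_zero] at this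
    exact X_sub_X_ne_zero h this
  apply mul_left_cancel₀ hne
  have e1 : MvPowerSeries.C (X i - X j : Poly N) *
      cmap (fun f => divDiff i j (X i * f)) (genFun N k)
      = MvPowerSeries.C (X i) * genFun N k
        - MvPowerSeries.C (X j) * cmap (perm (Equiv.swap i j)) (genFun N k) := by
    ext1 m
    rw [MvPowerSeries.coeff_C_mul, coeff_cmap, map_sub, MvPowerSeries.coeff_C_mul,
      MvPowerSeries.coeff_C_mul, coeff_cmap, ← divDiff_spec, perm_mul, perm_X,
      Equiv.swap_apply_left]
  rw [e1, cmap_swap_genFun k h]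
  have h1 := u_mul i j
  have h2 := u_mul j i
  -- What remains is an identity between commuting quantities, using only that `u i j` and `u j i`
  -- invert `1 - x_i y_j` and `1 - x_j y_i`.
  simp only [z_eq, map_sub] at *
  generalize genFun N k = F at *
  generalize (MvPowerSeries.C (X i) : Kern N) = a at *
  generalize (MvPowerSeries.C (X j) : Kern N) = b at *
  generalize (MvPowerSeries.X i : Kern N) = c at *
  generalize (MvPowerSeries.X j : Kern N) = d at *
  generalize u i j = p at *
  generalize u j i = q at *
  linear_combination (-a * F) * h1 + (-a * F * p * (1 - a * d) - (a - b) * F * a * d * p) * h2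

/-- The off-diagonal terms `x_i y_j / (1 - x_i y_j)` of the logarithmic derivative cancel against
those from the divided differences. The remaining factor is visibly unchanged when `x` and `y` are
exchanged, which is the purpose of this form. -/
theorem cmap_dunklX_genFun (k : ℝ) (i : Fin N) :
    cmap (dunklX k i) (genFun N k)
      = genFun N k * (u i i + k • (z i i * u i i)
        + k • ∑ j ∈ Finset.univ.erase i, (1 - z j j) * u j i * u i j) := by
  have e : cmap (dunklX k i) (genFun N k) = genFun N k + cmap (theta i) (genFun N k)
      + k • ∑ j ∈ Finset.univ.erase i, cmap (fun f => divDiff i j (X i * f)) (genFun N k) := by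
    ext1 m
    rw [coeff_cmap, map_add, map_add, coeff_cmap, dunklX_apply, dunkl, Derivation.leibniz,
      pderiv_X_self]
    rw [coeff_smul_real, map_sum]
    simp only [coeff_cmap, theta, smul_eq_mul, mul_one]
    ring
  rw [e, theta_genFun, Finset.sum_congr rfl fun j hj =>
    cmap_divDiff_genFun k (Finset.ne_of_mem_erase hj).symm, Finset.sum_sub_distrib,
    ← Finset.mul_sum, ← Finset.mul_sum, ← Finset.add_sum_erase _ _ (Finset.mem_univ i)]
  have h := u_eq i i
  simp only [smul_add, smul_sub, mul_add, mul_smul_comm]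
  linear_combination (-genFun N k) * h

end Kern

namespace Kern

/-! ### Symmetry of the kernel under the exchange of `x` and `y` -/

/-- `G` arises from `F` by exchanging `x` and `y`. -/
def IsSwap (F G : Kern N) : Prop := ∀ α β : Fin N →₀ ℕ,
  coeff α (MvPowerSeries.coeff β F) = coeff β (MvPowerSeries.coeff α G)

theorem IsSwap.add {F F' G G' : Kern N} (h : IsSwap F G) (h' : IsSwap F' G') :
    IsSwap (F + F') (G + G') := fun α β => by
  rw [map_add, map_add, coeff_add, coeff_add, h α β, h' α β]

theorem IsSwap.sub {F F' G G' : Kern N} (h : IsSwap F G) (h' : IsSwap F' G') :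
    IsSwap (F - F') (G - G') := fun α β => by
  rw [map_sub, map_sub, coeff_sub, coeff_sub, h α β, h' α β]

theorem IsSwap.smul {F G : Kern N} (h : IsSwap F G) (c : ℝ) : IsSwap (c • F) (c • G) :=
  fun α β => by rw [coeff_smul_real, coeff_smul_real, coeff_smul, coeff_smul, h α β]

theorem IsSwap.mul {F F' G G' : Kern N} (h : IsSwap F G) (h' : IsSwap F' G') :
    IsSwap (F * F') (G * G') := fun α β => by
  classical
  simp only [MvPowerSeries.coeff_mul, coeff_sum, MvPolynomial.coeff_mul]
  rw [Finset.sum_comm]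
  exact Finset.sum_congr rfl fun p _ => Finset.sum_congr rfl fun q _ => by
    rw [h p.1 q.1, h' p.2 q.2]

theorem isSwap_zero : IsSwap (0 : Kern N) 0 := fun α β => by simp

theorem isSwap_one : IsSwap (1 : Kern N) 1 := fun α β => by
  classical
  rw [MvPowerSeries.coeff_one, MvPowerSeries.coeff_one]
  split_ifs with h1 h2 h2 <;> simp [coeff_one, eq_comm, h1, h2]

theorem IsSwap.prod {ι : Type*} (s : Finset ι) {F G : ι → Kern N}
    (h : ∀ a ∈ s, IsSwap (F a) (G a)) : IsSwap (∏ a ∈ s, F a) (∏ a ∈ s, G a) := by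
  classical
  induction s using Finset.induction_on with
  | empty => exact isSwap_one
  | insert a s ha ih =>
    rw [Finset.prod_insert ha, Finset.prod_insert ha]
    exact (h a (by simp)).mul (ih fun b hb => h b (by simp [hb]))

theorem IsSwap.sum {ι : Type*} (s : Finset ι) {F G : ι → Kern N}
    (h : ∀ a ∈ s, IsSwap (F a) (G a)) : IsSwap (∑ a ∈ s, F a) (∑ a ∈ s, G a) := by
  classical
  induction s using Finset.induction_on with
  | empty => exact isSwap_zero
  | insert a s ha ih =>
    rw [Finset.sum_insert ha, Finset.sum_insert ha]
    exact (h a (by simp)).add (ih fun b hb => h b (by simp [hb]))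

theorem isSwap_binomSeries (t : ℝ) (i j : Fin N) :
    IsSwap (binomSeries t i j) (binomSeries t j i) := fun α β => by
  classical
  rw [binomSeries_eq_line, binomSeries_eq_line, coeff_line, coeff_line]
  have e : ∀ (s : Fin N) (m : ℕ) (γ : Fin N →₀ ℕ),
      coeff γ (C (bc t m) * X s ^ m : Poly N) = if γ = Finsupp.single s m then bc t m else 0 := by
    intro s m γ
    rw [coeff_C_mul, coeff_X_pow]
    simp only [eq_comm (a := γ)]
    split_ifs <;> simp
  have h0 : ∀ (q : Prop) [Decidable q] (γ : Fin N →₀ ℕ) (f : Poly N),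
      coeff γ (if q then f else 0) = if q then coeff γ f else 0 := by
    intro q _ γ f; split_ifs <;> simp
  rw [h0, h0, e, e]
  by_cases h1 : β = Finsupp.single j (β j)
  · by_cases h2 : α = Finsupp.single i (α i)
    · rw [if_pos h1, if_pos h2]
      by_cases h3 : α i = β j
      · rw [if_pos (by rw [← h3]; exact h2), if_pos (by rw [h3]; exact h1), h3]
      · rw [if_neg, if_neg]
        · intro h; apply h3; rw [h]; simp
        · intro h; apply h3; rw [h]; simp
    · rw [if_neg h2, if_pos h1, if_neg]
      intro h; apply h2; rw [h]; simp
  · rw [if_neg h1]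
    by_cases h2 : α = Finsupp.single i (α i)
    · rw [if_pos h2, if_neg]
      intro h; apply h1; rw [h]; simp
    · rw [if_neg h2]

theorem isSwap_z (i j : Fin N) : IsSwap (z i j) (z j i) := fun α β => by
  classical
  rw [z, z, MvPowerSeries.coeff_monomial, MvPowerSeries.coeff_monomial]
  split_ifs with h1 h2 h2 <;> simp [coeff_X, h1, h2, Ne.symm]

theorem isSwap_prod_binomSeries (k : ℝ) :
    IsSwap (∏ i : Fin N, ∏ j, binomSeries k i j) (∏ i : Fin N, ∏ j, binomSeries k i j) := by
  conv => arg 2; rw [Finset.prod_comm]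
  exact IsSwap.prod _ fun i _ => IsSwap.prod _ fun j _ => isSwap_binomSeries k i j

theorem isSwap_genFun (k : ℝ) : IsSwap (genFun N k) (genFun N k) := by
  rw [genFun_eq]
  exact (IsSwap.prod _ fun i _ => isSwap_binomSeries 1 i i).mul (isSwap_prod_binomSeries k)

/-- Permuting the `x` by `w` pairs `x_{w(i)}` with `y_i`; read from the side of `y`, this is a
permutation by `w⁻¹`. -/
theorem isSwap_cmap_perm_genFun (k : ℝ) (w : Equiv.Perm (Fin N)) :
    IsSwap (cmap (perm w) (genFun N k)) (cmap (perm w⁻¹) (genFun N k)) := by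
  rw [cmap_perm_genFun, cmap_perm_genFun]
  refine IsSwap.mul ?_ (isSwap_prod_binomSeries k)
  rw [← Equiv.prod_comp w fun i => u (w⁻¹ i) i]
  refine IsSwap.prod _ fun i _ => ?_
  rw [show w⁻¹ (w i) = i by simp]
  exact isSwap_binomSeries 1 (w i) i

theorem isSwap_cmap_dunklX_genFun (k : ℝ) (i : Fin N) :
    IsSwap (cmap (dunklX k i) (genFun N k)) (cmap (dunklX k i) (genFun N k)) := by
  rw [cmap_dunklX_genFun]
  refine (isSwap_genFun k).mul (((isSwap_binomSeries 1 i i).add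
    (((isSwap_z i i).mul (isSwap_binomSeries 1 i i)).smul k)).add
    ((IsSwap.sum _ fun j _ => ?_).smul k))
  rw [mul_assoc]
  conv => arg 2; rw [mul_comm (u j i)]
  exact (isSwap_one.sub (isSwap_z j j)).mul
    ((isSwap_binomSeries 1 j i).mul (isSwap_binomSeries 1 i j))

end Kern

/-- The coefficient of `y^β` in the generating function. -/
noncomputable def pCoeff (k : ℝ) (β : Fin N →₀ ℕ) : Poly N := MvPowerSeries.coeff β (genFun N k)

theorem coeff_pCoeff_symm (k : ℝ) (α β : Fin N →₀ ℕ) :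
    coeff α (pCoeff k β) = coeff β (pCoeff k α) := Kern.isSwap_genFun k α β

theorem coeff_perm_pCoeff (k : ℝ) (w : Equiv.Perm (Fin N)) (α β : Fin N →₀ ℕ) :
    coeff α (perm w (pCoeff k β)) = coeff β (perm w⁻¹ (pCoeff k α)) :=
  Kern.isSwap_cmap_perm_genFun k w α β

theorem coeff_dunklX_pCoeff (k : ℝ) (i : Fin N) (α β : Fin N →₀ ℕ) :
    coeff α (dunklX k i (pCoeff k β)) = coeff β (dunklX k i (pCoeff k α)) :=
  Kern.isSwap_cmap_dunklX_genFun k i α β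

theorem coeff_linU_pCoeff (k : ℝ) (i : Fin N) (α β : Fin N →₀ ℕ) :
    coeff α (linU k i (pCoeff k β)) = coeff β (linU k i (pCoeff k α)) := by
  rw [linU_eq, linU_eq]
  simp only [coeff_add, coeff_sub, coeff_smul, coeff_sum]
  rw [coeff_dunklX_pCoeff, coeff_pCoeff_symm]
  congr 2
  refine Finset.sum_congr rfl fun j _ => ?_
  rw [coeff_perm_pCoeff, Equiv.swap_inv]

/-- Through the symmetry of the kernel, permuting the variables `x` becomes permuting the exponents
of `y`. -/
theorem perm_pCoeff (k : ℝ) (w : Equiv.Perm (Fin N)) (β : Fin N →₀ ℕ) :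
    perm w (pCoeff k β) = pCoeff k (β.mapDomain w) := by
  ext α
  rw [coeff_perm_pCoeff, coeff_pCoeff_symm k α]
  have e := coeff_rename_mapDomain _ (w⁻¹).injective (pCoeff k α) (β.mapDomain w)
  rw [← Finsupp.mapDomain_comp, ← Equiv.Perm.coe_mul, inv_mul_cancel, Equiv.Perm.coe_one,
    Finsupp.mapDomain_id] at e
  exact e

/-! ### Homogeneity -/

namespace Kern

/-- The coefficient of `y^m` is homogeneous of degree `|m|`. -/
def IsHom (F : Kern N) : Prop := ∀ m : Fin N →₀ ℕ, (MvPowerSeries.coeff m F).IsHomogeneous m.degree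

theorem IsHom.mul {F G : Kern N} (h : IsHom F) (h' : IsHom G) : IsHom (F * G) := fun m => by
  classical
  rw [MvPowerSeries.coeff_mul]
  refine IsHomogeneous.sum _ _ _ fun q hq => ?_
  rw [← Finset.HasAntidiagonal.mem_antidiagonal.1 hq, map_add]
  exact (h _).mul (h' _)

theorem IsHom.prod {ι : Type*} (s : Finset ι) {F : ι → Kern N} (h : ∀ a ∈ s, IsHom (F a)) :
    IsHom (∏ a ∈ s, F a) := by
  classical
  induction s using Finset.induction_on with
  | empty =>
    intro m
    rw [Finset.prod_empty, MvPowerSeries.coeff_one]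
    split_ifs with h
    · subst h; simpa using isHomogeneous_one (Fin N) ℝ
    · exact isHomogeneous_zero _ _ _
  | insert a s ha ih =>
    rw [Finset.prod_insert ha]
    exact (h a (by simp)).mul (ih fun b hb => h b (by simp [hb]))

theorem isHom_binomSeries (t : ℝ) (i j : Fin N) : IsHom (binomSeries t i j) := fun m => by
  rw [binomSeries_eq_line, coeff_line]
  split_ifs with h
  · have := (isHomogeneous_C (Fin N) (bc t (m j))).mul (isHomogeneous_X_pow (R := ℝ) i (m j))
    rw [h]
    simpa using this
  · exact isHomogeneous_zero _ _ _

theorem isHom_genFun (k : ℝ) : IsHom (genFun N k) :=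
  IsHom.prod _ fun i _ => (isHom_binomSeries 1 i i).mul
    (IsHom.prod _ fun j _ => isHom_binomSeries k i j)

end Kern

theorem pCoeff_isHomogeneous (k : ℝ) (β : Fin N →₀ ℕ) : (pCoeff k β).IsHomogeneous β.degree :=
  Kern.isHom_genFun k β

theorem pCoeff_zero (k : ℝ) : pCoeff k (0 : Fin N →₀ ℕ) = 1 := by
  have h : ∀ (t : ℝ) (i j : Fin N), MvPowerSeries.constantCoeff (binomSeries t i j) = 1 := by
    intro t i j
    rw [← MvPowerSeries.coeff_zero_eq_constantCoeff_apply, Kern.binomSeries_eq_line,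
      Kern.coeff_line]
    simp [Kern.bc_zero]
  rw [pCoeff, MvPowerSeries.coeff_zero_eq_constantCoeff_apply, genFun, map_prod]
  simp [h]

/-! ### Positivity of the kernel -/

namespace Kern

/-- The exponents of degree `n`. -/
noncomputable def degs (N n : ℕ) : Finset (Fin N →₀ ℕ) := Finset.univ.finsuppAntidiag n

theorem mem_degs {n : ℕ} {β : Fin N →₀ ℕ} : β ∈ degs N n ↔ β.degree = n := by
  rw [degs, Finset.mem_finsuppAntidiag, Finsupp.degree_eq_sum]
  simp

/-- The functionals `v` in `y` and `w` in `x` applied to the part of `F` of degree `n` in `y`. -/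
noncomputable def pairing (n : ℕ) (F : Kern N) (v w : Poly N →ₗ[ℝ] ℝ) : ℝ :=
  ∑ β ∈ degs N n, v (monomial β 1) * w (MvPowerSeries.coeff β F)

/-- Composition of a functional with multiplication by a polynomial. -/
noncomputable def twist (v : Poly N →ₗ[ℝ] ℝ) (f : Poly N) : Poly N →ₗ[ℝ] ℝ :=
  v ∘ₗ LinearMap.mulLeft ℝ f

theorem twist_apply (v : Poly N →ₗ[ℝ] ℝ) (f g : Poly N) : twist v f g = v (f * g) := rfl

theorem twist_twist (v : Poly N →ₗ[ℝ] ℝ) (f g : Poly N) : twist (twist v f) g = twist v (f * g) := by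
  ext1 m; simp only [twist, LinearMap.comp_assoc, LinearMap.mulLeft_mul]

theorem pairing_add (n : ℕ) (F G : Kern N) (v w : Poly N →ₗ[ℝ] ℝ) :
    pairing n (F + G) v w = pairing n F v w + pairing n G v w := by
  simp [pairing, mul_add, Finset.sum_add_distrib]

theorem pairing_smul (n : ℕ) (c : ℝ) (F : Kern N) (v w : Poly N →ₗ[ℝ] ℝ) :
    pairing n (c • F) v w = c * pairing n F v w := by
  rw [pairing, pairing, Finset.mul_sum]
  refine Finset.sum_congr rfl fun β _ => ?_
  rw [coeff_smul_real, map_smul, smul_eq_mul]; ring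

theorem pairing_sum {ι : Type*} (s : Finset ι) (n : ℕ) (F : ι → Kern N) (v w : Poly N →ₗ[ℝ] ℝ) :
    pairing n (∑ a ∈ s, F a) v w = ∑ a ∈ s, pairing n (F a) v w := by
  simp only [pairing, map_sum, Finset.mul_sum]
  exact Finset.sum_comm

theorem pairing_z_mul_zero (i j : Fin N) (F : Kern N) (v w : Poly N →ₗ[ℝ] ℝ) :
    pairing 0 (z i j * F) v w = 0 := by
  refine Finset.sum_eq_zero fun β hβ => ?_
  have : β = 0 := by simpa [mem_degs, Finsupp.degree_eq_zero_iff] using hβ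
  subst this
  rw [coeff_z_mul]; simp

theorem pairing_z_mul_succ (n : ℕ) (i j : Fin N) (F : Kern N) (v w : Poly N →ₗ[ℝ] ℝ) :
    pairing (n + 1) (z i j * F) v w = pairing n F (twist v (X j)) (twist w (X i)) := by
  rw [pairing, ← Finset.sum_filter_of_ne (p := fun β => 1 ≤ β j)]
  · symm
    refine Finset.sum_nbij' (fun β => β + Finsupp.single j 1) (fun β => β - Finsupp.single j 1)
      ?_ ?_ ?_ ?_ ?_
    · intro β hβ
      rw [mem_degs] at hβ
      simp [mem_degs, hβ]
    · intro β hβ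
      rw [Finset.mem_filter, mem_degs] at hβ
      rw [mem_degs]
      have e : β - Finsupp.single j 1 + Finsupp.single j 1 = β :=
        tsub_add_cancel_of_le (Finsupp.single_le_iff.2 hβ.2)
      have e' := congrArg Finsupp.degree e
      rw [map_add, Finsupp.degree_single, hβ.1] at e'
      omega
    · intro β _; simp
    · intro β hβ
      rw [Finset.mem_filter] at hβ
      exact tsub_add_cancel_of_le (Finsupp.single_le_iff.2 hβ.2)
    · intro β _
      rw [coeff_z_mul, if_pos (by simp), twist_apply, twist_apply]
      congr 2
      · rw [X, monomial_mul, one_mul, add_comm]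
      · simp
  · intro β _ h
    by_contra h'
    apply h
    rw [coeff_z_mul, if_neg h', map_zero, mul_zero]

/-- The geometric series is expanded one factor `x_i y_j` at a time, each factor lowering the degree
in `y` by one and twisting both functionals. -/
theorem pairing_geom (n : ℕ) (i j : Fin N) (F : Kern N) (v w : Poly N →ₗ[ℝ] ℝ) :
    pairing n (F * (z i j * u i j)) v w = ∑ r ∈ Finset.range n,
      pairing (n - 1 - r) F (twist v (X j ^ (r + 1))) (twist w (X i ^ (r + 1))) := by
  have e : F * (z i j * u i j) = z i j * (F + F * (z i j * u i j)) := by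
    linear_combination (F * z i j) * u_eq i j
  induction n generalizing v w with
  | zero => rw [e, pairing_z_mul_zero]; simp
  | succ n ih =>
    rw [e, pairing_z_mul_succ, pairing_add, ih, Finset.sum_range_succ', add_comm]
    congr 1
    · refine Finset.sum_congr rfl fun r _ => ?_
      rw [twist_twist, twist_twist, ← pow_succ', ← pow_succ']
      congr 1
      omega
    · simp

theorem pairing_twist_sum (n : ℕ) (F : Kern N) (v w : Poly N →ₗ[ℝ] ℝ) (f : Fin N → Poly N) :
    ∑ i, ∑ j, pairing n F (twist v (f j)) (twist w (f i))
      = pairing n F (twist v (∑ i, f i)) (twist w (∑ i, f i)) := by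
  simp only [pairing, twist_apply, Finset.sum_mul, map_sum]
  rw [Finset.sum_congr rfl fun i _ => Finset.sum_comm, Finset.sum_comm]
  refine Finset.sum_congr rfl fun β _ => ?_
  simp only [Finset.mul_sum]
  exact Finset.sum_comm

/-- Euler's identity replaces the factor `n` by the sum of the operators `x_i ∂/∂x_i`, whose effect
on the kernel is its logarithmic derivative. The double sum over `i` and `j` collapses to a twist by
a power sum, so every term on the right is again a diagonal pairing of lower degree. -/
theorem pairing_genFun (k : ℝ) (n : ℕ) (v : Poly N →ₗ[ℝ] ℝ) :
    n * pairing n (genFun N k) v v = ∑ r ∈ Finset.range n,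
      (∑ i, pairing (n - 1 - r) (genFun N k) (twist v (X i ^ (r + 1))) (twist v (X i ^ (r + 1)))
      + k * pairing (n - 1 - r) (genFun N k) (twist v (∑ i, X i ^ (r + 1)))
          (twist v (∑ i, X i ^ (r + 1)))) := by
  have e1 : n * pairing n (genFun N k) v v
      = pairing n (∑ i, cmap (theta i) (genFun N k)) v v := by
    rw [pairing, pairing, Finset.mul_sum]
    refine Finset.sum_congr rfl fun β hβ => ?_
    have h := (pCoeff_isHomogeneous k β).sum_X_mul_pderiv
    rw [mem_degs.1 hβ] at h
    have h2 : MvPowerSeries.coeff β (∑ i, cmap (theta i) (genFun N k)) = (n : ℝ) • pCoeff k β := by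
      rw [map_sum, Nat.cast_smul_eq_nsmul, ← h]; rfl
    rw [h2, map_smul, smul_eq_mul, pCoeff]; ring
  rw [e1, pairing_sum]
  simp only [theta_genFun, mul_add, mul_smul_comm, Finset.mul_sum, pairing_add, pairing_smul,
    pairing_sum, pairing_geom]
  rw [Finset.sum_add_distrib, Finset.sum_add_distrib, Finset.sum_comm, ← Finset.mul_sum]
  simp only [← Finset.mul_sum]
  congr 2
  rw [Finset.sum_congr rfl fun i _ => Finset.sum_comm, Finset.sum_comm]
  exact Finset.sum_congr rfl fun r _ => pairing_twist_sum _ _ _ _ _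

/-- Strong induction along `pairing_genFun`, whose terms are nonnegative because `k ≥ 0`.
Definiteness makes the matrix of coefficients of the `p_β` in each degree invertible. -/
theorem pairing_genFun_pos {k : ℝ} (hk : 0 ≤ k) (n : ℕ) (v : Poly N →ₗ[ℝ] ℝ) :
    0 ≤ pairing n (genFun N k) v v ∧
      (pairing n (genFun N k) v v = 0 → ∀ β : Fin N →₀ ℕ, β.degree = n → v (monomial β 1) = 0) := by
  induction n using Nat.strong_induction_on generalizing v with
  | _ n ih =>
  rcases n with _ | n
  · have h0 : degs N 0 = {0} := by ext β; simp [mem_degs, Finsupp.degree_eq_zero_iff]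
    have hp : MvPowerSeries.coeff 0 (genFun N k) = 1 := pCoeff_zero k
    rw [pairing, h0, Finset.sum_singleton, hp]
    have h1 : (monomial (0 : Fin N →₀ ℕ) (1 : ℝ)) = 1 := rfl
    rw [h1]
    refine ⟨mul_self_nonneg _, fun h β hβ => ?_⟩
    have : β = 0 := by simpa [Finsupp.degree_eq_zero_iff] using hβ
    subst this
    exact mul_self_eq_zero.1 h
  · have e := pairing_genFun k (n + 1) v
    have hnn : ∀ r ∈ Finset.range (n + 1), ∀ f : Poly N,
        0 ≤ pairing (n + 1 - 1 - r) (genFun N k) (twist v f) (twist v f) := fun r hr f =>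
      (ih _ (by have := Finset.mem_range.1 hr; omega) _).1
    have hterm : ∀ r ∈ Finset.range (n + 1), 0 ≤
        (∑ i, pairing (n + 1 - 1 - r) (genFun N k) (twist v (X i ^ (r + 1)))
          (twist v (X i ^ (r + 1)))
        + k * pairing (n + 1 - 1 - r) (genFun N k) (twist v (∑ i, X i ^ (r + 1)))
          (twist v (∑ i, X i ^ (r + 1)))) := fun r hr =>
      add_nonneg (Finset.sum_nonneg fun i _ => hnn r hr _) (mul_nonneg hk (hnn r hr _))
    have hpos : (0 : ℝ) < (n + 1 : ℕ) := by positivity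
    refine ⟨?_, fun h β hβ => ?_⟩
    · have := Finset.sum_nonneg hterm
      rw [← e] at this
      exact nonneg_of_mul_nonneg_right this hpos
    · rw [h, mul_zero] at e
      -- The term `r = 0` suffices: it says that each functional `f ↦ v (x_i f)` is null in degree
      -- `n`, and every monomial of degree `n + 1` is some `x_i` times a monomial of degree `n`.
      have e0 := (Finset.sum_eq_zero_iff_of_nonneg hterm).1 e.symm 0 (by simp)
      have hsum := Finset.sum_nonneg fun (i : Fin N) (_ : i ∈ Finset.univ) =>
        hnn 0 (by simp) (X i ^ (0 + 1))
      have e1 := le_antisymm (by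
        have := mul_nonneg hk (hnn 0 (by simp) (∑ i, X i ^ (0 + 1)))
        linarith) hsum
      have e2 := (Finset.sum_eq_zero_iff_of_nonneg fun i _ =>
        hnn 0 (by simp) (X i ^ (0 + 1))).1 e1
      have hβ0 : β ≠ 0 := by rintro rfl; simp at hβ
      obtain ⟨i, hi⟩ := Finsupp.ne_iff.1 hβ0
      have hs : β - Finsupp.single i 1 + Finsupp.single i 1 = β :=
        tsub_add_cancel_of_le (Finsupp.single_le_iff.2 (Nat.one_le_iff_ne_zero.2 hi))
      have hd := congrArg Finsupp.degree hs
      rw [map_add, Finsupp.degree_single, hβ] at hd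
      have := (ih _ (by omega) (twist v (X i ^ (0 + 1)))).2 (e2 i (Finset.mem_univ i))
        (β - Finsupp.single i 1) (by omega)
      rw [twist_apply, zero_add, pow_one, X, monomial_mul, one_mul, add_comm, hs] at this
      exact this

end Kern

/-! ### The basis of the polynomials `p` -/

/-- The linear map `x^β ↦ p_β`. -/
noncomputable def pMap (N : ℕ) (k : ℝ) : Poly N →ₗ[ℝ] Poly N :=
  (basisMonomials (Fin N) ℝ).constr ℝ (pCoeff k)

theorem pMap_monomial (k : ℝ) (β : Fin N →₀ ℕ) : pMap N k (monomial β 1) = pCoeff k β := by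
  have := (basisMonomials (Fin N) ℝ).constr_basis ℝ (pCoeff k) β
  rwa [coe_basisMonomials] at this

theorem lin_ext {M : Type*} [AddCommMonoid M] [Module ℝ M] {f g : Poly N →ₗ[ℝ] M}
    (h : ∀ β : Fin N →₀ ℕ, f (monomial β 1) = g (monomial β 1)) : f = g :=
  (basisMonomials (Fin N) ℝ).ext fun β => by rw [coe_basisMonomials]; exact h β

theorem homogeneousComponent_pMap (k : ℝ) (n : ℕ) (f : Poly N) :
    homogeneousComponent n (pMap N k f) = pMap N k (homogeneousComponent n f) := by
  suffices h : homogeneousComponent n ∘ₗ pMap N k = pMap N k ∘ₗ homogeneousComponent n from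
    LinearMap.congr_fun h f
  refine lin_ext fun β => ?_
  simp only [LinearMap.comp_apply, pMap_monomial]
  rw [homogeneousComponent_of_mem (pCoeff_isHomogeneous k β),
    homogeneousComponent_of_mem (isHomogeneous_monomial (1 : ℝ) rfl)]
  split_ifs
  · rw [pMap_monomial]
  · rw [map_zero]

theorem pMap_injective {k : ℝ} (hk : 0 ≤ k) : Function.Injective (pMap N k) := by
  rw [← LinearMap.ker_eq_bot, LinearMap.ker_eq_bot']
  intro f hf
  ext β
  set n := β.degree with hn
  let v : Poly N →ₗ[ℝ] ℝ := (basisMonomials (Fin N) ℝ).constr ℝ fun γ => coeff γ f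
  have hv : ∀ γ, v (monomial γ 1) = coeff γ f := fun γ => by
    have := (basisMonomials (Fin N) ℝ).constr_basis ℝ (fun γ => coeff γ f) γ
    rwa [coe_basisMonomials] at this
  have hc : homogeneousComponent n f = ∑ γ ∈ Kern.degs N n, coeff γ f • monomial γ 1 := by
    ext γ
    simp only [coeff_homogeneousComponent, coeff_sum, coeff_smul, coeff_monomial, smul_eq_mul,
      mul_ite, mul_one, mul_zero, Finset.sum_ite_eq', Kern.mem_degs]
  have h0 : Kern.pairing n (genFun N k) v v = 0 := by
    have e : Kern.pairing n (genFun N k) v v = v (pMap N k (homogeneousComponent n f)) := by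
      rw [hc, map_sum, map_sum, Kern.pairing]
      refine Finset.sum_congr rfl fun γ _ => ?_
      rw [map_smul, map_smul, pMap_monomial, hv]; rfl
    rw [e, ← homogeneousComponent_pMap, hf, map_zero, map_zero]
  rw [← hv, (Kern.pairing_genFun_pos hk n v).2 h0 β rfl, coeff_zero]

/-- The map preserves degree, so injectivity gives surjectivity on each finite-dimensional
homogeneous component. -/
theorem pMap_surjective {k : ℝ} (hk : 0 ≤ k) : Function.Surjective (pMap N k) := by
  intro f
  have h : ∀ n (f : Poly N), f.IsHomogeneous n → ∃ g, pMap N k g = f := by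
    intro n f hf
    have : FiniteDimensional ℝ (homogeneousSubmodule (Fin N) ℝ n) :=
      Module.Finite.iff_fg.2 (homogeneousSubmodule_fg (Fin N) ℝ n)
    have hmaps : ∀ g ∈ homogeneousSubmodule (Fin N) ℝ n,
        pMap N k g ∈ homogeneousSubmodule (Fin N) ℝ n := by
      intro g hg
      have hg' : homogeneousComponent n g = g := homogeneousComponent_eq_self hg
      rw [← hg', ← homogeneousComponent_pMap]
      exact homogeneousComponent_isHomogeneous n _
    have hs := LinearMap.injective_iff_surjective.1
      (show Function.Injective ((pMap N k).restrict hmaps) from fun a b hab =>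
        Subtype.ext (pMap_injective hk (congrArg Subtype.val hab)))
    obtain ⟨g, hg⟩ := hs ⟨f, hf⟩
    exact ⟨g, congrArg Subtype.val hg⟩
  choose g hg using fun n => h n _ (homogeneousComponent_isHomogeneous n f)
  refine ⟨∑ n ∈ Finset.range (f.totalDegree + 1), g n, ?_⟩
  rw [map_sum, Finset.sum_congr rfl fun n _ => hg n, sum_homogeneousComponent]

/-- The basis `p_α` of the polynomials. -/
noncomputable def pBasis (N : ℕ) {k : ℝ} (hk : 0 ≤ k) : Module.Basis (Comp N) ℝ (Poly N) :=
  ((basisMonomials (Fin N) ℝ).map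
    (LinearEquiv.ofBijective (pMap N k) ⟨pMap_injective hk, pMap_surjective hk⟩)).reindex
    Finsupp.equivFunOnFinite

theorem pPoly_eq (k : ℝ) (α : Comp N) :
    pPoly k α = pCoeff k (Finsupp.equivFunOnFinite.symm α) := rfl

theorem pBasis_apply {k : ℝ} (hk : 0 ≤ k) (α : Comp N) : pBasis N hk α = pPoly k α := by
  rw [pBasis, Module.Basis.reindex_apply, Module.Basis.map_apply, coe_basisMonomials, pPoly_eq,
    ← pMap_monomial]
  rfl

theorem pBasis_repr {k : ℝ} (hk : 0 ≤ k) (g : Poly N) (α : Comp N) :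
    (pBasis N hk).repr (pMap N k g) α = coeff (Finsupp.equivFunOnFinite.symm α) g := by
  have e : pMap N k g = LinearEquiv.ofBijective (pMap N k)
    ⟨pMap_injective hk, pMap_surjective hk⟩ g := rfl
  rw [pBasis, Module.Basis.repr_reindex_apply, Module.Basis.map_repr, LinearEquiv.trans_apply, e,
    LinearEquiv.symm_apply_apply]
  rfl

/-! ### Transposition between the monomials and the basis `p` -/

/-- The inner product on polynomials for which the monomials are orthonormal. -/
noncomputable def dot (N : ℕ) : Poly N →ₗ[ℝ] Poly N →ₗ[ℝ] ℝ :=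
  (basisMonomials (Fin N) ℝ).constr ℝ fun γ => lcoeff ℝ γ

theorem dot_monomial_left (γ : Fin N →₀ ℕ) (h : Poly N) : dot N (monomial γ 1) h = coeff γ h := by
  have := (basisMonomials (Fin N) ℝ).constr_basis ℝ
    (fun γ => (lcoeff ℝ γ : Poly N →ₗ[ℝ] ℝ)) γ
  rw [coe_basisMonomials] at this
  rw [dot, this]; rfl

theorem dot_monomial_right (γ : Fin N →₀ ℕ) (h : Poly N) : dot N h (monomial γ 1) = coeff γ h := by
  suffices e : (dot N).flip (monomial γ 1) = lcoeff ℝ γ from LinearMap.congr_fun e h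
  refine lin_ext fun β => ?_
  rw [LinearMap.flip_apply, dot_monomial_left]
  simp only [lcoeff_apply, coeff_monomial, eq_comm]

theorem dot_pMap (k : ℝ) (g : Poly N) (α : Fin N →₀ ℕ) :
    dot N g (pCoeff k α) = coeff α (pMap N k g) := by
  suffices e : (dot N).flip (pCoeff k α) = lcoeff ℝ α ∘ₗ pMap N k from LinearMap.congr_fun e g
  refine lin_ext fun β => ?_
  rw [LinearMap.flip_apply, dot_monomial_left, LinearMap.comp_apply, pMap_monomial,
    coeff_pCoeff_symm]
  rfl

/-- Let `P` be the map `x^β ↦ p_β`. Symmetry of the kernel makes `P` symmetric for `dot`, and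
`coeff_linU_pCoeff` does the same for `U_i P`. Therefore `U_i P` equals `P` times the transpose of
`U_i`. -/
theorem pBasis_repr_linU {k : ℝ} (hk : 0 ≤ k) (i : Fin N) (β γ : Comp N) :
    (pBasis N hk).repr (linU k i (pPoly k β)) γ
      = coeff (Finsupp.equivFunOnFinite.symm β)
          (linU k i (monomial (Finsupp.equivFunOnFinite.symm γ) 1)) := by
  rw [pPoly_eq]
  set b := Finsupp.equivFunOnFinite.symm β
  set c := Finsupp.equivFunOnFinite.symm γ with hc
  obtain ⟨g, hg⟩ := pMap_surjective hk (linU k i (pCoeff k b))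
  rw [← hg, pBasis_repr, ← hc, ← dot_monomial_right]
  -- Writing the monomial in terms of the `p_α` makes the claim linear in `h`, so it need only be
  -- tested where symmetry of the coefficients applies.
  obtain ⟨h, hh⟩ := pMap_surjective hk (monomial c (1 : ℝ))
  rw [← hh]
  suffices e : dot N g ∘ₗ pMap N k = lcoeff ℝ b ∘ₗ linU k i ∘ₗ pMap N k from
    LinearMap.congr_fun e h
  refine lin_ext fun α => ?_
  simp only [LinearMap.comp_apply, pMap_monomial]
  rw [dot_pMap, hg, coeff_linU_pCoeff]
  rfl

theorem perm_pPoly (k : ℝ) (w : Equiv.Perm (Fin N)) (α : Comp N) :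
    perm w (pPoly k α) = pPoly k (act w α) := by
  rw [pPoly_eq, pPoly_eq, perm_pCoeff]
  congr 1
  ext i
  rw [Finsupp.mapDomain_equiv_apply]
  rfl

/-! ### Dominance -/

/-- The partial sums `α_1 + … + α_j`. -/
def psum (α : Comp N) (j : Fin N) : ℕ := ∑ i ∈ Finset.Iic j, α i

theorem psum_injective {α β : Comp N} (h : ∀ j, psum α j = psum β j) : α = β := by
  have key : ∀ n, ∀ j : Fin N, (j : ℕ) = n → α j = β j := by
    intro n
    induction n using Nat.strong_induction_on with
    | _ n ih =>
    intro j hj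
    have e := h j
    rw [psum, psum, ← Finset.Iio_insert, Finset.sum_insert (by simp),
      Finset.sum_insert (by simp)] at e
    have e' : ∑ i ∈ Finset.Iio j, α i = ∑ i ∈ Finset.Iio j, β i :=
      Finset.sum_congr rfl fun i hi => ih i (by rw [← hj]; simpa using hi) i rfl
    omega
  exact funext fun j => key j j rfl

theorem psum_eq_sum (α : Comp N) (j : Fin N) :
    psum α j = ∑ i, (if i ≤ j then 1 else 0) * α i := by
  simp only [ite_mul, one_mul, zero_mul, ← Finset.sum_filter]
  rw [psum]
  congr 1
  ext i; simp

theorem psum_act_eq (I : Finset (Fin N)) (α : Comp N) {w : Equiv.Perm (Fin N)} (hw : w ∈ symI I)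
    (j : Fin N) : psum (act w α) j = ∑ i ∈ I, (if i ≤ j then 1 else 0) * α (w⁻¹ i)
      + ∑ i ∈ Iᶜ, (if i ≤ j then 1 else 0) * α i := by
  rw [psum_eq_sum, ← Finset.sum_add_sum_compl I]
  congr 1
  refine Finset.sum_congr rfl fun i hi => ?_
  have : w i = i := by simpa [symI] using (Finset.mem_filter.1 hw).2 i (Finset.mem_compl.1 hi)
  rw [act, Equiv.Perm.inv_eq_iff_eq.2 this.symm]

theorem inv_support_subset {I : Finset (Fin N)} {w : Equiv.Perm (Fin N)} (hw : w ∈ symI I) :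
    {x | w⁻¹ x ≠ x} ⊆ (I : Set (Fin N)) := by
  intro x hx
  by_contra h
  exact hx (Equiv.Perm.inv_eq_iff_eq.2 ((Finset.mem_filter.1 hw).2 x h).symm)

theorem psum_act_one (α : Comp N) : act 1 α = α := rfl

theorem one_mem_symI (I : Finset (Fin N)) : 1 ∈ symI I := by simp [symI]

/-- The rearrangement inequality, with the indicator of the first positions as weights: on `I` these
weights decrease weakly, as `α` does. -/
theorem psum_act_le {I : Finset (Fin N)} {α : Comp N} (hα : GeI I α) {w : Equiv.Perm (Fin N)}
    (hw : w ∈ symI I) (j : Fin N) : psum (act w α) j ≤ psum α j := by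
  rw [psum_act_eq I α hw, ← psum_act_one α, psum_act_eq I α (one_mem_symI I)]
  refine Nat.add_le_add_right ?_ _
  refine MonovaryOn.sum_mul_comp_perm_le_sum_mul ?_ (inv_support_subset hw)
  intro s hs t ht hst
  have hts : t < s := by
    by_contra h
    rcases (not_lt.1 h).eq_or_lt with rfl | h
    · exact lt_irrefl _ hst
    · exact absurd (hα s hs t ht h) (not_le.2 hst)
  dsimp only
  split_ifs with h1 h2
  · rfl
  · exact absurd (hts.le.trans h1) h2
  · exact Nat.zero_le _
  · rfl

theorem psum_le_act {I : Finset (Fin N)} {α : Comp N}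
    (hα : ∀ i ∈ I, ∀ j ∈ I, i < j → α i ≤ α j) {w : Equiv.Perm (Fin N)}
    (hw : w ∈ symI I) (j : Fin N) : psum α j ≤ psum (act w α) j := by
  rw [psum_act_eq I α hw]
  conv_lhs => rw [← psum_act_one α, psum_act_eq I α (one_mem_symI I)]
  refine Nat.add_le_add_right ?_ _
  refine AntivaryOn.sum_mul_le_sum_mul_comp_perm ?_ (inv_support_subset hw)
  intro s hs t ht hst
  have hts : s < t := by
    by_contra h
    rcases (not_lt.1 h).eq_or_lt with rfl | h
    · exact lt_irrefl _ hst
    · exact absurd (hα t ht s hs h) (not_le.2 hst)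
  dsimp only
  split_ifs with h1 h2
  · rfl
  · exact absurd (hts.le.trans h1) h2
  · exact Nat.zero_le _
  · rfl

theorem act_act (v w : Equiv.Perm (Fin N)) (α : Comp N) : act v (act w α) = act (v * w) α := by
  funext i; simp [act]

theorem mem_symI_univ (w : Equiv.Perm (Fin N)) : w ∈ symI (Finset.univ : Finset (Fin N)) := by
  simp [symI]

theorem act_sortPerm_plus (α : Comp N) : act (sortPerm α) (plus α) = α := by
  funext i; simp [act, plus]

theorem plus_eq_act (α : Comp N) : plus α = act (sortPerm α)⁻¹ α := by
  funext i; simp only [act, inv_inv]; rfl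

theorem geI_plus (α : Comp N) (I : Finset (Fin N)) : GeI I (plus α) := by
  intro i _ j _ hij
  have h := Tuple.monotone_sort (fun i => OrderDual.toDual (α i)) hij.le
  simpa [plus, sortPerm] using h

theorem eq_of_geI_act {γ : Comp N} {w : Equiv.Perm (Fin N)} {I : Finset (Fin N)} (hw : w ∈ symI I)
    (h : GeI I γ) (h' : GeI I (act w γ)) : act w γ = γ := by
  apply psum_injective
  intro j
  refine le_antisymm (psum_act_le h hw j) ?_
  have hw' : w⁻¹ ∈ symI I := by
    refine Finset.mem_filter.2 ⟨Finset.mem_univ _, fun i hi => ?_⟩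
    exact Equiv.Perm.inv_eq_iff_eq.2 ((Finset.mem_filter.1 hw).2 i hi).symm
  have := psum_act_le h' hw' j
  rwa [act_act, inv_mul_cancel, psum_act_one] at this

theorem plus_act (w : Equiv.Perm (Fin N)) (α : Comp N) : plus (act w α) = plus α := by
  have e : plus (act w α) = act ((sortPerm (act w α))⁻¹ * w * sortPerm α) (plus α) := by
    rw [plus_eq_act (act w α), ← act_act, act_sortPerm_plus, act_act]
  rw [e]
  apply eq_of_geI_act (mem_symI_univ _) (geI_plus α _)
  rw [← e]
  exact geI_plus _ _

theorem exists_act_of_plus_eq {α β : Comp N} (h : plus β = plus α) : ∃ w, β = act w α := by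
  refine ⟨sortPerm β * (sortPerm α)⁻¹, ?_⟩
  rw [← act_act, ← plus_eq_act, ← h, act_sortPerm_plus]

theorem plus_plus (α : Comp N) : plus (plus α) = plus α := by
  rw [plus_eq_act α, plus_act, plus_eq_act]

theorem psum_act_le_plus (w : Equiv.Perm (Fin N)) (α : Comp N) (j : Fin N) :
    psum (act w α) j ≤ psum (plus α) j := by
  rw [← act_sortPerm_plus (act w α), plus_act]
  exact psum_act_le (geI_plus α Finset.univ) (mem_symI_univ _) j

theorem psum_le_plus (α : Comp N) (j : Fin N) : psum α j ≤ psum (plus α) j :=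
  psum_act_le_plus 1 α j

theorem sum_act (w : Equiv.Perm (Fin N)) (α : Comp N) : ∑ i, act w α i = ∑ i, α i :=
  Equiv.sum_comp w⁻¹ α

/-- The order on compositions of the same size for which the operators `U_i` are triangular:
compare the sorted compositions first. -/
def DomLE (α β : Comp N) : Prop := ∑ i, α i = ∑ i, β i ∧
  (SDom (plus β) (plus α) ∨ (plus β = plus α ∧ ∀ j, psum α j ≤ psum β j))

theorem DomLE.refl (α : Comp N) : DomLE α α := ⟨rfl, Or.inr ⟨rfl, fun _ => le_rfl⟩⟩

theorem SDom.trans {α β γ : Comp N} (h : SDom α β) (h' : SDom β γ) : SDom α γ := by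
  refine ⟨fun j => (h'.1 j).trans (h.1 j), ?_⟩
  rintro rfl
  exact h.2 (psum_injective fun j => le_antisymm (h'.1 j) (h.1 j))

theorem SDom.irrefl (α : Comp N) : ¬ SDom α α := fun h => h.2 rfl

theorem DomLE.trans {α β γ : Comp N} (h : DomLE α β) (h' : DomLE β γ) : DomLE α γ := by
  refine ⟨h.1.trans h'.1, ?_⟩
  rcases h.2 with h1 | ⟨h1, h2⟩ <;> rcases h'.2 with h3 | ⟨h3, h4⟩
  · exact Or.inl (h3.trans h1)
  · exact Or.inl (h3 ▸ h1)
  · exact Or.inl (h1 ▸ h3)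
  · exact Or.inr ⟨h3.trans h1, fun j => (h2 j).trans (h4 j)⟩

theorem DomLE.antisymm {α β : Comp N} (h : DomLE α β) (h' : DomLE β α) : α = β := by
  rcases h.2 with h1 | ⟨h1, h2⟩ <;> rcases h'.2 with h3 | ⟨h3, h4⟩
  · exact absurd (h3.trans h1) (SDom.irrefl _)
  · exact absurd h3.symm h1.2
  · exact absurd h1.symm h3.2
  · exact psum_injective fun j => le_antisymm (h2 j) (h4 j)

theorem exists_minimal_le {s : Finset (Comp N)} {a : Comp N} (ha : a ∈ s) :
    ∃ b ∈ s, DomLE b a ∧ ∀ c ∈ s, DomLE c b → c = b := by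
  let P : PartialOrder (Comp N) :=
    { le := DomLE, lt := fun a b => DomLE a b ∧ ¬ DomLE b a, le_refl := DomLE.refl, le_trans := fun _ _ _ => DomLE.trans,
      le_antisymm := fun _ _ => DomLE.antisymm }
  obtain ⟨b, hb, hmin⟩ := @Finset.exists_le_minimal (Comp N) P.toPreorder a s ha
  exact ⟨b, hmin.1, hb, fun c hc hcb => DomLE.antisymm hcb (hmin.2 hc hcb)⟩

theorem sum_split (f : Fin N → ℕ) {p q : Fin N} (h : p ≠ q) {S : Finset (Fin N)} (hp : p ∈ S)
    (hq : q ∈ S) : ∑ i ∈ S, f i = f p + f q + ∑ i ∈ (S.erase p).erase q, f i := by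
  rw [add_assoc, Finset.add_sum_erase _ _ (Finset.mem_erase.2 ⟨h.symm, hq⟩),
    Finset.add_sum_erase _ _ hp]

/-- Moving two entries strictly inside their range at constant sum makes the sorted composition
smaller in dominance, wherever the two positions are. -/
theorem domLE_of_pinch {α β : Comp N} {p q : Fin N} (hpq : p ≠ q)
    (h : ∀ i, i ≠ p → i ≠ q → α i = β i) (hs : α p + α q = β p + β q) (h1 : α p < β p)
    (h2 : α q < β p) : DomLE α β ∧ α ≠ β := by
  have hrest : ∀ S : Finset (Fin N), ∀ i ∈ (S.erase p).erase q, α i = β i := fun S i hi => by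
    simp only [Finset.mem_erase] at hi
    exact h i hi.2.1 hi.1
  have hsum : ∀ S : Finset (Fin N), p ∈ S → q ∈ S → ∑ i ∈ S, α i = ∑ i ∈ S, β i := by
    intro S hp hq
    rw [sum_split α hpq hp hq, sum_split β hpq hp hq, hs, Finset.sum_congr rfl (hrest S)]
  refine ⟨⟨hsum _ (Finset.mem_univ p) (Finset.mem_univ q), Or.inl ⟨fun j => ?_, fun e => ?_⟩⟩,
    fun e => by simp [e] at h1⟩
  -- A partial sum of `α⁺` is a sum of `α` over a set `S` of positions. It is bounded by the sum of
  -- `β` over `S` if `p ∈ S`, and otherwise by that of `β` with `p` and `q` exchanged.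
  · set w := (sortPerm α)⁻¹
    have hS : ∀ γ : Comp N, psum (act w γ) j
        = ∑ i ∈ (Finset.Iic j).map (w⁻¹ : Equiv.Perm (Fin N)).toEmbedding, γ i := by
      intro γ; rw [psum, Finset.sum_map]; rfl
    change psum (plus α) j ≤ psum (plus β) j
    rw [plus_eq_act α]
    set S := (Finset.Iic j).map (w⁻¹ : Equiv.Perm (Fin N)).toEmbedding
    by_cases hp : p ∈ S
    · refine le_trans ?_ (psum_act_le_plus w β j)
      rw [hS, hS]
      by_cases hq : q ∈ S
      · exact (hsum S hp hq).le
      · refine Finset.sum_le_sum fun i hi => ?_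
        by_cases hip : i = p
        · rw [hip]; exact h1.le
        · exact (h i hip fun e => hq (e ▸ hi)).le
    · refine le_trans ?_ (psum_act_le_plus (w * Equiv.swap p q) β j)
      rw [← act_act, hS, hS]
      refine Finset.sum_le_sum fun i hi => ?_
      rw [act_swap_apply]
      by_cases hiq : i = q
      · rw [hiq, Equiv.swap_apply_right]; exact h2.le
      · have hip : i ≠ p := fun e => hp (e ▸ hi)
        rw [Equiv.swap_apply_of_ne_of_ne hip hiq]
        exact (h i hip hiq).le
  -- Equal rearrangements would have equal sums of squares, but pinching strictly lowers that sum.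
  · obtain ⟨w, hw⟩ := exists_act_of_plus_eq e
    have h3 : ∑ i, β i ^ 2 = ∑ i, α i ^ 2 := by
      rw [hw]; exact Equiv.sum_comp w⁻¹ fun i => α i ^ 2
    rw [sum_split (fun i => β i ^ 2) hpq (Finset.mem_univ p) (Finset.mem_univ q),
      sum_split (fun i => α i ^ 2) hpq (Finset.mem_univ p) (Finset.mem_univ q),
      Finset.sum_congr rfl fun i hi => congrArg (· ^ 2) (hrest Finset.univ i hi)] at h3
    have h4 := Nat.add_right_cancel h3
    zify at h1 h2 hs h4
    nlinarith [mul_pos (sub_pos.2 h1) (sub_pos.2 h2)]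

theorem domLE_act_swap {β : Comp N} {p q : Fin N} (hpq : p < q) (h : β q < β p) :
    DomLE (act (Equiv.swap p q) β) β ∧ act (Equiv.swap p q) β ≠ β := by
  refine ⟨⟨sum_act _ _, Or.inr ⟨(plus_act _ _).symm, fun j => ?_⟩⟩, fun e => ?_⟩
  · refine psum_act_le (I := {p, q}) ?_ ?_ j
    · intro i hi t ht hit
      simp only [Finset.mem_insert, Finset.mem_singleton] at hi ht
      rcases hi with rfl | rfl <;> rcases ht with rfl | rfl
      · exact le_rfl
      · exact h.le
      · exact absurd hit hpq.not_gt
      · exact le_rfl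
    · refine Finset.mem_filter.2 ⟨Finset.mem_univ _, fun i hi => ?_⟩
      simp only [Finset.mem_insert, Finset.mem_singleton, not_or] at hi
      exact Equiv.swap_apply_of_ne_of_ne hi.1 hi.2
  · have := congrFun e p
    rw [act_swap_apply, Equiv.swap_apply_left] at this
    omega

/-! ### Triangularity on monomials -/

/-- The monomial `x^β`. -/
noncomputable def mono (β : Comp N) : Poly N := monomial (Finsupp.equivFunOnFinite.symm β) 1

theorem coeff_mono (β γ : Comp N) :
    coeff (Finsupp.equivFunOnFinite.symm γ) (mono β) = if β = γ then 1 else 0 := by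
  rw [mono, coeff_monomial]
  simp only [EmbeddingLike.apply_eq_iff_eq]

theorem perm_mono (w : Equiv.Perm (Fin N)) (β : Comp N) : perm w (mono β) = mono (act w β) := by
  rw [perm_def, mono, rename_monomial, mono]
  congr 2
  ext i
  rw [Finsupp.mapDomain_equiv_apply]
  rfl

/-- The span of the monomials strictly below `x^β`. -/
noncomputable def lower (β : Comp N) : Submodule ℝ (Poly N) where
  carrier := {f | ∀ γ : Comp N, ¬ (DomLE γ β ∧ γ ≠ β) →
    coeff (Finsupp.equivFunOnFinite.symm γ) f = 0}
  add_mem' hf hg γ h := by rw [coeff_add, hf γ h, hg γ h, add_zero]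
  zero_mem' γ _ := coeff_zero _
  smul_mem' c f hf γ h := by rw [coeff_smul, hf γ h, smul_zero]

theorem mono_mem_lower {γ β : Comp N} (h : DomLE γ β ∧ γ ≠ β) : mono γ ∈ lower β := by
  intro δ hδ
  rw [coeff_mono, if_neg]
  rintro rfl
  exact hδ h

/-- The composition `β` with the entries at `i` and `j` replaced. -/
def setTwo (β : Comp N) (i j : Fin N) (s t : ℕ) : Comp N :=
  Function.update (Function.update β i s) j t

theorem setTwo_left (β : Comp N) {i j : Fin N} (h : i ≠ j) (s t : ℕ) :
    setTwo β i j s t i = s := by simp [setTwo, h]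

theorem setTwo_right (β : Comp N) (i j : Fin N) (s t : ℕ) :
    setTwo β i j s t j = t := by simp [setTwo]

theorem setTwo_of_ne (β : Comp N) {i j l : Fin N} (hi : l ≠ i) (hj : l ≠ j) (s t : ℕ) :
    setTwo β i j s t l = β l := by simp [setTwo, hi, hj]

theorem setTwo_self (β : Comp N) (i j : Fin N) : setTwo β i j (β i) (β j) = β := by
  simp [setTwo]

theorem act_swap_eq_setTwo (β : Comp N) {i j : Fin N} (h : i ≠ j) :
    act (Equiv.swap i j) β = setTwo β i j (β j) (β i) := by
  funext l
  rw [act_swap_apply]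
  by_cases hi : l = i
  · subst hi; rw [Equiv.swap_apply_left, setTwo_left β h]
  by_cases hj : l = j
  · subst hj; rw [Equiv.swap_apply_right, setTwo_right]
  rw [Equiv.swap_apply_of_ne_of_ne hi hj, setTwo_of_ne β hi hj]

theorem mono_setTwo (β : Comp N) {i j : Fin N} (h : i ≠ j) (s t : ℕ) :
    mono (setTwo β i j s t) = X i ^ s * X j ^ t * mono (setTwo β i j 0 0) := by
  rw [mono, mono, X_pow_eq_monomial, X_pow_eq_monomial, monomial_mul, monomial_mul, one_mul,
    one_mul]
  congr 2
  ext l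
  simp only [Finsupp.equivFunOnFinite_symm_apply_apply, Finsupp.add_apply, Finsupp.single_apply]
  by_cases hi : l = i
  · subst hi; rw [setTwo_left β h, setTwo_left β h, if_pos rfl, if_neg h.symm]; simp
  by_cases hj : l = j
  · subst hj; rw [setTwo_right, setTwo_right, if_pos rfl, if_neg h]; simp
  rw [setTwo_of_ne β hi hj, setTwo_of_ne β hi hj, if_neg (Ne.symm hi), if_neg (Ne.symm hj)]
  simp

theorem divDiff_mono_of_le (β : Comp N) {i j : Fin N} (h : i ≠ j) (hij : β j ≤ β i) :
    divDiff i j (X i * mono β)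
      = ∑ s ∈ Finset.range (β i + 1 - β j), mono (setTwo β i j (β j + s) (β i - s)) := by
  apply divDiff_eq h
  have e : ∀ s ∈ Finset.range (β i + 1 - β j), mono (setTwo β i j (β j + s) (β i - s))
      = X i ^ s * X j ^ (β i + 1 - β j - 1 - s)
        * (X i ^ β j * X j ^ β j * mono (setTwo β i j 0 0)) := by
    intro s hs
    rw [Finset.mem_range] at hs
    rw [mono_setTwo β h, show β i - s = (β i + 1 - β j - 1 - s) + β j by omega, pow_add, pow_add]
    ring
  have hd : β i + 1 = β j + (β i + 1 - β j) := by omega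
  have hm : mono β = X i ^ β i * X j ^ β j * mono (setTwo β i j 0 0) := by
    conv_lhs => rw [← setTwo_self β i j, mono_setTwo β h]
  have hg := (Commute.all (X i : Poly N) (X j)).mul_geom_sum₂ (β i + 1 - β j)
  rw [Finset.sum_congr rfl e, ← Finset.sum_mul, ← mul_assoc, hg, perm_mul, perm_mono, perm_X,
    Equiv.swap_apply_left, act_swap_eq_setTwo β h, mono_setTwo β h]
  conv_lhs => rw [hm]
  have h1 : (X i : Poly N) * (X i ^ β i * X j ^ β j * mono (setTwo β i j 0 0))
      = X i ^ (β i + 1) * (X j ^ β j * mono (setTwo β i j 0 0)) := by ring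
  have h2 : (X j : Poly N) * (X i ^ β j * X j ^ β i * mono (setTwo β i j 0 0))
      = X j ^ (β i + 1) * (X i ^ β j * mono (setTwo β i j 0 0)) := by ring
  rw [h1, h2]
  conv_lhs => rw [hd, pow_add, pow_add]
  ring

theorem divDiff_mono_of_lt (β : Comp N) {i j : Fin N} (h : i ≠ j) (hij : β i < β j) :
    divDiff i j (X i * mono β)
      = -∑ s ∈ Finset.range (β j - (β i + 1)),
          mono (setTwo β i j (β i + 1 + s) (β j - 1 - s)) := by
  apply divDiff_eq h
  have e : ∀ s ∈ Finset.range (β j - (β i + 1)), mono (setTwo β i j (β i + 1 + s) (β j - 1 - s))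
      = X i ^ s * X j ^ (β j - (β i + 1) - 1 - s)
        * (X i ^ (β i + 1) * X j ^ (β i + 1) * mono (setTwo β i j 0 0)) := by
    intro s hs
    rw [Finset.mem_range] at hs
    rw [mono_setTwo β h, show β j - 1 - s = (β j - (β i + 1) - 1 - s) + (β i + 1) by omega,
      pow_add, pow_add]
    ring
  have hd : β j = (β i + 1) + (β j - (β i + 1)) := by omega
  have hm : mono β = X i ^ β i * X j ^ β j * mono (setTwo β i j 0 0) := by
    conv_lhs => rw [← setTwo_self β i j, mono_setTwo β h]
  have hg := (Commute.all (X i : Poly N) (X j)).mul_geom_sum₂ (β j - (β i + 1))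
  rw [Finset.sum_congr rfl e, ← Finset.sum_mul, mul_neg, ← mul_assoc, hg, perm_mul, perm_mono,
    perm_X, Equiv.swap_apply_left, act_swap_eq_setTwo β h, mono_setTwo β h]
  conv_lhs => rw [hm]
  have h1 : (X i : Poly N) * (X i ^ β i * X j ^ β j * mono (setTwo β i j 0 0))
      = X j ^ β j * (X i ^ (β i + 1) * mono (setTwo β i j 0 0)) := by ring
  have h2 : (X j : Poly N) * (X i ^ β j * X j ^ β i * mono (setTwo β i j 0 0))
      = X i ^ β j * (X j ^ (β i + 1) * mono (setTwo β i j 0 0)) := by ring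
  rw [h1, h2]
  conv_lhs => rw [hd, pow_add, pow_add]
  ring

theorem setTwo_pinch_left (β : Comp N) {i j : Fin N} (h : i ≠ j) {s t : ℕ}
    (hs : s + t = β i + β j) (h1 : s < β i) (h2 : t < β i) :
    DomLE (setTwo β i j s t) β ∧ setTwo β i j s t ≠ β :=
  domLE_of_pinch h (fun l hi hj => setTwo_of_ne β hi hj s t)
    (by rw [setTwo_left β h, setTwo_right, hs]) (by rwa [setTwo_left β h]) (by rwa [setTwo_right])

theorem setTwo_pinch_right (β : Comp N) {i j : Fin N} (h : i ≠ j) {s t : ℕ}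
    (hs : s + t = β i + β j) (h1 : s < β j) (h2 : t < β j) :
    DomLE (setTwo β i j s t) β ∧ setTwo β i j s t ≠ β :=
  domLE_of_pinch h.symm (fun l hj hi => setTwo_of_ne β hi hj s t)
    (by rw [setTwo_left β h, setTwo_right]; omega) (by rwa [setTwo_right])
    (by rwa [setTwo_left β h])

/-- The contribution of the index `j` to `U_i x^β`, up to the factor `k`. -/
noncomputable def uTerm (β : Comp N) (i j : Fin N) : Poly N :=
  divDiff i j (X i * mono β) - if j < i then perm (Equiv.swap i j) (mono β) else 0

/-- The divided difference is a string of monomials between `x^β` and its transpose. Interior ones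
are pinched, hence lower. The end terms give the diagonal coefficient and, if not cancelled by the
subtracted transposition, a rearrangement of smaller partial sums. -/
theorem uTerm_triangular (β : Comp N) {i j : Fin N} (h : i ≠ j) :
    uTerm β i j - ((if β j ≤ β i then (1 : ℝ) else 0)
      - (if j < i ∧ β j = β i then 1 else 0)) • mono β ∈ lower β := by
  rw [uTerm, perm_mono]
  rcases lt_trichotomy (β i) (β j) with hlt | heq | hgt
  · rw [divDiff_mono_of_lt β h hlt, if_neg hlt.not_ge, if_neg (fun h : j < i ∧ β j = β i => hlt.ne' h.2),
      sub_zero, zero_smul, sub_zero]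
    refine Submodule.sub_mem _ (Submodule.neg_mem _ (Submodule.sum_mem _ fun s hs => ?_)) ?_
    · rw [Finset.mem_range] at hs
      exact mono_mem_lower (setTwo_pinch_right β h (by omega) (by omega) (by omega))
    · split_ifs with hji
      · rw [Equiv.swap_comm]
        exact mono_mem_lower (domLE_act_swap hji hlt)
      · exact Submodule.zero_mem _
  · rw [divDiff_mono_of_le β h heq.ge, heq, Nat.add_sub_cancel_left, Finset.sum_range_one,
      add_zero, Nat.sub_zero, if_pos le_rfl, act_swap_eq_setTwo β h]
    have : setTwo β i j (β j) (β j) = β := by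
      conv_rhs => rw [← setTwo_self β i j, heq]
    have h' : setTwo β i j (β j) (β i) = β := by rw [heq, this]
    rw [this, h']
    simp only [and_true]
    split_ifs <;> simp
  · obtain ⟨n, hn⟩ : ∃ n, β i + 1 - β j = n + 2 := ⟨β i - β j - 1, by omega⟩
    rw [divDiff_mono_of_le β h hgt.le, hn, Finset.sum_range_succ, Finset.sum_range_succ',
      if_pos hgt.le, show β j + (n + 1) = β i by omega, show β i - (n + 1) = β j by omega,
      setTwo_self, add_zero, Nat.sub_zero, ← act_swap_eq_setTwo β h,
      if_neg (show ¬ (j < i ∧ β j = β i) by omega), sub_zero, one_smul]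
    have hmid : ∑ s ∈ Finset.range n, mono (setTwo β i j (β j + (s + 1)) (β i - (s + 1)))
        ∈ lower β := by
      refine Submodule.sum_mem _ fun s hs => ?_
      rw [Finset.mem_range] at hs
      exact mono_mem_lower (setTwo_pinch_left β h (by omega) (by omega) (by omega))
    -- For `j < i` the transposed monomial at the start of the string is cancelled; for `i < j` it
    -- is itself lower.
    split_ifs with hji
    · convert hmid using 1; abel
    · have hij : i < j := lt_of_le_of_ne (not_lt.1 hji) h
      convert Submodule.add_mem _ hmid (mono_mem_lower (domLE_act_swap hij hgt)) using 1; abel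

theorem pderiv_X_mul_mono (β : Comp N) (i : Fin N) :
    pderiv i (X i * mono β) = ((β i : ℝ) + 1) • mono β := by
  rw [Derivation.leibniz, pderiv_X_self, mono, pderiv_monomial, smul_eq_mul, smul_eq_mul, mul_one,
    one_mul, add_smul, one_smul]
  congr 1
  rw [X, monomial_mul, one_mul, smul_monomial, Finsupp.equivFunOnFinite_symm_apply_apply]
  rcases Nat.eq_zero_or_pos (β i) with h0 | h0
  · simp [h0]
  · rw [add_tsub_cancel_of_le]
    · simp
    · rw [Finsupp.single_le_iff]; simpa using Nat.one_le_iff_ne_zero.2 h0.ne'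

theorem linU_mono (k : ℝ) (i : Fin N) (β : Comp N) :
    linU k i (mono β) - kappa k β i • mono β ∈ lower β := by
  have hsum : ∑ j ∈ Finset.univ.erase i, uTerm β i j
      = ∑ j ∈ Finset.univ.erase i, divDiff i j (X i * mono β)
        - ∑ j ∈ Finset.Iio i, perm (Equiv.swap i j) (mono β) := by
    simp only [uTerm]
    rw [Finset.sum_sub_distrib, ← Finset.sum_filter]
    congr 2
    ext j
    simp only [Finset.mem_filter, Finset.mem_erase, Finset.mem_univ, and_true, Finset.mem_Iio]
    exact ⟨fun h => h.2, fun h => ⟨h.ne, h⟩⟩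
  have h1 : linU k i (mono β) = ((β i : ℝ) + 1 + k) • mono β
      + k • ∑ j ∈ Finset.univ.erase i, uTerm β i j := by
    rw [hsum, linU_eq, dunklX_apply, dunkl, pderiv_X_mul_mono, smul_sub,
      add_smul _ k]
    abel
  have hk : kappa k β i = (β i : ℝ) + 1 + k + k * ∑ j ∈ Finset.univ.erase i,
      ((if β j ≤ β i then (1 : ℝ) else 0) - (if j < i ∧ β j = β i then 1 else 0)) := by
    rw [Finset.sum_sub_distrib, Finset.sum_erase_eq_sub (Finset.mem_univ i),
      Finset.sum_erase_eq_sub (Finset.mem_univ i), if_pos le_rfl, if_neg (by simp),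
      Finset.sum_boole, Finset.sum_boole, kappa]
    have hc := Finset.card_filter_add_card_filter_not
      (s := (Finset.univ : Finset (Fin N))) (fun j => β i < β j)
    simp only [not_lt, Finset.card_univ, Fintype.card_fin] at hc
    have hc' : ((Finset.univ.filter fun j => β i < β j).card : ℝ)
      + (Finset.univ.filter fun j => β j ≤ β i).card = N := by exact_mod_cast hc
    rw [← hc']
    ring
  have h2 : linU k i (mono β) - kappa k β i • mono β = k • ∑ j ∈ Finset.univ.erase i,
      (uTerm β i j - ((if β j ≤ β i then (1 : ℝ) else 0)
        - (if j < i ∧ β j = β i then 1 else 0)) • mono β) := by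
    rw [h1, hk, Finset.sum_sub_distrib (f := fun j => uTerm β i j), ← Finset.sum_smul]
    module
  rw [h2]
  exact Submodule.smul_mem _ _ (Submodule.sum_mem _ fun j hj =>
    uTerm_triangular β (Finset.ne_of_mem_erase hj).symm)

theorem pBasis_repr_linU_ne_zero {k : ℝ} (hk : 0 ≤ k) {i : Fin N} {β γ : Comp N}
    (h : (pBasis N hk).repr (linU k i (pPoly k β)) γ ≠ 0) : DomLE β γ := by
  by_contra hn
  apply h
  have hne : γ ≠ β := by rintro rfl; exact hn (DomLE.refl _)
  have := linU_mono k i γ β fun h => hn h.1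
  rw [coeff_sub, coeff_smul, coeff_mono, if_neg hne, smul_zero, sub_zero] at this
  rw [pBasis_repr_linU]
  exact this

theorem pBasis_repr_linU_self {k : ℝ} (hk : 0 ≤ k) (i : Fin N) (β : Comp N) :
    (pBasis N hk).repr (linU k i (pPoly k β)) β = kappa k β i := by
  have := linU_mono k i β β fun h => h.2 rfl
  rw [coeff_sub, coeff_smul, coeff_mono, if_pos rfl, smul_eq_mul, mul_one, sub_eq_zero] at this
  rw [pBasis_repr_linU]
  exact this

/-- At a minimal index `γ` of the support no other term contributes to the coefficient of `p_γ` in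
`U_i f`, so `μ = κ(γ)`. Injectivity of `κ` leaves only one minimal index, and every index of the
support lies above it. -/
theorem jointEigen_support {k : ℝ} (hk : 0 ≤ k) {μ : Fin N → ℝ} {f : Poly N} (hf : f ≠ 0)
    (h : JointEigen k μ f) : ∃ α, μ = kappa k α ∧ (pBasis N hk).repr f α ≠ 0 ∧
      ∀ β, (pBasis N hk).repr f β ≠ 0 → DomLE α β := by
  set b := pBasis N hk with hb
  have hmin : ∀ γ, b.repr f γ ≠ 0 → (∀ c, b.repr f c ≠ 0 → DomLE c γ → c = γ) →
      μ = kappa k γ := by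
    intro γ hγ hm
    funext i
    have e : b.repr (linU k i f) γ = b.repr f γ * kappa k γ i := by
      conv_lhs => rw [← b.linearCombination_repr f, Finsupp.linearCombination_apply, Finsupp.sum,
        map_sum, map_sum, Finsupp.finsetSum_apply]
      rw [Finset.sum_eq_single γ]
      · rw [map_smul, map_smul, Finsupp.smul_apply, hb, pBasis_apply, pBasis_repr_linU_self,
          smul_eq_mul]
      · intro c hc hne
        rw [map_smul, map_smul, Finsupp.smul_apply, hb, pBasis_apply]
        by_contra h0
        exact hne (hm c (Finsupp.mem_support_iff.1 hc)
          (pBasis_repr_linU_ne_zero hk (right_ne_zero_of_smul h0)))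
      · intro h0; exact absurd (Finsupp.mem_support_iff.2 hγ) h0
    rw [h i, map_smul, Finsupp.smul_apply, smul_eq_mul, mul_comm] at e
    exact mul_left_cancel₀ hγ e
  have hmin' : ∀ β, b.repr f β ≠ 0 → ∃ γ, b.repr f γ ≠ 0 ∧ DomLE γ β ∧ μ = kappa k γ := by
    intro β hβ
    obtain ⟨γ, h1, h2, h3⟩ := exists_minimal_le (Finsupp.mem_support_iff.2 hβ)
    rw [Finsupp.mem_support_iff] at h1
    exact ⟨γ, h1, h2, hmin γ h1 fun c hc => h3 c (Finsupp.mem_support_iff.2 hc)⟩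
  have hne : b.repr f ≠ 0 := fun e => hf ((LinearEquiv.map_eq_zero_iff _).1 e)
  obtain ⟨β, hβ⟩ := Finsupp.ne_iff.1 hne
  obtain ⟨α, h1, _, h3⟩ := hmin' β hβ
  refine ⟨α, h3, h1, fun β hβ => ?_⟩
  obtain ⟨γ, _, h5, h6⟩ := hmin' β hβ
  rwa [kappa_injective hk (h3.symm.trans h6)]

/-! ### Existence of joint eigenfunctions -/

theorem kappa_sub_sq_ne {k : ℝ} (hk : 0 ≤ k) {α : Comp N} {i j : Fin N} (h : α i ≠ α j) :
    (kappa k α i - kappa k α j) ^ 2 ≠ k ^ 2 := by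
  rcases lt_or_gt_of_ne h with h | h
  · have := kappa_sub_ge hk h
    nlinarith
  · have := kappa_sub_ge hk h
    nlinarith

/-- The transposition squares to one, so if the combination vanished, applying it twice would force
`d² = k²`. -/
theorem swap_combination_ne_zero {k d : ℝ} (hd : d ^ 2 ≠ k ^ 2) {f : Poly N} (hf : f ≠ 0)
    (i j : Fin N) : d • perm (Equiv.swap i j) f - k • f ≠ 0 := by
  intro e
  have e1 : d • perm (Equiv.swap i j) f = k • f := sub_eq_zero.1 e
  have e2 := congrArg (perm (Equiv.swap i j)) e1
  rw [map_smul, map_smul, perm_swap_swap] at e2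
  have e3 : (d ^ 2 - k ^ 2) • f = 0 := by
    rw [sub_smul, pow_two, pow_two, mul_smul, mul_smul, e2, smul_comm d k, e1, sub_self]
  exact (smul_ne_zero (sub_ne_zero.2 hd) hf) e3

theorem act_swap_act_swap (i j : Fin N) (α : Comp N) :
    act (Equiv.swap i j) (act (Equiv.swap i j) α) = α := by
  rw [act_act, Equiv.swap_mul_self, psum_act_one]

theorem exists_jointEigen_of_swap {k : ℝ} (hk : 0 ≤ k) {α : Comp N} {i i' : Fin N}
    (h : (i : ℕ) + 1 = i') (hne : α i ≠ α i')
    (hE : ∃ f : Poly N, f ≠ 0 ∧ JointEigen k (kappa k (act (Equiv.swap i i') α)) f) :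
    ∃ f : Poly N, f ≠ 0 ∧ JointEigen k (kappa k α) f := by
  obtain ⟨f, hf, hfe⟩ := hE
  have hne' : act (Equiv.swap i i') α i ≠ act (Equiv.swap i i') α i' := by
    simp only [act_swap_apply, Equiv.swap_apply_left, Equiv.swap_apply_right]
    exact hne.symm
  refine ⟨_, swap_combination_ne_zero (kappa_sub_sq_ne hk hne') hf i i', ?_⟩
  have := hfe.swap h
  rwa [← kappa_act_swap k h hne', act_swap_act_swap] at this

theorem jointEigen_one (k : ℝ) : JointEigen k (kappa k (0 : Comp N)) 1 := by
  have h1 : mono (0 : Comp N) = 1 := by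
    rw [mono]
    have : (Finsupp.equivFunOnFinite.symm (0 : Comp N)) = 0 := by ext; simp
    rw [this]; rfl
  intro i
  rw [← sub_eq_zero]
  ext γ
  have := linU_mono k i (0 : Comp N) (Finsupp.equivFunOnFinite γ) (by
    rintro ⟨h, h'⟩
    apply h'
    have := h.1
    simp only [Pi.zero_apply, Finset.sum_const_zero, Finset.sum_eq_zero_iff, Finset.mem_univ,
      true_implies] at this
    exact funext this)
  rw [h1, Equiv.symm_apply_apply] at this
  rw [this, coeff_zero]

/-- Induction on the degree, with an inner induction on the distance `m` of a nonzero entry from the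
last position. Intertwiners reduce to a nonzero last entry, and the raising operator then lowers the
degree. -/
theorem exists_jointEigen_succ {n : ℕ} {k : ℝ} (hk : 0 ≤ k) (d : ℕ) :
    ∀ α : Comp (n + 1), ∑ i, α i = d → ∃ f : Poly (n + 1), f ≠ 0 ∧ JointEigen k (kappa k α) f := by
  induction d with
  | zero =>
    intro α hα
    have : α = 0 := by
      funext i
      simp only [Finset.sum_eq_zero_iff, Finset.mem_univ, true_implies] at hα
      exact hα i
    subst this
    exact ⟨1, one_ne_zero, jointEigen_one k⟩
  | succ d ih =>
    have key : ∀ m : ℕ, ∀ (α : Comp (n + 1)) (i : Fin (n + 1)), ∑ i, α i = d + 1 → α i ≠ 0 →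
        (i : ℕ) + m = n → ∃ f : Poly (n + 1), f ≠ 0 ∧ JointEigen k (kappa k α) f := by
      intro m
      induction m with
      | zero =>
        intro α i hα hi him
        have hil : i = Fin.last n := Fin.ext (by simpa using him)
        subst hil
        -- The raising operator undone: the last entry, lowered by one, returns to the front. The
        -- truncated subtraction is harmless because that entry is nonzero.
        set β : Comp (n + 1) := Fin.cons (α (Fin.last n) - 1) fun i : Fin n => α i.castSucc with hβ
        have h0 : β 0 = α (Fin.last n) - 1 := rfl
        have hs : ∀ i : Fin n, β i.succ = α i.castSucc := fun _ => rfl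
        have e : (Fin.snoc (fun i : Fin n => β i.succ) (β 0 + 1) : Comp (n + 1)) = α := by
          funext i
          refine Fin.lastCases ?_ (fun i => ?_) i
          · rw [Fin.snoc_last (α := fun _ => ℕ), h0]; omega
          · rw [Fin.snoc_castSucc (α := fun _ => ℕ), hs]
        have hsum : ∑ i, β i = d := by
          rw [Fin.sum_univ_castSucc] at hα
          rw [Fin.sum_univ_succ, h0]
          simp only [hs]
          omega
        obtain ⟨f, hf, hfe⟩ := ih β hsum
        refine ⟨raise f, raise_ne_zero hf, ?_⟩
        rw [← e, kappa_snoc]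
        exact hfe.raise
      | succ m ihm =>
        intro α i hα hi him
        have hlt : (i : ℕ) + 1 < n + 1 := by omega
        set i' : Fin (n + 1) := ⟨i + 1, hlt⟩
        have h : (i : ℕ) + 1 = i' := rfl
        -- If the next entry is zero the two are unequal and the intertwiner exchanges them; if not,
        -- the next entry can take over without any exchange.
        by_cases h0 : α i' = 0
        · apply exists_jointEigen_of_swap hk h (by rw [h0]; exact hi)
          refine ihm _ i' (by rw [sum_act, hα]) ?_ (by omega)
          rwa [act_swap_apply, Equiv.swap_apply_right]
        · exact ihm α i' hα h0 (by omega)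
    intro α hα
    obtain ⟨i, hi⟩ : ∃ i, α i ≠ 0 := by
      by_contra! h
      simp [h] at hα
    exact key (n - i) α i hα hi (by omega)

theorem exists_jointEigen {k : ℝ} (hk : 0 ≤ k) (α : Comp N) :
    ∃ f : Poly N, f ≠ 0 ∧ JointEigen k (kappa k α) f := by
  cases N with
  | zero => exact ⟨1, one_ne_zero, fun i => i.elim0⟩
  | succ n => exact exists_jointEigen_succ hk _ α rfl

/-! ### Normalised joint eigenfunctions -/

theorem exists_monic {k : ℝ} (hk : 0 ≤ k) (α : Comp N) :
    ∃ f : Poly N, JointEigen k (kappa k α) f ∧ (pBasis N hk).repr f α = 1 := by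
  obtain ⟨f, hf, hfe⟩ := exists_jointEigen hk α
  obtain ⟨β, h1, h2, _⟩ := jointEigen_support hk hf hfe
  obtain rfl := kappa_injective hk h1
  refine ⟨((pBasis N hk).repr f α)⁻¹ • f, hfe.smul _, ?_⟩
  rw [map_smul, Finsupp.smul_apply, smul_eq_mul, inv_mul_cancel₀ h2]

/-- The joint eigenfunction whose `p_α`-coefficient is `1`. -/
noncomputable def monic {k : ℝ} (hk : 0 ≤ k) (α : Comp N) : Poly N :=
  Classical.choose (exists_monic hk α)

theorem monic_eigen {k : ℝ} (hk : 0 ≤ k) (α : Comp N) :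
    JointEigen k (kappa k α) (monic hk α) := (Classical.choose_spec (exists_monic hk α)).1

theorem monic_repr_self {k : ℝ} (hk : 0 ≤ k) (α : Comp N) :
    (pBasis N hk).repr (monic hk α) α = 1 := (Classical.choose_spec (exists_monic hk α)).2

theorem monic_support {k : ℝ} (hk : 0 ≤ k) {α β : Comp N}
    (h : (pBasis N hk).repr (monic hk α) β ≠ 0) : DomLE α β := by
  have hne : monic hk α ≠ 0 := fun e => by simp [e] at h
  obtain ⟨γ, h1, _, h3⟩ := jointEigen_support hk hne (monic_eigen hk α)
  obtain rfl := kappa_injective hk h1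
  exact h3 β h

/-- Simplicity of the spectrum: the difference is an eigenfunction for `κ(α)` without a `p_α` term,
which `jointEigen_support` forbids unless it is zero. -/
theorem eq_smul_monic {k : ℝ} (hk : 0 ≤ k) {α : Comp N} {f : Poly N}
    (h : JointEigen k (kappa k α) f) : f = (pBasis N hk).repr f α • monic hk α := by
  by_contra hne
  obtain ⟨γ, h1, h2, _⟩ := jointEigen_support hk (sub_ne_zero.2 hne)
    (h.sub ((monic_eigen hk α).smul _))
  obtain rfl := kappa_injective hk h1
  apply h2
  rw [map_sub, map_smul, Finsupp.sub_apply, Finsupp.smul_apply, monic_repr_self, smul_eq_mul,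
    mul_one, sub_self]

theorem act_injective (w : Equiv.Perm (Fin N)) : Function.Injective (act w) := fun α β h => by
  have := congrArg (act w⁻¹) h
  rwa [act_act, act_act, inv_mul_cancel, psum_act_one, psum_act_one] at this

theorem repr_pPoly {k : ℝ} (hk : 0 ≤ k) (α β : Comp N) :
    (pBasis N hk).repr (pPoly k α) β = if α = β then 1 else 0 := by
  rw [← pBasis_apply hk, Module.Basis.repr_self, Finsupp.single_apply]

theorem repr_perm {k : ℝ} (hk : 0 ≤ k) (w : Equiv.Perm (Fin N)) (f : Poly N) (β : Comp N) :
    (pBasis N hk).repr (perm w f) (act w β) = (pBasis N hk).repr f β := by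
  suffices h : (pBasis N hk).coord (act w β) ∘ₗ perm w = (pBasis N hk).coord β from
    LinearMap.congr_fun h f
  refine (pBasis N hk).ext fun γ => ?_
  simp only [LinearMap.comp_apply, Module.Basis.coord_apply, pBasis_apply, perm_pPoly, repr_pPoly,
    (act_injective w).eq_iff]

theorem repr_perm' {k : ℝ} (hk : 0 ≤ k) (w : Equiv.Perm (Fin N)) (f : Poly N) (β : Comp N) :
    (pBasis N hk).repr (perm w f) β = (pBasis N hk).repr f (act w⁻¹ β) := by
  rw [← repr_perm hk w f, act_act, mul_inv_cancel, psum_act_one]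

/-! ### Seminormal action of adjacent transpositions -/

/-- The coefficient in the action of an adjacent transposition. -/
noncomputable def swapCoeff (k : ℝ) (α : Comp N) (i i' : Fin N) : ℝ :=
  k / (kappa k α i - kappa k α i')

theorem swapCoeff_mem {k : ℝ} (hk : 0 ≤ k) {α : Comp N} {i i' : Fin N} (h : α i' < α i) :
    0 ≤ swapCoeff k α i i' ∧ swapCoeff k α i i' < 1 := by
  have := kappa_sub_ge hk h
  have h0 : 0 < kappa k α i - kappa k α i' := by linarith
  exact ⟨div_nonneg hk h0.le, (div_lt_one h0).2 (by linarith)⟩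

/-- The intertwiner gives a multiple of the eigenfunction for the exchanged composition. The factor
is read off at its leading index, which lies strictly below `α` and so does not occur in `monic hk
α`. -/
theorem monic_act_swap {k : ℝ} (hk : 0 ≤ k) {α : Comp N} {i i' : Fin N} (h : (i : ℕ) + 1 = i')
    (hlt : α i' < α i) : monic hk (act (Equiv.swap i i') α)
      = perm (Equiv.swap i i') (monic hk α) - swapCoeff k α i i' • monic hk α := by
  have hd : kappa k α i - kappa k α i' ≠ 0 := by have := kappa_sub_ge hk hlt; linarith
  have e := (monic_eigen hk α).swap h
  rw [← kappa_act_swap k h hlt.ne'] at e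
  have e2 := eq_smul_monic hk e
  have h0 : (pBasis N hk).repr (monic hk α) (act (Equiv.swap i i') α) = 0 := by
    by_contra hne
    have hs := domLE_act_swap (β := α) (p := i) (q := i') (Fin.lt_def.2 (by omega)) hlt
    exact hs.2 (hs.1.antisymm (monic_support hk hne))
  rw [map_sub, map_smul, map_smul, Finsupp.sub_apply, Finsupp.smul_apply, Finsupp.smul_apply,
    repr_perm, monic_repr_self, h0, smul_zero, sub_zero, smul_eq_mul, mul_one] at e2
  apply smul_right_injective _ hd
  dsimp only
  rw [← e2, smul_sub, smul_smul, swapCoeff, mul_div_cancel₀ _ hd]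

theorem perm_swap_monic {k : ℝ} (hk : 0 ≤ k) {α : Comp N} {i i' : Fin N} (h : (i : ℕ) + 1 = i')
    (hlt : α i' < α i) : perm (Equiv.swap i i') (monic hk α)
      = monic hk (act (Equiv.swap i i') α) + swapCoeff k α i i' • monic hk α := by
  rw [monic_act_swap hk h hlt, sub_add_cancel]

theorem perm_swap_monic_act {k : ℝ} (hk : 0 ≤ k) {α : Comp N} {i i' : Fin N}
    (h : (i : ℕ) + 1 = i') (hlt : α i' < α i) :
    perm (Equiv.swap i i') (monic hk (act (Equiv.swap i i') α))
      = (1 - swapCoeff k α i i' ^ 2) • monic hk α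
        - swapCoeff k α i i' • monic hk (act (Equiv.swap i i') α) := by
  rw [monic_act_swap hk h hlt, map_sub, map_smul, perm_swap_swap]
  module

/-- Here `κ_i - κ_{i'} = k`, so for `k > 0` the intertwiner is `k (s f - f)`. Its eigenvalues,
`κ(α)` with two unequal values exchanged, are not those of any composition, so it vanishes. For `k =
0` the transposition preserves the eigenspace and the coefficient of `p_α`. -/
theorem perm_swap_monic_of_eq {k : ℝ} (hk : 0 ≤ k) {α : Comp N} {i i' : Fin N}
    (h : (i : ℕ) + 1 = i') (e : α i = α i') :
    perm (Equiv.swap i i') (monic hk α) = monic hk α := by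
  have hs : ∀ t, α (Equiv.swap i i' t) = α t := by
    intro t
    by_cases h1 : t = i
    · rw [h1, Equiv.swap_apply_left, e]
    by_cases h2 : t = i'
    · rw [h2, Equiv.swap_apply_right, e]
    rw [Equiv.swap_apply_of_ne_of_ne h1 h2]
  have hκ := kappa_adjacent_of_eq k h e
  rcases hk.eq_or_lt with h0 | hpos
  · have hκ0 : ∀ t, kappa k α (Equiv.swap i i' t) = kappa k α t := by
      intro t; rw [kappa_eq_rank, kappa_eq_rank, hs, ← h0]; simp
    have he : JointEigen k (kappa k α) (perm (Equiv.swap i i') (monic hk α)) := by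
      intro t
      have hz : k • monic hk α = 0 := smul_eq_zero_of_left h0.symm _
      by_cases h1 : t = i
      · rw [h1, linU_left_perm_swap h, monic_eigen hk α, map_smul, ← hκ0 i,
          Equiv.swap_apply_left, hz, add_zero]
      by_cases h2 : t = i'
      · rw [h2, linU_right_perm_swap h, monic_eigen hk α, map_smul, ← hκ0 i',
          Equiv.swap_apply_right, hz, sub_zero]
      rw [linU_perm_swap_of_ne h k h1 h2, monic_eigen hk α, map_smul]
    have e2 := eq_smul_monic hk he
    have hα : act (Equiv.swap i i') α = α := funext fun t => by rw [act_swap_apply, hs]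
    have h1 := repr_perm hk (Equiv.swap i i') (monic hk α) α
    rw [hα, monic_repr_self] at h1
    rw [e2, h1, one_smul]
  · have hg := (monic_eigen hk α).swap h
    rw [hκ, ← smul_sub] at hg
    by_contra hne
    obtain ⟨β, h1, _⟩ := jointEigen_support hk (smul_ne_zero hpos.ne' (sub_ne_zero.2 hne)) hg
    have hβ : ∀ t, β t = α (Equiv.swap i i' t) :=
      eq_of_kappa_eq hk (Equiv.swap i i') fun t => (congrFun h1 t).symm
    have : β = α := funext fun t => (hβ t).trans (hs t)
    rw [this] at h1
    have := congrFun h1 i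
    rw [Function.comp, Equiv.swap_apply_left] at this
    linarith

/-! ### Generation by adjacent transpositions -/

/-- Colour classes without gaps make a Young subgroup generated by adjacent transpositions.
Different colourings yield the whole group, `S_I`, and the stabiliser of `α` in `S_I`. -/
theorem mem_subgroup_of_adjacent {ι : Type*} (c : Fin N → ι)
    (hc : ∀ p r q : Fin N, p < r → r < q → c p = c q → c r = c p)
    (G : Subgroup (Equiv.Perm (Fin N)))
    (hG : ∀ i i' : Fin N, (i : ℕ) + 1 = i' → c i = c i' → Equiv.swap i i' ∈ G)
    (u : Equiv.Perm (Fin N)) (hu : ∀ x, c (u x) = c x) : u ∈ G := by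
  have hswap : ∀ d : ℕ, ∀ p q : Fin N, (p : ℕ) + d + 1 = q → c p = c q → Equiv.swap p q ∈ G := by
    intro d
    induction d with
    | zero => intro p q h e; exact hG p q h e
    | succ d ih =>
      intro p q h e
      set r : Fin N := ⟨p + d + 1, by omega⟩ with hr
      have hpr : p < r := Fin.lt_def.2 (by simp only [hr]; omega)
      have hrq : r < q := Fin.lt_def.2 (by simp only [hr]; omega)
      have hcr := hc p r q hpr hrq e
      have h1 := ih p r rfl hcr.symm
      have h2 := hG r q (by simp only [hr]; omega) (hcr.trans e)
      -- With `r` just before `q`, the transposition of `p` and `q` is that of `p` and `r`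
      -- conjugated by that of `r` and `q`.
      have := Equiv.swap_mul_swap_mul_swap hpr.ne (hpr.trans hrq).ne
      rw [Equiv.swap_comm p q, ← this]
      exact G.mul_mem (G.mul_mem h2 h1) h2
  have hswap' : ∀ p q : Fin N, c p = c q → Equiv.swap p q ∈ G := by
    intro p q e
    rcases lt_trichotomy p q with h | h | h
    · exact hswap (q - p - 1) p q (by have := Fin.lt_def.1 h; omega) e
    · rw [h, Equiv.swap_self]; exact G.one_mem
    · rw [Equiv.swap_comm]
      exact hswap (p - q - 1) q p (by have := Fin.lt_def.1 h; omega) e.symm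
  induction hn : u.support.card using Nat.strong_induction_on generalizing u with
  | _ n ih =>
  by_cases h1 : u = 1
  · rw [h1]; exact G.one_mem
  · obtain ⟨p, hp⟩ : ∃ p, u p ≠ p := by
      by_contra! h
      exact h1 (Equiv.ext h)
    have hv : Equiv.swap p (u p) * u ∈ G := by
      refine ih _ (hn ▸ Equiv.Perm.card_support_swap_mul hp) _ (fun x => ?_) rfl
      rw [Equiv.Perm.mul_apply]
      by_cases h2 : u x = p
      · rw [h2, Equiv.swap_apply_left, hu, ← hu x, h2]
      by_cases h3 : u x = u p
      · rw [h3, Equiv.swap_apply_right, ← hu x, h3, hu]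
      rw [Equiv.swap_apply_of_ne_of_ne h2 h3, hu]
    have := G.mul_mem (hswap' p (u p) (hu p).symm) hv
    rwa [← mul_assoc, Equiv.swap_mul_self, one_mul] at this

/-- The permutations preserving a subspace. -/
def stabSpace (W : Submodule ℝ (Poly N)) : Subgroup (Equiv.Perm (Fin N)) where
  carrier := {w | ∀ f, perm w f ∈ W ↔ f ∈ W}
  mul_mem' {v w} hv hw f := by rw [perm_comp, hv, hw]
  one_mem' f := by rw [perm_one]
  inv_mem' {w} hw f := by rw [← hw, perm_perm_inv]

/-- The span of the eigenfunctions indexed by `O`. -/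
noncomputable def monicSpan {k : ℝ} (hk : 0 ≤ k) (O : Set (Comp N)) : Submodule ℝ (Poly N) :=
  Submodule.span ℝ (monic hk '' O)

theorem monic_mem_monicSpan {k : ℝ} (hk : 0 ≤ k) {O : Set (Comp N)} {α : Comp N} (h : α ∈ O) :
    monic hk α ∈ monicSpan hk O := Submodule.subset_span ⟨α, h, rfl⟩

theorem swap_mem_stabSpace_monicSpan {k : ℝ} (hk : 0 ≤ k) {O : Set (Comp N)} {i i' : Fin N}
    (h : (i : ℕ) + 1 = i') (hO : ∀ α ∈ O, act (Equiv.swap i i') α ∈ O) :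
    Equiv.swap i i' ∈ stabSpace (monicSpan hk O) := by
  have key : ∀ f ∈ monicSpan hk O, perm (Equiv.swap i i') f ∈ monicSpan hk O := by
    intro f hf
    refine Submodule.span_induction ?_ ?_ ?_ ?_ hf
    · rintro _ ⟨α, hα, rfl⟩
      have h1 := monic_mem_monicSpan hk hα
      have h2 := monic_mem_monicSpan hk (hO α hα)
      rcases lt_trichotomy (α i) (α i') with hlt | heq | hgt
      · have e := perm_swap_monic_act hk (α := act (Equiv.swap i i') α) h (by
          simpa only [act_swap_apply, Equiv.swap_apply_left, Equiv.swap_apply_right] using hlt)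
        rw [act_swap_act_swap] at e
        rw [e]
        exact Submodule.sub_mem _ (Submodule.smul_mem _ _ h2) (Submodule.smul_mem _ _ h1)
      · rwa [perm_swap_monic_of_eq hk h heq]
      · rw [perm_swap_monic hk h hgt]
        exact Submodule.add_mem _ h2 (Submodule.smul_mem _ _ h1)
    · rw [map_zero]; exact Submodule.zero_mem _
    · intro f g _ _ hf hg; rw [map_add]; exact Submodule.add_mem _ hf hg
    · intro c f _ hf; rw [map_smul]; exact Submodule.smul_mem _ _ hf
  intro f
  refine ⟨fun hf => ?_, key f⟩
  have := key _ hf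
  rwa [perm_swap_swap] at this

/-! ### The polynomials `ω` and `ζ` -/

theorem linU_iff (k : ℝ) (μ : Fin N → ℝ) (f : Poly N) :
    (∀ i, opU k i f = μ i • f) ↔ JointEigen k μ f := by
  simp only [JointEigen, linU_apply]

theorem mem_span_pPoly {k : ℝ} (hk : 0 ≤ k) {P : Comp N → Prop} {f : Poly N}
    (h : ∀ β, (pBasis N hk).repr f β ≠ 0 → P β) :
    f ∈ Submodule.span ℝ {q : Poly N | ∃ β, P β ∧ q = pPoly k β} := by
  rw [← (pBasis N hk).linearCombination_repr f, Finsupp.linearCombination_apply, Finsupp.sum]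
  refine Submodule.sum_mem _ fun β hβ => Submodule.smul_mem _ _ (Submodule.subset_span ?_)
  exact ⟨β, h β (Finsupp.mem_support_iff.1 hβ), pBasis_apply hk β⟩

theorem repr_eq_zero_of_mem_span {k : ℝ} (hk : 0 ≤ k) {s : Set (Poly N)} {α : Comp N}
    (h : ∀ q ∈ s, (pBasis N hk).repr q α = 0) {f : Poly N} (hf : f ∈ Submodule.span ℝ s) :
    (pBasis N hk).repr f α = 0 := by
  have : Submodule.span ℝ s ≤ LinearMap.ker ((pBasis N hk).coord α) :=
    Submodule.span_le.2 fun q hq => h q hq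
  exact this hf

/-- A partition has the largest partial sums among its rearrangements, so any other index above it
for `DomLE` has a strictly dominating rearrangement, as the definition of `ω` demands. -/
theorem isOmega_iff {k : ℝ} (hk : 0 ≤ k) {lam : Comp N} (hlam : plus lam = lam) (f : Poly N) :
    IsOmega k lam f ↔ f = monic hk lam := by
  constructor
  · rintro ⟨h1, h2⟩
    rw [linU_iff] at h1
    have h3 := repr_eq_zero_of_mem_span hk (α := lam) (fun q hq => by
      obtain ⟨β, _, h5, rfl⟩ := hq
      rw [repr_pPoly, if_neg]
      rintro rfl
      rw [hlam] at h5
      exact h5.2 rfl) h2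
    rw [map_sub, Finsupp.sub_apply, repr_pPoly, if_pos rfl, sub_eq_zero] at h3
    rw [eq_smul_monic hk h1, h3, one_smul]
  · rintro rfl
    refine ⟨(linU_iff _ _ _).2 (monic_eigen hk lam), ?_⟩
    have := mem_span_pPoly hk (f := monic hk lam - pPoly k lam)
      (P := fun β => ∑ i, β i = ∑ i, lam i ∧ SDom (plus β) lam) (fun β hβ => by
        rw [map_sub, Finsupp.sub_apply, repr_pPoly] at hβ
        have hne : lam ≠ β := by
          rintro rfl
          rw [monic_repr_self, if_pos rfl, sub_self] at hβ
          exact hβ rfl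
        rw [if_neg hne, sub_zero] at hβ
        obtain ⟨h1, h2 | ⟨h2, h3⟩⟩ := monic_support hk hβ
        · rw [hlam] at h2
          exact ⟨h1.symm, h2⟩
        · exfalso
          apply hne
          refine psum_injective fun j => le_antisymm (h3 j) ?_
          rw [hlam] at h2
          rw [← h2]
          exact psum_le_plus β j)
    simpa only [and_assoc] using this

theorem omega_eq {k : ℝ} (hk : 0 ≤ k) (α : Comp N) :
    omega k α = perm (sortPerm α) (monic hk (plus α)) := by
  have h := Classical.epsilon_spec (p := IsOmega k (plus α))
    ⟨_, (isOmega_iff hk (plus_plus α) _).2 rfl⟩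
  rw [omega, (isOmega_iff hk (plus_plus α) _).1 h]

theorem omega_repr_self {k : ℝ} (hk : 0 ≤ k) (α : Comp N) :
    (pBasis N hk).repr (omega k α) α = 1 := by
  have := repr_perm hk (sortPerm α) (monic hk (plus α)) (plus α)
  rwa [act_sortPerm_plus, monic_repr_self, ← omega_eq] at this

/-- Within one orbit of compositions the `ω_α` are thus dual to the coefficients at the `p_β`, which
makes expansions in the `ω_β` readable. -/
theorem omega_support {k : ℝ} (hk : 0 ≤ k) {α β : Comp N} (hp : plus β = plus α)
    (h : (pBasis N hk).repr (omega k α) β ≠ 0) : β = α := by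
  rw [omega_eq hk, repr_perm'] at h
  obtain ⟨_, h2 | ⟨_, h3⟩⟩ := monic_support hk h
  · rw [plus_act, plus_plus, hp] at h2
    exact absurd rfl h2.2
  · have e : plus α = act (sortPerm α)⁻¹ β := by
      refine psum_injective fun j => le_antisymm (h3 j) ?_
      rw [← hp]
      exact psum_act_le_plus _ β j
    apply act_injective (sortPerm α)⁻¹
    rw [← e, plus_eq_act]

theorem eq_zero_of_mem_monicSpan {k : ℝ} (hk : 0 ≤ k) {O : Set (Comp N)} {f : Poly N}
    (hf : f ∈ monicSpan hk O) (h : ∀ β ∈ O, (pBasis N hk).repr f β = 0) : f = 0 := by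
  obtain ⟨l, hl, rfl⟩ := (Finsupp.mem_span_image_iff_linearCombination ℝ).1 hf
  by_contra hne
  have hl0 : l ≠ 0 := by rintro rfl; simp at hne
  obtain ⟨β, hβ⟩ := Finsupp.ne_iff.1 hl0
  obtain ⟨γ, h1, _, h3⟩ := exists_minimal_le (Finsupp.mem_support_iff.2 hβ)
  apply Finsupp.mem_support_iff.1 h1
  have e := h γ ((Finsupp.mem_supported ℝ l).1 hl h1)
  rw [Finsupp.linearCombination_apply, Finsupp.sum, map_sum, Finsupp.finsetSum_apply,
    Finset.sum_eq_single γ] at e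
  · rwa [map_smul, Finsupp.smul_apply, monic_repr_self, smul_eq_mul, mul_one] at e
  · intro δ hδ hne
    rw [map_smul, Finsupp.smul_apply]
    by_contra h0
    exact hne (h3 δ hδ (monic_support hk (right_ne_zero_of_smul h0)))
  · intro h0; exact absurd h1 h0

theorem perm_mem_monicSpan_plus {k : ℝ} (hk : 0 ≤ k) (lam : Comp N) (w : Equiv.Perm (Fin N))
    {f : Poly N} (hf : f ∈ monicSpan hk {β : Comp N | plus β = lam}) :
    perm w f ∈ monicSpan hk {β : Comp N | plus β = lam} := by
  have := mem_subgroup_of_adjacent (fun _ => ()) (fun _ _ _ _ _ _ => rfl)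
    (stabSpace (monicSpan hk {β : Comp N | plus β = lam})) (fun i i' h _ =>
      swap_mem_stabSpace_monicSpan hk h fun α (hα : plus α = lam) => by
        rw [Set.mem_ofPred_eq, plus_act, hα]) w fun _ => rfl
  exact (this f).2 hf

/-- Both sides lie in the span of the eigenfunctions of one orbit, which is stable under `S_N`; its
elements are determined by their coefficients at the `p_β` of that orbit. -/
theorem monic_eq_sum_omega {k : ℝ} (hk : 0 ≤ k) (α : Comp N) :
    monic hk α = ∑ β ∈ Finset.univ.image fun w => act w α,
      (pBasis N hk).repr (monic hk α) β • omega k β := by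
  have hS : ∀ β, β ∈ (Finset.univ.image fun w => act w α) ↔ plus β = plus α := by
    intro β
    simp only [Finset.mem_image, Finset.mem_univ, true_and]
    constructor
    · rintro ⟨w, rfl⟩; exact plus_act w α
    · intro h
      obtain ⟨w, hw⟩ := exists_act_of_plus_eq h
      exact ⟨w, hw.symm⟩
  rw [← sub_eq_zero]
  refine eq_zero_of_mem_monicSpan hk (O := {β : Comp N | plus β = plus α}) ?_ ?_
  · refine Submodule.sub_mem _ (monic_mem_monicSpan hk rfl)
      (Submodule.sum_mem _ fun β hβ => Submodule.smul_mem _ _ ?_)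
    rw [omega_eq hk]
    refine perm_mem_monicSpan_plus hk _ _ (monic_mem_monicSpan hk ?_)
    rw [Set.mem_ofPred_eq, plus_plus]
    exact (hS β).1 hβ
  · intro β hβ
    rw [map_sub, map_sum, Finsupp.sub_apply, Finsupp.finsetSum_apply, Finset.sum_eq_single β]
    · rw [map_smul, Finsupp.smul_apply, omega_repr_self, smul_eq_mul, mul_one, sub_self]
    · intro γ hγ hne
      rw [map_smul, Finsupp.smul_apply]
      by_contra h0
      exact hne (omega_support hk (Eq.trans hβ ((hS γ).1 hγ).symm) (right_ne_zero_of_smul h0)).symm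
    · intro h0; exact absurd ((hS β).2 hβ) h0

theorem isZeta_iff {k : ℝ} (hk : 0 ≤ k) (α : Comp N) (f : Poly N) :
    IsZeta k α f ↔ f = monic hk α := by
  constructor
  · rintro ⟨h1, h2⟩
    rw [linU_iff] at h1
    have h3 := repr_eq_zero_of_mem_span hk (α := α) (fun q hq => by
      obtain ⟨β, h4, h5, rfl⟩ := hq
      by_contra h0
      exact h5.2 (omega_support hk h4.symm h0).symm) h2
    rw [map_sub, Finsupp.sub_apply, omega_repr_self, sub_eq_zero] at h3
    rw [eq_smul_monic hk h1, h3, one_smul]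
  · rintro rfl
    refine ⟨(linU_iff _ _ _).2 (monic_eigen hk α), ?_⟩
    have hα : α ∈ Finset.univ.image fun w => act w α :=
      Finset.mem_image.2 ⟨1, Finset.mem_univ _, rfl⟩
    have e := monic_eq_sum_omega hk α
    rw [← Finset.add_sum_erase _ _ hα, monic_repr_self, one_smul] at e
    rw [sub_eq_of_eq_add' e]
    refine Submodule.sum_mem _ fun β hβ => ?_
    obtain ⟨hne, hβ⟩ := Finset.mem_erase.1 hβ
    obtain ⟨w, _, rfl⟩ := Finset.mem_image.1 hβ
    by_cases h0 : (pBasis N hk).repr (monic hk α) (act w α) = 0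
    · rw [h0, zero_smul]; exact Submodule.zero_mem _
    · refine Submodule.smul_mem _ _ (Submodule.subset_span ⟨_, plus_act w α, ⟨?_, hne⟩, rfl⟩)
      obtain ⟨_, h2 | ⟨_, h3⟩⟩ := monic_support hk h0
      · rw [plus_act] at h2; exact absurd rfl h2.2
      · exact h3

theorem zeta_eq_monic {k : ℝ} (hk : 0 ≤ k) (α : Comp N) : zeta k α = monic hk α :=
  (isZeta_iff hk α _).1 (Classical.epsilon_spec (p := IsZeta k α) ⟨_, (isZeta_iff hk α _).2 rfl⟩)

/-! ### The group `S_I` and the products `E_ε` -/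

theorem mem_symI {I : Finset (Fin N)} {w : Equiv.Perm (Fin N)} :
    w ∈ symI I ↔ ∀ i, i ∉ I → w i = i := by simp [symI]

theorem mul_mem_symI {I : Finset (Fin N)} {v w : Equiv.Perm (Fin N)} (hv : v ∈ symI I)
    (hw : w ∈ symI I) : v * w ∈ symI I := mem_symI.2 fun i hi => by
  rw [Equiv.Perm.mul_apply, mem_symI.1 hw i hi, mem_symI.1 hv i hi]

theorem inv_mem_symI {I : Finset (Fin N)} {w : Equiv.Perm (Fin N)} (hw : w ∈ symI I) :
    w⁻¹ ∈ symI I := mem_symI.2 fun i hi =>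
  Equiv.Perm.inv_eq_iff_eq.2 (mem_symI.1 hw i hi).symm

theorem swap_mem_symI {I : Finset (Fin N)} {i j : Fin N} (hi : i ∈ I) (hj : j ∈ I) :
    Equiv.swap i j ∈ symI I := mem_symI.2 fun _ ht =>
  Equiv.swap_apply_of_ne_of_ne (fun e => ht (e ▸ hi)) (fun e => ht (e ▸ hj))

theorem apply_mem_iff {I : Finset (Fin N)} {w : Equiv.Perm (Fin N)} (hw : w ∈ symI I)
    (i : Fin N) : w i ∈ I ↔ i ∈ I := by
  constructor
  · intro h
    by_contra hi
    rw [mem_symI.1 hw i hi] at h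
    exact hi h
  · intro h
    by_contra hi
    have := mem_symI.1 hw _ hi
    rw [w.injective this] at hi
    exact hi h

theorem act_mem_orbitI {I : Finset (Fin N)} {α : Comp N} {w : Equiv.Perm (Fin N)}
    (hw : w ∈ symI I) : act w α ∈ orbitI I α := Finset.mem_image.2 ⟨w, hw, rfl⟩

theorem self_mem_orbitI (I : Finset (Fin N)) (α : Comp N) : α ∈ orbitI I α :=
  act_mem_orbitI (one_mem_symI I)

theorem act_mem_orbitI_of_mem {I : Finset (Fin N)} {α β : Comp N} {w : Equiv.Perm (Fin N)}
    (hw : w ∈ symI I) (hβ : β ∈ orbitI I α) : act w β ∈ orbitI I α := by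
  obtain ⟨v, hv, rfl⟩ := Finset.mem_image.1 hβ
  rw [act_act]
  exact act_mem_orbitI (mul_mem_symI hw hv)

theorem sum_orbitI_act {M : Type*} [AddCommMonoid M] {I : Finset (Fin N)} {α : Comp N}
    {w : Equiv.Perm (Fin N)} (hw : w ∈ symI I) (f : Comp N → M) :
    ∑ β ∈ orbitI I α, f (act w β) = ∑ β ∈ orbitI I α, f β := by
  refine Finset.sum_nbij' (act w) (act w⁻¹) ?_ ?_ ?_ ?_ ?_
  · intro β hβ; exact act_mem_orbitI_of_mem hw hβ
  · intro β hβ; exact act_mem_orbitI_of_mem (inv_mem_symI hw) hβ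
  · intro β _; rw [act_act, inv_mul_cancel, psum_act_one]
  · intro β _; rw [act_act, mul_inv_cancel, psum_act_one]
  · intro β _; rfl

theorem sum_symI_mul_left {M : Type*} [AddCommMonoid M] {I : Finset (Fin N)}
    {v : Equiv.Perm (Fin N)} (hv : v ∈ symI I) (f : Equiv.Perm (Fin N) → M) :
    ∑ w ∈ symI I, f (v * w) = ∑ w ∈ symI I, f w := by
  refine Finset.sum_nbij' (v * ·) (v⁻¹ * ·) ?_ ?_ ?_ ?_ ?_
  · intro w hw; exact mul_mem_symI hv hw
  · intro w hw; exact mul_mem_symI (inv_mem_symI hv) hw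
  · intro w _; simp
  · intro w _; simp
  · intro w _; rfl

theorem sum_symI_mul_right {M : Type*} [AddCommMonoid M] {I : Finset (Fin N)}
    {v : Equiv.Perm (Fin N)} (hv : v ∈ symI I) (f : Equiv.Perm (Fin N) → M) :
    ∑ w ∈ symI I, f (w * v) = ∑ w ∈ symI I, f w := by
  refine Finset.sum_nbij' (· * v) (· * v⁻¹) ?_ ?_ ?_ ?_ ?_
  · intro w hw; exact mul_mem_symI hw hv
  · intro w hw; exact mul_mem_symI hw (inv_mem_symI hv)
  · intro w _; simp
  · intro w _; simp
  · intro w _; rfl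

/-- Sets of indices without gaps. -/
def NoGap (I : Finset (Fin N)) : Prop := ∀ p ∈ I, ∀ q ∈ I, ∀ r, p < r → r < q → r ∈ I

theorem noGap_interval (l m : ℕ) : NoGap (interval N l m) := by
  intro p hp q hq r hpr hrq
  simp only [interval, Finset.mem_filter, Finset.mem_univ, true_and, Fin.lt_def] at *
  omega

theorem symI_subset_subgroup {I : Finset (Fin N)} (hI : NoGap I)
    (G : Subgroup (Equiv.Perm (Fin N)))
    (hG : ∀ i ∈ I, ∀ i' ∈ I, (i : ℕ) + 1 = i' → Equiv.swap i i' ∈ G)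
    {w : Equiv.Perm (Fin N)} (hw : w ∈ symI I) : w ∈ G := by
  refine mem_subgroup_of_adjacent (fun p => if p ∈ I then none else some p) ?_ G ?_ w ?_
  · intro p r q hpr hrq e
    by_cases hp : p ∈ I <;> by_cases hq : q ∈ I <;> simp only [hp, hq, if_true, if_false] at e ⊢
    · rw [if_pos (hI p hp q hq r hpr hrq)]
    · simp at e
    · simp at e
    · simp only [Option.some.injEq] at e
      exact absurd (hpr.trans hrq) (by rw [e]; exact lt_irrefl _)
  · intro i i' h e
    by_cases hi : i ∈ I <;> by_cases hi' : i' ∈ I <;> simp only [hi, hi', if_true, if_false] at e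
    · exact hG i hi i' hi' h
    · simp at e
    · simp at e
    · simp only [Option.some.injEq] at e
      rw [e] at h; omega
  · intro x
    by_cases hx : x ∈ I
    · rw [if_pos hx, if_pos ((apply_mem_iff hw x).2 hx)]
    · rw [mem_symI.1 hw x hx]

/-- Monotonicity of `α` on `I` makes its level sets there intervals, so its stabiliser in `S_I` is
generated by adjacent transpositions of equal entries. This is why `g_β` is well defined. -/
theorem perm_monic_of_act_eq {k : ℝ} (hk : 0 ≤ k) {I : Finset (Fin N)} (hI : NoGap I)
    {α : Comp N} (hα : GeI I α) {u : Equiv.Perm (Fin N)} (hu : u ∈ symI I) (he : act u α = α) :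
    perm u (monic hk α) = monic hk α := by
  let G : Subgroup (Equiv.Perm (Fin N)) :=
    { carrier := {u | perm u (monic hk α) = monic hk α}
      mul_mem' := fun {v w} (hv : perm v _ = _) (hw : perm w _ = _) => by
        change perm (v * w) _ = _
        rw [perm_comp, hw, hv]
      one_mem' := perm_one _
      inv_mem' := fun {w} (hw : perm w _ = _) => by
        change perm w⁻¹ _ = _
        conv_lhs => rw [← hw]
        rw [perm_inv_perm] }
  refine mem_subgroup_of_adjacent
    (fun p => if p ∈ I then (Sum.inl (α p) : ℕ ⊕ Fin N) else Sum.inr p) ?_ G ?_ u ?_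
  · intro p r q hpr hrq e
    by_cases hp : p ∈ I <;> by_cases hq : q ∈ I <;> simp only [hp, hq, if_true, if_false] at e ⊢
    · have hr := hI p hp q hq r hpr hrq
      rw [if_pos hr]
      have h1 := hα p hp r hr hpr
      have h2 := hα r hr q hq hrq
      simp only [Sum.inl.injEq] at e ⊢
      omega
    · simp at e
    · simp at e
    · simp only [Sum.inr.injEq] at e
      exact absurd (hpr.trans hrq) (by rw [e]; exact lt_irrefl _)
  · intro i i' h e
    by_cases hi : i ∈ I <;> by_cases hi' : i' ∈ I <;> simp only [hi, hi', if_true, if_false] at e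
    · exact perm_swap_monic_of_eq hk h (Sum.inl.inj e)
    · simp at e
    · simp at e
    · simp only [Sum.inr.injEq] at e
      rw [e] at h; omega
  · intro x
    by_cases hx : x ∈ I
    · rw [if_pos hx, if_pos ((apply_mem_iff hu x).2 hx)]
      have := congrFun he (u x)
      simp only [act, Equiv.Perm.inv_def, Equiv.symm_apply_apply] at this
      rw [this]
    · rw [mem_symI.1 hu x hx]

theorem perm_monic_eq_of_act_eq {k : ℝ} (hk : 0 ≤ k) {I : Finset (Fin N)} (hI : NoGap I)
    {α : Comp N} (hα : GeI I α) {v w : Equiv.Perm (Fin N)} (hv : v ∈ symI I) (hw : w ∈ symI I)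
    (he : act v α = act w α) : perm v (monic hk α) = perm w (monic hk α) := by
  have h := perm_monic_of_act_eq hk hI hα (mul_mem_symI (inv_mem_symI hw) hv) (by
    rw [← act_act, he, act_act, inv_mul_cancel, psum_act_one])
  calc perm v (monic hk α) = perm (w * (w⁻¹ * v)) (monic hk α) := by rw [mul_inv_cancel_left]
    _ = perm w (monic hk α) := by rw [perm_comp, h]

theorem gPoly_act {k : ℝ} (hk : 0 ≤ k) {I : Finset (Fin N)} (hI : NoGap I)
    {α : Comp N} (hα : GeI I α) {w : Equiv.Perm (Fin N)} (hw : w ∈ symI I) :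
    gPoly k I α (act w α) = perm w (monic hk α) := by
  have h := Classical.epsilon_spec
    (p := fun v : Equiv.Perm (Fin N) => v ∈ symI I ∧ act v α = act w α) ⟨w, hw, rfl⟩
  rw [gPoly, zeta_eq_monic hk]
  exact perm_monic_eq_of_act_eq hk hI hα h.1 hw h.2

theorem calE_pos {k ε : ℝ} (hk : 0 ≤ k) (hε : ε = 1 ∨ ε = -1) (I : Finset (Fin N)) (β : Comp N) :
    0 < calE k ε I β := by
  refine Finset.prod_pos fun q hq => ?_
  have h := kappa_sub_ge hk (Finset.mem_filter.1 hq).2.2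
  have h0 : 0 < kappa k β q.2 - kappa k β q.1 := by linarith
  have h1 : 0 ≤ k / (kappa k β q.2 - kappa k β q.1) := div_nonneg hk h0.le
  have h2 : k / (kappa k β q.2 - kappa k β q.1) < 1 := (div_lt_one h0).2 (by linarith)
  rcases hε with rfl | rfl
  · rw [one_mul]; linarith
  · rw [mul_div_assoc]; linarith

theorem calE_of_geI (k ε : ℝ) {I : Finset (Fin N)} {α : Comp N} (hα : GeI I α) :
    calE k ε I α = 1 := by
  rw [calE, Finset.filter_eq_empty_iff.2, Finset.prod_empty]
  intro q hq h
  rw [Finset.mem_product] at hq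
  exact absurd (hα q.1 hq.1 q.2 hq.2 h.1) (not_le.2 h.2)

/-- An adjacent transposition preserves the order of every pair except `(i, i')`. The ascents of the
new composition are the transposed old ones together with that pair, and `κ` moves along with the
positions. -/
theorem calE_act_swap (k ε : ℝ) {I : Finset (Fin N)} {β : Comp N} {i i' : Fin N} (hi : i ∈ I)
    (hi' : i' ∈ I) (h : (i : ℕ) + 1 = i') (hlt : β i' < β i) :
    calE k ε I (act (Equiv.swap i i') β)
      = (1 + ε * swapCoeff k β i i') * calE k ε I β := by
  set s := Equiv.swap i i' with hs
  have hss : ∀ t, s (s t) = t := fun t => by simp [hs]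
  have hsI : ∀ t ∈ I, s t ∈ I := fun t ht => (apply_mem_iff (swap_mem_symI hi hi') t).2 ht
  have hord : ∀ p q, p < q → ¬ (p = i ∧ q = i') → s p < s q := by
    intro p q hpq hne
    simp only [hs, Equiv.swap_apply_def, Fin.lt_def, Fin.ext_iff] at *
    split_ifs <;> omega
  have hset : ((I ×ˢ I).filter fun q => q.1 < q.2 ∧ act s β q.1 < act s β q.2)
      = insert (i, i') (((I ×ˢ I).filter fun q => q.1 < q.2 ∧ β q.1 < β q.2).image
          (Prod.map s s)) := by
    ext ⟨p, q⟩
    simp only [Finset.mem_filter, Finset.mem_product, Finset.mem_insert, Finset.mem_image,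
      Prod.exists, Prod.map_apply, Prod.mk.injEq, hs, act_swap_apply]
    rw [← hs]
    constructor
    · rintro ⟨⟨hp, hq⟩, hpq, hβ⟩
      by_cases hc : p = i ∧ q = i'
      · exact Or.inl hc
      · exact Or.inr ⟨s p, s q, ⟨⟨hsI p hp, hsI q hq⟩, hord p q hpq hc, hβ⟩, hss p, hss q⟩
    · rintro (⟨rfl, rfl⟩ | ⟨a, b, ⟨⟨ha, hb⟩, hab, hβ⟩, rfl, rfl⟩)
      · refine ⟨⟨hi, hi'⟩, Fin.lt_def.2 (by omega), ?_⟩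
        rw [hs, Equiv.swap_apply_left, Equiv.swap_apply_right]
        exact hlt
      · refine ⟨⟨hsI a ha, hsI b hb⟩, hord a b hab ?_, by rwa [hss, hss]⟩
        rintro ⟨rfl, rfl⟩
        exact absurd hβ hlt.not_gt
  have hκ : ∀ t, kappa k (act s β) t = kappa k β (s t) := fun t =>
    congrFun (kappa_act_swap k h hlt.ne') t
  rw [calE, hset, Finset.prod_insert, Finset.prod_image]
  · simp only [hκ, Prod.map_fst, Prod.map_snd, hss]
    rw [hs, Equiv.swap_apply_left, Equiv.swap_apply_right, swapCoeff, calE, mul_div_assoc]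
  · intro a _ b _ hab
    exact Prod.ext (s.injective (congrArg Prod.fst hab)) (s.injective (congrArg Prod.snd hab))
  · rintro hmem
    obtain ⟨⟨a, b⟩, hab, e⟩ := Finset.mem_image.1 hmem
    simp only [Prod.map_apply, Prod.mk.injEq] at e
    have ha : a = i' := by rw [← hss a, e.1, hs, Equiv.swap_apply_left]
    have hb : b = i := by rw [← hss b, e.2, hs, Equiv.swap_apply_right]
    have hlt' := (Finset.mem_filter.1 hab).2.1
    simp only [ha, hb, Fin.lt_def] at hlt'
    omega

theorem perm_swap_pair_of_gt {k ε : ℝ} (hk : 0 ≤ k) (hε : ε = 1 ∨ ε = -1) {I : Finset (Fin N)}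
    {β : Comp N} {i i' : Fin N} (hi : i ∈ I) (hi' : i' ∈ I) (h : (i : ℕ) + 1 = i')
    (hlt : β i' < β i) :
    perm (Equiv.swap i i') ((1 / calE k ε I β) • monic hk β
      + (ε / calE k ε I (act (Equiv.swap i i') β)) • monic hk (act (Equiv.swap i i') β))
    = ε • ((1 / calE k ε I β) • monic hk β
      + (ε / calE k ε I (act (Equiv.swap i i') β)) • monic hk (act (Equiv.swap i i') β)) := by
  have hE := calE_act_swap k ε hi hi' h hlt
  have hpos := calE_pos hk hε I β
  have hpos' := calE_pos hk hε I (act (Equiv.swap i i') β)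
  have hε2 : ε * ε = 1 := by rcases hε with rfl | rfl <;> norm_num
  rw [map_add, map_smul, map_smul, perm_swap_monic hk h hlt, perm_swap_monic_act hk h hlt]
  generalize monic hk (act (Equiv.swap i i') β) = f
  generalize monic hk β = g
  rw [hE] at hpos' ⊢
  generalize swapCoeff k β i i' = c at *
  generalize calE k ε I β = E at *
  have hc : 1 + ε * c ≠ 0 := by intro h0; rw [h0, zero_mul] at hpos'; exact lt_irrefl _ hpos'
  have h1 : 1 / E * c + ε / ((1 + ε * c) * E) * (1 - c ^ 2) = ε * (1 / E) := by
    -- As `ε² = 1`, the factor gained by `E_ε` divides the matrix entry `1 - c²`.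
    have h3 : 1 - c ^ 2 = (1 + ε * c) * (1 - ε * c) := by linear_combination c ^ 2 * hε2
    have h4 : ε / ((1 + ε * c) * E) * (1 - c ^ 2) = ε * (1 - ε * c) / E := by
      rw [h3, div_mul_eq_mul_div, div_eq_div_iff (mul_ne_zero hc hpos.ne') hpos.ne']
      ring
    rw [h4, one_div_mul_eq_div, ← add_div, mul_one_div]
    congr 1
    linear_combination -c * hε2
  have h2 : 1 / E - ε / ((1 + ε * c) * E) * c = ε * (ε / ((1 + ε * c) * E)) := by
    field_simp
    linear_combination -hε2
  calc _ = (1 / E * c + ε / ((1 + ε * c) * E) * (1 - c ^ 2)) • g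
        + (1 / E - ε / ((1 + ε * c) * E) * c) • f := by module
    _ = _ := by rw [h1, h2]; module

theorem perm_swap_pair {k ε : ℝ} (hk : 0 ≤ k) (hε : ε = 1 ∨ ε = -1) {I : Finset (Fin N)}
    {β : Comp N} {i i' : Fin N} (hi : i ∈ I) (hi' : i' ∈ I) (h : (i : ℕ) + 1 = i')
    (hne : ε = 1 ∨ β i ≠ β i') :
    perm (Equiv.swap i i') ((1 / calE k ε I β) • monic hk β
      + (ε / calE k ε I (act (Equiv.swap i i') β)) • monic hk (act (Equiv.swap i i') β))
    = ε • ((1 / calE k ε I β) • monic hk β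
      + (ε / calE k ε I (act (Equiv.swap i i') β)) • monic hk (act (Equiv.swap i i') β)) := by
  rcases lt_trichotomy (β i) (β i') with hlt | heq | hgt
  · have e := perm_swap_pair_of_gt hk hε (β := act (Equiv.swap i i') β) hi hi' h (by
      simpa only [act_swap_apply, Equiv.swap_apply_left, Equiv.swap_apply_right] using hlt)
    rw [act_swap_act_swap] at e
    have hε2 : ε * ε = 1 := by rcases hε with rfl | rfl <;> norm_num
    have e2 : (1 / calE k ε I β) • monic hk β
        + (ε / calE k ε I (act (Equiv.swap i i') β)) • monic hk (act (Equiv.swap i i') β)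
        = ε • ((1 / calE k ε I (act (Equiv.swap i i') β)) • monic hk (act (Equiv.swap i i') β)
        + (ε / calE k ε I β) • monic hk β) := by
      rw [smul_add, smul_smul, smul_smul, ← mul_div_assoc, ← mul_div_assoc, hε2, mul_one, add_comm]
    rw [e2, map_smul, e]
  · have hβ : act (Equiv.swap i i') β = β := by
      funext t
      rw [act_swap_apply]
      by_cases h1 : t = i
      · rw [h1, Equiv.swap_apply_left, heq]
      by_cases h2 : t = i'
      · rw [h2, Equiv.swap_apply_right, heq]
      rw [Equiv.swap_apply_of_ne_of_ne h1 h2]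
    have h1 : ε = 1 := hne.resolve_right fun h => h heq
    rw [hβ, h1, map_add, map_smul, perm_swap_monic_of_eq hk h heq, one_smul]
  · exact perm_swap_pair_of_gt hk hε hi hi' h hgt

/-! ### Equivariant elements of `X` -/

theorem spaceX_eq {k : ℝ} (hk : 0 ≤ k) (I : Finset (Fin N)) (α : Comp N) :
    spaceX k I α = monicSpan hk (orbitI I α : Set (Comp N)) := by
  rw [spaceX, monicSpan]
  congr 1
  ext q
  simp only [Set.mem_ofPred_eq, Set.mem_image, Finset.mem_coe, orbitI, Finset.mem_image]
  constructor
  · rintro ⟨w, hw, rfl⟩; exact ⟨_, ⟨w, hw, rfl⟩, (zeta_eq_monic hk _).symm⟩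
  · rintro ⟨_, ⟨w, hw, rfl⟩, rfl⟩; exact ⟨w, hw, (zeta_eq_monic hk _).symm⟩

theorem perm_mem_spaceX {k : ℝ} (hk : 0 ≤ k) {I : Finset (Fin N)} (hI : NoGap I) {α : Comp N}
    {w : Equiv.Perm (Fin N)} (hw : w ∈ symI I) {f : Poly N} (hf : f ∈ spaceX k I α) :
    perm w f ∈ spaceX k I α := by
  rw [spaceX_eq hk] at *
  exact (symI_subset_subgroup hI (stabSpace (monicSpan hk (orbitI I α : Set (Comp N))))
    (fun i hi i' hi' h => swap_mem_stabSpace_monicSpan hk h fun β hβ =>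
      act_mem_orbitI_of_mem (swap_mem_symI hi hi') hβ) hw f).2 hf

theorem monic_mem_spaceX {k : ℝ} (hk : 0 ≤ k) {I : Finset (Fin N)} {α β : Comp N}
    (hβ : β ∈ orbitI I α) : monic hk β ∈ spaceX k I α := by
  rw [spaceX_eq hk]
  exact monic_mem_monicSpan hk hβ

/-- The span of the translates `w ζ_α`, `w ∈ S_I`. -/
noncomputable def transSpan {k : ℝ} (hk : 0 ≤ k) (I : Finset (Fin N)) (α : Comp N) :
    Submodule ℝ (Poly N) :=
  Submodule.span ℝ {q | ∃ w ∈ symI I, q = perm w (monic hk α)}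

theorem perm_mem_transSpan {k : ℝ} (hk : 0 ≤ k) {I : Finset (Fin N)} {α : Comp N}
    {w : Equiv.Perm (Fin N)} (hw : w ∈ symI I) {f : Poly N} (hf : f ∈ transSpan hk I α) :
    perm w f ∈ transSpan hk I α := by
  refine Submodule.span_induction ?_ ?_ ?_ ?_ hf
  · rintro _ ⟨v, hv, rfl⟩
    rw [← perm_comp]
    exact Submodule.subset_span ⟨_, mul_mem_symI hw hv, rfl⟩
  · rw [map_zero]; exact Submodule.zero_mem _
  · intro f g _ _ hf hg; rw [map_add]; exact Submodule.add_mem _ hf hg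
  · intro c f _ hf; rw [map_smul]; exact Submodule.smul_mem _ _ hf

/-- In each plane spanned by `ζ_γ` and `ζ_{sγ}`, either vector is recovered from the other and its
translate, since both off-diagonal entries `1` and `1 - c²` are nonzero. -/
theorem spaceX_le_transSpan {k : ℝ} (hk : 0 ≤ k) {I : Finset (Fin N)} (hI : NoGap I)
    (α : Comp N) : spaceX k I α ≤ transSpan hk I α := by
  let G : Subgroup (Equiv.Perm (Fin N)) :=
    { carrier := {u | ∀ γ, monic hk (act u γ) ∈ transSpan hk I α ↔ monic hk γ ∈ transSpan hk I α}
      mul_mem' := fun {v w} hv hw γ => by rw [← act_act, hv, hw]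
      one_mem' := fun γ => Iff.rfl
      inv_mem' := fun {w} hw γ => by rw [← hw, act_act, mul_inv_cancel, psum_act_one] }
  have hG : ∀ i ∈ I, ∀ i' ∈ I, (i : ℕ) + 1 = i' → Equiv.swap i i' ∈ G := by
    intro i hi i' hi' h
    have key : ∀ γ, monic hk γ ∈ transSpan hk I α →
        monic hk (act (Equiv.swap i i') γ) ∈ transSpan hk I α := by
      intro γ hγ
      have hγ' := perm_mem_transSpan hk (swap_mem_symI hi hi') hγ
      rcases lt_trichotomy (γ i) (γ i') with hlt | heq | hgt
      · have hlt' : act (Equiv.swap i i') γ i' < act (Equiv.swap i i') γ i := by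
          simpa only [act_swap_apply, Equiv.swap_apply_left, Equiv.swap_apply_right] using hlt
        have e := perm_swap_monic_act hk h hlt'
        have hc := swapCoeff_mem hk hlt'
        rw [act_swap_act_swap] at e
        set c := swapCoeff k (act (Equiv.swap i i') γ) i i'
        have h1 : (1 - c ^ 2) ≠ 0 := by nlinarith
        have h2 : (1 - c ^ 2) • monic hk (act (Equiv.swap i i') γ) ∈ transSpan hk I α := by
          rw [← eq_sub_iff_add_eq.1 e]
          exact Submodule.add_mem _ hγ' (Submodule.smul_mem _ _ hγ)
        exact (Submodule.smul_mem_iff _ h1).1 h2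
      · have hγs : act (Equiv.swap i i') γ = γ := by
          funext t
          rw [act_swap_apply]
          by_cases h1 : t = i
          · rw [h1, Equiv.swap_apply_left, heq]
          by_cases h2 : t = i'
          · rw [h2, Equiv.swap_apply_right, heq]
          rw [Equiv.swap_apply_of_ne_of_ne h1 h2]
        rwa [hγs]
      · rw [monic_act_swap hk h hgt]
        exact Submodule.sub_mem _ hγ' (Submodule.smul_mem _ _ hγ)
    intro γ
    refine ⟨fun hγ => ?_, key γ⟩
    have := key _ hγ
    rwa [act_swap_act_swap] at this
  rw [spaceX, Submodule.span_le]
  rintro _ ⟨w, hw, rfl⟩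
  rw [zeta_eq_monic hk]
  refine (symI_subset_subgroup hI G hG hw α).2 (Submodule.subset_span ⟨1, one_mem_symI I, ?_⟩)
  rw [perm_one]

/-- Equivariance under `S_I` for the character `χ`. -/
def Equivariant (I : Finset (Fin N)) (χ : Equiv.Perm (Fin N) →* ℝ) (f : Poly N) : Prop :=
  ∀ w ∈ symI I, perm w f = χ w • f

/-- The operator `∑ χ(w) w` multiplies an equivariant element by the order of `S_I` and sends each
translate of `ζ_α` to a multiple of one vector. That vector is not claimed to be nonzero. -/
theorem exists_equivariant_generator {k : ℝ} (hk : 0 ≤ k) {I : Finset (Fin N)} (hI : NoGap I)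
    (α : Comp N) (χ : Equiv.Perm (Fin N) →* ℝ) (hχ : ∀ w, χ w * χ w = 1) :
    ∃ a : Poly N, ∀ f ∈ spaceX k I α, Equivariant I χ f → ∃ c : ℝ, f = c • a := by
  refine ⟨∑ w ∈ symI I, χ w • perm w (monic hk α), fun f hf he => ?_⟩
  set a := ∑ w ∈ symI I, χ w • perm w (monic hk α) with ha
  let A : Poly N →ₗ[ℝ] Poly N := ∑ w ∈ symI I, χ w • perm w
  have hA : ∀ g, A g = ∑ w ∈ symI I, χ w • perm w g := fun g => by
    simp [A]
  have h1 : A f = ((symI I).card : ℝ) • f := by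
    rw [hA, Finset.sum_congr rfl fun w hw => by rw [he w hw, smul_smul, hχ, one_smul],
      Finset.sum_const, Nat.cast_smul_eq_nsmul]
  have h2 : A f ∈ Submodule.span ℝ {a} := by
    have hle : transSpan hk I α ≤ (Submodule.span ℝ {a}).comap A := by
      rw [transSpan, Submodule.span_le]
      rintro _ ⟨v, hv, rfl⟩
      change A (perm v (monic hk α)) ∈ Submodule.span ℝ {a}
      have e : A (perm v (monic hk α)) = χ v • a := by
        rw [hA, ha, Finset.smul_sum,
          ← sum_symI_mul_right hv fun w => χ v • χ w • perm w (monic hk α)]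
        refine Finset.sum_congr rfl fun w _ => ?_
        rw [smul_smul, map_mul, mul_left_comm, hχ, mul_one, perm_comp]
      rw [e]
      exact Submodule.smul_mem _ _ (Submodule.mem_span_singleton_self a)
    exact hle (spaceX_le_transSpan hk hI α hf)
  obtain ⟨c, hc⟩ := Submodule.mem_span_singleton.1 h2
  have hcard : ((symI I).card : ℝ) ≠ 0 := by
    exact_mod_cast (Finset.card_pos.2 ⟨1, one_mem_symI I⟩).ne'
  refine ⟨(((symI I).card : ℝ))⁻¹ * c, ?_⟩
  rw [mul_smul, hc, h1, smul_smul, inv_mul_cancel₀ hcard, one_smul]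

theorem equivariant_unique {k : ℝ} (hk : 0 ≤ k) {I : Finset (Fin N)} (hI : NoGap I)
    {α : Comp N} (χ : Equiv.Perm (Fin N) →* ℝ) (hχ : ∀ w, χ w * χ w = 1) {f g : Poly N}
    (hf : f ∈ spaceX k I α) (hf0 : f ≠ 0) (hfe : Equivariant I χ f)
    (hg : g ∈ spaceX k I α) (hge : Equivariant I χ g) : ∃ c : ℝ, g = c • f := by
  obtain ⟨a, ha⟩ := exists_equivariant_generator hk hI α χ hχ
  obtain ⟨c, hc⟩ := ha f hf hfe
  obtain ⟨d, hd⟩ := ha g hg hge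
  have hc0 : c ≠ 0 := by rintro rfl; rw [zero_smul] at hc; exact hf0 hc
  refine ⟨d * c⁻¹, ?_⟩
  rw [hd, hc, smul_smul, mul_assoc, inv_mul_cancel₀ hc0, mul_one]

theorem equivariant_eq {k : ℝ} (hk : 0 ≤ k) {I : Finset (Fin N)} (hI : NoGap I)
    {α : Comp N} (χ : Equiv.Perm (Fin N) →* ℝ) (hχ : ∀ w, χ w * χ w = 1) {f g : Poly N}
    (hf : f ∈ spaceX k I α) (hfe : Equivariant I χ f)
    (hg : g ∈ spaceX k I α) (hge : Equivariant I χ g) {γ : Comp N}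
    (hne : (pBasis N hk).repr f γ ≠ 0)
    (he : (pBasis N hk).repr f γ = (pBasis N hk).repr g γ) : f = g := by
  have hf0 : f ≠ 0 := by rintro rfl; simp at hne
  obtain ⟨c, rfl⟩ := equivariant_unique hk hI χ hχ hf hf0 hfe hg hge
  rw [map_smul, Finsupp.smul_apply, smul_eq_mul] at he
  have : c = 1 := mul_right_cancel₀ hne (by rw [← he, one_mul])
  rw [this, one_smul]

theorem equivariant_of_adjacent {I : Finset (Fin N)} (hI : NoGap I)
    (χ : Equiv.Perm (Fin N) →* ℝ) {f : Poly N}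
    (h : ∀ i ∈ I, ∀ i' ∈ I, (i : ℕ) + 1 = i' →
      perm (Equiv.swap i i') f = χ (Equiv.swap i i') • f) : Equivariant I χ f := by
  let G : Subgroup (Equiv.Perm (Fin N)) :=
    { carrier := {u | perm u f = χ u • f}
      mul_mem' := fun {v w} (hv : perm v _ = _) (hw : perm w _ = _) => by
        change perm (v * w) _ = _
        rw [perm_comp, hw, map_smul, hv, smul_smul, map_mul, mul_comm]
      one_mem' := by
        change perm 1 f = _
        rw [perm_one, map_one, one_smul]
      inv_mem' := fun {w} (hw : perm w _ = _) => by
        change perm w⁻¹ _ = _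
        have e := congrArg (perm w⁻¹) hw
        rw [perm_inv_perm, map_smul] at e
        have e2 : χ w * χ w⁻¹ = 1 := by rw [← map_mul, mul_inv_cancel, map_one]
        conv_rhs => rw [e]
        rw [smul_smul, mul_comm, e2, one_smul] }
  intro w hw
  exact symI_subset_subgroup hI G h hw

/-! ### The reversed composition -/

/-- In zero-based positions the interval runs from `l` to `l + m - 1`, so mirror images add up to
`2l + m - 1`. -/
theorem revPerm_involutive (N l m : ℕ) (h : l + m ≤ N) : Function.Involutive fun i : Fin N =>
    if hi : l ≤ (i : ℕ) ∧ (i : ℕ) < l + m then (⟨2 * l + m - 1 - i, by omega⟩ : Fin N) else i := by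
  intro i
  dsimp only
  by_cases hi : l ≤ (i : ℕ) ∧ (i : ℕ) < l + m
  · rw [dif_pos hi]
    have h2 : l ≤ 2 * l + m - 1 - (i : ℕ) ∧ 2 * l + m - 1 - (i : ℕ) < l + m := by omega
    rw [dif_pos h2]
    ext
    simp only
    omega
  · rw [dif_neg hi, dif_neg hi]

/-- The permutation reversing the interval. -/
def revPerm {l m : ℕ} (h : l + m ≤ N) : Equiv.Perm (Fin N) :=
  Function.Involutive.toPerm _ (revPerm_involutive N l m h)

theorem mem_interval {l m : ℕ} {i : Fin N} :
    i ∈ interval N l m ↔ l ≤ (i : ℕ) ∧ (i : ℕ) < l + m := by simp [interval]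

theorem revPerm_apply_of_mem {l m : ℕ} (h : l + m ≤ N) {i : Fin N} (hi : i ∈ interval N l m) :
    (revPerm h i : ℕ) = 2 * l + m - 1 - i := by
  rw [mem_interval] at hi
  change ((if hi : l ≤ (i : ℕ) ∧ (i : ℕ) < l + m then (⟨2 * l + m - 1 - i, by omega⟩ : Fin N)
    else i : Fin N) : ℕ) = _
  rw [dif_pos hi]

theorem revPerm_apply_of_notMem {l m : ℕ} (h : l + m ≤ N) {i : Fin N}
    (hi : i ∉ interval N l m) : revPerm h i = i := by
  rw [mem_interval] at hi
  exact dif_neg hi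

theorem revPerm_mem_symI {l m : ℕ} (h : l + m ≤ N) : revPerm h ∈ symI (interval N l m) :=
  mem_symI.2 fun _ hi => revPerm_apply_of_notMem h hi

theorem revI_eq_act {l m : ℕ} (h : l + m ≤ N) (α : Comp N) :
    revI l m α = act (revPerm h) α := by
  have hinv : (revPerm h)⁻¹ = revPerm h := rfl
  funext i
  rw [act, hinv, revI]
  by_cases hi : i ∈ interval N l m
  · have hi' := mem_interval.1 hi
    rw [dif_pos ⟨hi', by omega⟩]
    congr 1
    ext
    rw [revPerm_apply_of_mem h hi]
  · rw [revPerm_apply_of_notMem h hi, dif_neg]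
    exact fun h => hi (mem_interval.2 h.1)

theorem revI_monotone {l m : ℕ} (h : l + m ≤ N) {α : Comp N} (hα : GeI (interval N l m) α) :
    ∀ i ∈ interval N l m, ∀ j ∈ interval N l m, i < j → revI l m α i ≤ revI l m α j := by
  intro i hi j hj hij
  rw [revI_eq_act h]
  change α (revPerm h i) ≤ α (revPerm h j)
  refine hα _ ((apply_mem_iff (revPerm_mem_symI h) j).2 hj) _
    ((apply_mem_iff (revPerm_mem_symI h) i).2 hi) ?_
  rw [Fin.lt_def, revPerm_apply_of_mem h hi, revPerm_apply_of_mem h hj]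
  have h1 := mem_interval.1 hi
  have h2 := mem_interval.1 hj
  have h3 := Fin.lt_def.1 hij
  omega

theorem psum_le_of_repr_monic_ne_zero {k : ℝ} (hk : 0 ≤ k) {α β : Comp N}
    (hp : plus β = plus α) (h : (pBasis N hk).repr (monic hk α) β ≠ 0) (j : Fin N) :
    psum α j ≤ psum β j := by
  obtain ⟨_, h2 | ⟨_, h3⟩⟩ := monic_support hk h
  · exact absurd hp.symm h2.2.symm
  · exact h3 j

theorem repr_monic_of_monotone {k : ℝ} (hk : 0 ≤ k) {I : Finset (Fin N)} {γ : Comp N}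
    (hγ : ∀ i ∈ I, ∀ j ∈ I, i < j → γ i ≤ γ j) {w : Equiv.Perm (Fin N)} (hw : w ∈ symI I) :
    (pBasis N hk).repr (monic hk (act w γ)) γ = if act w γ = γ then 1 else 0 := by
  split_ifs with h
  · rw [h, monic_repr_self]
  · by_contra h0
    apply h
    have := psum_le_of_repr_monic_ne_zero hk (plus_act w γ).symm h0
    exact psum_injective fun j => le_antisymm (this j) (psum_le_act hγ hw j)

theorem repr_monic_of_geI {k : ℝ} (hk : 0 ≤ k) {I : Finset (Fin N)} {α : Comp N}
    (hα : GeI I α) {w : Equiv.Perm (Fin N)} (hw : w ∈ symI I) :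
    (pBasis N hk).repr (monic hk α) (act w α) = if act w α = α then 1 else 0 := by
  split_ifs with h
  · rw [h, monic_repr_self]
  · by_contra h0
    apply h
    have := psum_le_of_repr_monic_ne_zero hk (plus_act w α) h0
    exact psum_injective fun j => le_antisymm (psum_act_le hα hw j) (this j)

/-- On `I` the reversed composition increases, so it has the least partial sums in its `S_I`-orbit,
while `ζ_β` involves only indices of the orbit with partial sums at least those of `β`. -/
theorem repr_monic_rev {k : ℝ} (hk : 0 ≤ k) {l m : ℕ} (h : l + m ≤ N) {α : Comp N}
    (hα : GeI (interval N l m) α) {w : Equiv.Perm (Fin N)} (hw : w ∈ symI (interval N l m)) :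
    (pBasis N hk).repr (monic hk (act w α)) (revI l m α)
      = if act w α = revI l m α then 1 else 0 := by
  have e : act w α = act (w * (revPerm h)⁻¹) (revI l m α) := by
    rw [revI_eq_act h, act_act, mul_assoc, inv_mul_cancel, mul_one]
  rw [e]
  exact repr_monic_of_monotone hk (revI_monotone h hα)
    (mul_mem_symI hw (inv_mem_symI (revPerm_mem_symI h)))

/-- After undoing `w` this concerns `ζ_α` itself. There `α` has the greatest partial sums in its
orbit, so no other index of the orbit occurs. -/
theorem repr_perm_monic_rev {k : ℝ} (hk : 0 ≤ k) {l m : ℕ} (h : l + m ≤ N) {α : Comp N}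
    (hα : GeI (interval N l m) α) {w : Equiv.Perm (Fin N)} (hw : w ∈ symI (interval N l m)) :
    (pBasis N hk).repr (perm w (monic hk α)) (revI l m α)
      = if act w α = revI l m α then 1 else 0 := by
  rw [repr_perm', revI_eq_act h, act_act, repr_monic_of_geI hk hα
    (mul_mem_symI (inv_mem_symI hw) (revPerm_mem_symI h)), ← act_act]
  refine if_congr ?_ rfl rfl
  rw [← (act_injective w).eq_iff, act_act, mul_inv_cancel, psum_act_one, eq_comm]

/-! ### Permissible forms -/

theorem IsPermissible.perm_right {k : ℝ} {B : LinearMap.BilinForm ℝ (Poly N)}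
    (hB : IsPermissible k B) (w : Equiv.Perm (Fin N)) (f g : Poly N) :
    B f (perm w g) = B (perm w⁻¹ f) g := by
  rw [hB.invariant, inv_inv]

theorem IsPermissible.linU {k : ℝ} {B : LinearMap.BilinForm ℝ (Poly N)}
    (hB : IsPermissible k B) (i : Fin N) (f g : Poly N) :
    B (linU k i f) g = B f (linU k i g) := by
  have h := hB.selfAdjoint i f g
  rw [← dunklX_apply, ← dunklX_apply] at h
  rw [linU_eq, linU_eq]
  simp only [map_add, map_sub, map_smul, map_sum, LinearMap.add_apply, LinearMap.sub_apply,
    LinearMap.smul_apply, LinearMap.sum_apply, h, hB.perm_right, Equiv.swap_inv]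

/-- Transpositions are their own inverses, so every `U_i` is self-adjoint, and distinct compositions
differ in some eigenvalue. -/
theorem IsPermissible.monic_orthogonal {k : ℝ} (hk : 0 ≤ k)
    {B : LinearMap.BilinForm ℝ (Poly N)} (hB : IsPermissible k B) {α β : Comp N} (h : α ≠ β) :
    B (monic hk α) (monic hk β) = 0 := by
  obtain ⟨i, hi⟩ := Function.ne_iff.1 fun e => h (kappa_injective hk e)
  have e := hB.linU i (monic hk α) (monic hk β)
  rw [monic_eigen, monic_eigen, map_smul, map_smul, LinearMap.smul_apply, smul_eq_mul,
    smul_eq_mul] at e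
  have : (kappa k α i - kappa k β i) * B (monic hk α) (monic hk β) = 0 := by linarith
  exact (mul_eq_zero.1 this).resolve_left (sub_ne_zero.2 hi)

theorem evalOne_perm (w : Equiv.Perm (Fin N)) (f : Poly N) : evalOne (perm w f) = evalOne f := by
  rw [evalOne, perm_def, eval_rename]
  rfl

/-! ### The symmetric polynomial -/

theorem jPoly_eq {k : ℝ} (hk : 0 ≤ k) (l m : ℕ) (α : Comp N) :
    jPoly k l m α = calE k 1 (interval N l m) (revI l m α) •
      ∑ β ∈ orbitI (interval N l m) α, (1 / calE k 1 (interval N l m) β) • monic hk β := by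
  simp only [jPoly, zeta_eq_monic hk]

theorem jPoly_mem {k : ℝ} (hk : 0 ≤ k) (l m : ℕ) (α : Comp N) :
    jPoly k l m α ∈ spaceX k (interval N l m) α := by
  rw [jPoly_eq hk]
  exact Submodule.smul_mem _ _ (Submodule.sum_mem _ fun β hβ =>
    Submodule.smul_mem _ _ (monic_mem_spaceX hk hβ))

theorem jPoly_repr {k : ℝ} (hk : 0 ≤ k) {l m : ℕ} (h : l + m ≤ N) {α : Comp N}
    (hα : GeI (interval N l m) α) :
    (pBasis N hk).repr (jPoly k l m α) (revI l m α) = 1 := by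
  have hR : revI l m α ∈ orbitI (interval N l m) α := by
    rw [revI_eq_act h]; exact act_mem_orbitI (revPerm_mem_symI h)
  rw [jPoly_eq hk, map_smul, map_sum, Finsupp.smul_apply, Finsupp.finsetSum_apply,
    Finset.sum_eq_single_of_mem _ hR]
  · rw [map_smul, Finsupp.smul_apply, monic_repr_self, smul_eq_mul, smul_eq_mul, mul_one,
      mul_one_div_cancel (calE_pos hk (Or.inl rfl) _ _).ne']
  · intro β hβ hne
    obtain ⟨w, hw, rfl⟩ := Finset.mem_image.1 hβ
    rw [map_smul, Finsupp.smul_apply, repr_monic_rev hk h hα hw, if_neg hne, smul_zero]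

theorem jPoly_equivariant {k : ℝ} (hk : 0 ≤ k) (l m : ℕ) (α : Comp N) :
    Equivariant (interval N l m) 1 (jPoly k l m α) := by
  refine equivariant_of_adjacent (noGap_interval l m) 1
    fun i hi i' hi' hii => ?_
  rw [jPoly_eq hk, map_smul, MonoidHom.one_apply, one_smul]
  congr 1
  set J := ∑ β ∈ orbitI (interval N l m) α, (1 / calE k 1 (interval N l m) β) • monic hk β with hJ
  -- Doubling the sum pairs each `β` with its transpose without choosing representatives; fixed
  -- points need no separate treatment.
  have e : J + J = ∑ β ∈ orbitI (interval N l m) α,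
      ((1 / calE k 1 (interval N l m) β) • monic hk β
        + (1 / calE k 1 (interval N l m) (act (Equiv.swap i i') β)) •
          monic hk (act (Equiv.swap i i') β)) := by
    rw [Finset.sum_add_distrib, sum_orbitI_act (swap_mem_symI hi hi')
      fun β => (1 / calE k 1 (interval N l m) β) • monic hk β]
  have e2 : perm (Equiv.swap i i') (J + J) = J + J := by
    rw [e, map_sum]
    refine Finset.sum_congr rfl fun β _ => ?_
    rw [perm_swap_pair hk (Or.inl rfl) hi hi' hii (Or.inl rfl), one_smul]
  rw [map_add, ← two_smul ℝ, ← two_smul ℝ J] at e2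
  exact smul_right_injective _ (two_ne_zero (α := ℝ)) e2

theorem sum_gPoly_mem {k : ℝ} (hk : 0 ≤ k) {I : Finset (Fin N)} (hI : NoGap I) {α : Comp N}
    (hα : GeI I α) : ∑ β ∈ orbitI I α, gPoly k I α β ∈ spaceX k I α := by
  refine Submodule.sum_mem _ fun β hβ => ?_
  obtain ⟨w, hw, rfl⟩ := Finset.mem_image.1 hβ
  rw [gPoly_act hk hI hα hw]
  exact perm_mem_spaceX hk hI hw (monic_mem_spaceX hk (self_mem_orbitI I α))

theorem sum_gPoly_equivariant {k : ℝ} (hk : 0 ≤ k) {I : Finset (Fin N)} (hI : NoGap I)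
    {α : Comp N} (hα : GeI I α) : Equivariant I 1 (∑ β ∈ orbitI I α, gPoly k I α β) := by
  intro w hw
  rw [MonoidHom.one_apply, one_smul, map_sum, ← sum_orbitI_act hw fun β => gPoly k I α β]
  refine Finset.sum_congr rfl fun β hβ => ?_
  obtain ⟨v, hv, rfl⟩ := Finset.mem_image.1 hβ
  rw [gPoly_act hk hI hα hv, act_act, gPoly_act hk hI hα (mul_mem_symI hw hv), perm_comp]

theorem jPoly_eq_sum_gPoly {k : ℝ} (hk : 0 ≤ k) {l m : ℕ} (h : l + m ≤ N) {α : Comp N}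
    (hα : GeI (interval N l m) α) :
    jPoly k l m α = ∑ β ∈ orbitI (interval N l m) α, gPoly k (interval N l m) α β := by
  have hI := noGap_interval (N := N) l m
  refine equivariant_eq hk hI 1 (fun _ => by simp) (jPoly_mem hk l m α)
    (jPoly_equivariant hk l m α) (sum_gPoly_mem hk hI hα) (sum_gPoly_equivariant hk hI hα)
    (γ := revI l m α) (by rw [jPoly_repr hk h hα]; exact one_ne_zero) ?_
  have hR : revI l m α ∈ orbitI (interval N l m) α := by
    rw [revI_eq_act h]; exact act_mem_orbitI (revPerm_mem_symI h)
  rw [jPoly_repr hk h hα, map_sum, Finsupp.finsetSum_apply]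
  have hterm : ∀ β ∈ orbitI (interval N l m) α,
      (pBasis N hk).repr (gPoly k (interval N l m) α β) (revI l m α)
        = if β = revI l m α then 1 else 0 := by
    intro β hβ
    obtain ⟨w, hw, rfl⟩ := Finset.mem_image.1 hβ
    rw [gPoly_act hk hI hα hw, repr_perm_monic_rev hk h hα hw]
  rw [Finset.sum_congr rfl hterm, Finset.sum_ite_eq', if_pos hR]

theorem form_jPoly_monic {k : ℝ} (hk : 0 ≤ k) {l m : ℕ} {α : Comp N}
    (hα : GeI (interval N l m) α) {B : LinearMap.BilinForm ℝ (Poly N)} (hB : IsPermissible k B) :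
    B (jPoly k l m α) (monic hk α)
      = calE k 1 (interval N l m) (revI l m α) * B (monic hk α) (monic hk α) := by
  rw [jPoly_eq hk, map_smul, LinearMap.smul_apply, map_sum, LinearMap.sum_apply, smul_eq_mul,
    Finset.sum_eq_single_of_mem _ (self_mem_orbitI _ α)]
  · rw [map_smul, LinearMap.smul_apply, calE_of_geI k 1 hα, div_one, one_smul]
  · intro β _ hne
    rw [map_smul, LinearMap.smul_apply, hB.monic_orthogonal hk hne, smul_zero]

/-- One factor is expanded in the `g_β` and the other in the `ζ_β`. Invariance makes all the terms
equal to the pairing with `ζ_α`, whose weight is `E_+(α^R)` because `E_+(α) = 1`. -/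
theorem form_jPoly {k : ℝ} (hk : 0 ≤ k) {l m : ℕ} (h : l + m ≤ N) {α : Comp N}
    (hα : GeI (interval N l m) α) {B : LinearMap.BilinForm ℝ (Poly N)} (hB : IsPermissible k B) :
    B (jPoly k l m α) (jPoly k l m α) = (orbitI (interval N l m) α).card
      * calE k 1 (interval N l m) (revI l m α) * B (monic hk α) (monic hk α) := by
  have hterm : ∀ β ∈ orbitI (interval N l m) α,
      B (jPoly k l m α) (gPoly k (interval N l m) α β)
        = calE k 1 (interval N l m) (revI l m α) * B (monic hk α) (monic hk α) := by
    intro β hβ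
    obtain ⟨w, hw, rfl⟩ := Finset.mem_image.1 hβ
    rw [gPoly_act hk (noGap_interval l m) hα hw, hB.perm_right,
      jPoly_equivariant hk l m α _ (inv_mem_symI hw), MonoidHom.one_apply, one_smul,
      form_jPoly_monic hk hα hB]
  conv_lhs => arg 2; rw [jPoly_eq_sum_gPoly hk h hα]
  rw [map_sum, Finset.sum_congr rfl hterm, Finset.sum_const, nsmul_eq_mul, mul_assoc]

theorem evalOne_jPoly {k : ℝ} (hk : 0 ≤ k) {l m : ℕ} (h : l + m ≤ N) {α : Comp N}
    (hα : GeI (interval N l m) α) : evalOne (jPoly k l m α)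
      = (orbitI (interval N l m) α).card * evalOne (monic hk α) := by
  have hterm : ∀ β ∈ orbitI (interval N l m) α,
      eval (fun _ => (1 : ℝ)) (gPoly k (interval N l m) α β) = evalOne (monic hk α) := by
    intro β hβ
    obtain ⟨w, hw, rfl⟩ := Finset.mem_image.1 hβ
    rw [gPoly_act hk (noGap_interval l m) hα hw]
    exact evalOne_perm w _
  rw [evalOne, jPoly_eq_sum_gPoly hk h hα, map_sum, Finset.sum_congr rfl hterm, Finset.sum_const,
    nsmul_eq_mul]

/-! ### The alternating polynomial -/

/-- The sign character with real values. -/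
def sgnHom (N : ℕ) : Equiv.Perm (Fin N) →* ℝ :=
  (Int.castRingHom ℝ : ℤ →* ℝ).comp ((Units.coeHom ℤ).comp Equiv.Perm.sign)

theorem sgnHom_apply (w : Equiv.Perm (Fin N)) : sgnHom N w = sgn w := rfl

theorem sgnHom_mul_self (w : Equiv.Perm (Fin N)) : sgnHom N w * sgnHom N w = 1 := by
  rw [sgnHom_apply, sgn]
  rcases Int.units_eq_one_or (Equiv.Perm.sign w) with h | h <;> rw [h] <;> norm_num

theorem GtI.geI {I : Finset (Fin N)} {α : Comp N} (h : GtI I α) : GeI I α :=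
  fun i hi j hj hij => (h i hi j hj hij).le

theorem GtI.injOn {I : Finset (Fin N)} {α : Comp N} (h : GtI I α) {i j : Fin N} (hi : i ∈ I)
    (hj : j ∈ I) (e : α i = α j) : i = j := by
  rcases lt_trichotomy i j with hij | hij | hij
  · have := h i hi j hj hij; omega
  · exact hij
  · have := h j hj i hi hij; omega

theorem GtI.act_inj {I : Finset (Fin N)} {α : Comp N} (h : GtI I α) {v w : Equiv.Perm (Fin N)}
    (hv : v ∈ symI I) (hw : w ∈ symI I) (e : act v α = act w α) : v = w := by
  rw [← inv_inj]
  ext1 i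
  by_cases hi : i ∈ I
  · exact h.injOn ((apply_mem_iff (inv_mem_symI hv) i).2 hi)
      ((apply_mem_iff (inv_mem_symI hw) i).2 hi) (congrFun e i)
  · rw [mem_symI.1 (inv_mem_symI hv) i hi, mem_symI.1 (inv_mem_symI hw) i hi]

theorem aPoly_eq {k : ℝ} (hk : 0 ≤ k) (l m : ℕ) (α : Comp N) :
    aPoly k l m α = calE k (-1) (interval N l m) (revI l m α) •
      ∑ w ∈ symI (interval N l m),
        (sgn w / calE k (-1) (interval N l m) (act w α)) • monic hk (act w α) := by
  simp only [aPoly, zeta_eq_monic hk]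

theorem aPoly_mem {k : ℝ} (hk : 0 ≤ k) (l m : ℕ) (α : Comp N) :
    aPoly k l m α ∈ spaceX k (interval N l m) α := by
  rw [aPoly_eq hk]
  exact Submodule.smul_mem _ _ (Submodule.sum_mem _ fun w hw =>
    Submodule.smul_mem _ _ (monic_mem_spaceX hk (act_mem_orbitI hw)))

theorem aPoly_repr {k : ℝ} (hk : 0 ≤ k) {l m : ℕ} (h : l + m ≤ N) {α : Comp N}
    (hα : GtI (interval N l m) α) :
    (pBasis N hk).repr (aPoly k l m α) (revI l m α) = sgn (revPerm h) := by
  rw [aPoly_eq hk, map_smul, map_sum, Finsupp.smul_apply, Finsupp.finsetSum_apply,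
    Finset.sum_eq_single_of_mem _ (revPerm_mem_symI h)]
  · rw [map_smul, Finsupp.smul_apply, ← revI_eq_act h, monic_repr_self, smul_eq_mul, smul_eq_mul,
      mul_one, mul_div_cancel₀ _ (calE_pos hk (Or.inr rfl) _ _).ne']
  · intro w hw hne
    rw [map_smul, Finsupp.smul_apply, repr_monic_rev hk h hα.geI hw, if_neg, smul_zero]
    intro e
    rw [revI_eq_act h] at e
    exact hne (hα.act_inj hw (revPerm_mem_symI h) e)

theorem sgn_ne_zero (w : Equiv.Perm (Fin N)) : sgn w ≠ 0 := fun e => by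
  have := sgnHom_mul_self w
  rw [sgnHom_apply, e] at this
  norm_num at this

theorem sgn_swap_mul {i j : Fin N} (h : i ≠ j) (w : Equiv.Perm (Fin N)) :
    sgn (Equiv.swap i j * w) = -1 * sgn w := by
  rw [sgn, Equiv.Perm.sign_mul, Equiv.Perm.sign_swap h, sgn]
  push_cast
  ring

theorem aPoly_equivariant {k : ℝ} (hk : 0 ≤ k) {l m : ℕ} {α : Comp N}
    (hα : GtI (interval N l m) α) :
    Equivariant (interval N l m) (sgnHom N) (aPoly k l m α) := by
  refine equivariant_of_adjacent (noGap_interval l m) _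
    fun i hi i' hi' hii => ?_
  have hne : i ≠ i' := by rintro rfl; omega
  have hs : sgnHom N (Equiv.swap i i') = -1 := by
    have := sgn_swap_mul hne 1
    rw [mul_one] at this
    rw [sgnHom_apply, this, ← sgnHom_apply, map_one, mul_one]
  rw [hs, aPoly_eq hk, map_smul, smul_comm (-1 : ℝ)]
  congr 1
  set I := interval N l m
  set J := ∑ w ∈ symI I, (sgn w / calE k (-1) I (act w α)) • monic hk (act w α) with hJ
  -- The doubled sum now pairs `w` with its product by the transposition; the change of sign
  -- supplies the `-1` in the second coefficient of the pair.
  have e : J + J = ∑ w ∈ symI I, sgn w • ((1 / calE k (-1) I (act w α)) • monic hk (act w α)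
      + (-1 / calE k (-1) I (act (Equiv.swap i i') (act w α))) •
          monic hk (act (Equiv.swap i i') (act w α))) := by
    conv_lhs => arg 2; rw [hJ, ← sum_symI_mul_left (swap_mem_symI hi hi')]
    rw [hJ, ← Finset.sum_add_distrib]
    refine Finset.sum_congr rfl fun w _ => ?_
    rw [sgn_swap_mul hne, act_act, smul_add, smul_smul, smul_smul]
    congr 2 <;> ring
  have e2 : perm (Equiv.swap i i') (J + J) = (-1 : ℝ) • (J + J) := by
    rw [e, map_sum, Finset.smul_sum]
    refine Finset.sum_congr rfl fun w hw => ?_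
    rw [map_smul, perm_swap_pair hk (Or.inr rfl) hi hi' hii (Or.inr ?_), smul_comm]
    intro e
    have := hα.injOn ((apply_mem_iff (inv_mem_symI hw) i).2 hi)
      ((apply_mem_iff (inv_mem_symI hw) i').2 hi') e
    exact hne (w⁻¹.injective this)
  rw [map_add, ← two_smul ℝ, ← two_smul ℝ J, smul_comm (-1 : ℝ)] at e2
  exact smul_right_injective _ (two_ne_zero (α := ℝ)) e2

theorem aPoly_eq_sum_perm {k : ℝ} (hk : 0 ≤ k) {l m : ℕ} (h : l + m ≤ N) {α : Comp N}
    (hα : GtI (interval N l m) α) :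
    aPoly k l m α = ∑ w ∈ symI (interval N l m), sgn w • perm w (monic hk α) := by
  have hI := noGap_interval (N := N) l m
  refine equivariant_eq hk hI (sgnHom N) sgnHom_mul_self (aPoly_mem hk l m α)
    (aPoly_equivariant hk hα) ?_ ?_ (γ := revI l m α)
    (by rw [aPoly_repr hk h hα]; exact sgn_ne_zero _) ?_
  · exact Submodule.sum_mem _ fun w hw => Submodule.smul_mem _ _
      (perm_mem_spaceX hk hI hw (monic_mem_spaceX hk (self_mem_orbitI _ α)))
  · intro v hv
    rw [map_sum, ← sum_symI_mul_left hv fun w => sgn w • perm w (monic hk α), Finset.smul_sum]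
    refine Finset.sum_congr rfl fun w _ => ?_
    rw [map_smul, perm_comp, ← sgnHom_apply, ← sgnHom_apply, map_mul, smul_smul, ← mul_assoc,
      sgnHom_mul_self, one_mul]
  · rw [aPoly_repr hk h hα, map_sum, Finsupp.finsetSum_apply,
      Finset.sum_eq_single_of_mem _ (revPerm_mem_symI h)]
    · rw [map_smul, Finsupp.smul_apply, repr_perm_monic_rev hk h hα.geI (revPerm_mem_symI h),
        if_pos (revI_eq_act h α).symm, smul_eq_mul, mul_one]
    · intro w hw hne
      rw [map_smul, Finsupp.smul_apply, repr_perm_monic_rev hk h hα.geI hw, if_neg, smul_zero]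
      intro e
      rw [revI_eq_act h] at e
      exact hne (hα.act_inj hw (revPerm_mem_symI h) e)

theorem form_aPoly {k : ℝ} (hk : 0 ≤ k) {l m : ℕ} (h : l + m ≤ N) {α : Comp N}
    (hα : GtI (interval N l m) α) {B : LinearMap.BilinForm ℝ (Poly N)} (hB : IsPermissible k B) :
    B (aPoly k l m α) (aPoly k l m α) = (symI (interval N l m)).card
      * calE k (-1) (interval N l m) (revI l m α) * B (monic hk α) (monic hk α) := by
  have h1 : B (aPoly k l m α) (monic hk α)
      = calE k (-1) (interval N l m) (revI l m α) * B (monic hk α) (monic hk α) := by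
    rw [aPoly_eq hk, map_smul, LinearMap.smul_apply, map_sum, LinearMap.sum_apply, smul_eq_mul,
      Finset.sum_eq_single_of_mem _ (one_mem_symI _)]
    · rw [map_smul, LinearMap.smul_apply, psum_act_one, calE_of_geI k (-1) hα.geI, div_one,
        ← sgnHom_apply, map_one, one_smul]
    · intro w hw hne
      rw [map_smul, LinearMap.smul_apply, hB.monic_orthogonal hk, smul_zero]
      intro e
      exact hne (hα.act_inj hw (one_mem_symI _) e)
  have hterm : ∀ w ∈ symI (interval N l m),
      B (aPoly k l m α) (sgn w • perm w (monic hk α))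
        = calE k (-1) (interval N l m) (revI l m α) * B (monic hk α) (monic hk α) := by
    intro w hw
    -- Moving `w` to the alternating factor produces the sign of `w⁻¹`, which cancels the sign in
    -- the expansion, so all terms are again equal.
    have hs : sgn w * sgnHom N w⁻¹ = 1 := by
      rw [← sgnHom_apply, ← map_mul, mul_inv_cancel, map_one]
    rw [map_smul, hB.perm_right, aPoly_equivariant hk hα _ (inv_mem_symI hw), map_smul,
      LinearMap.smul_apply, smul_smul, hs, one_smul, h1]
  conv_lhs => arg 2; rw [aPoly_eq_sum_perm hk h hα]
  rw [map_sum, Finset.sum_congr rfl hterm, Finset.sum_const, nsmul_eq_mul, mul_assoc]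

end NSJack

theorem theorem3p15 (N : ℕ) (k : ℝ) (hk : 0 ≤ k) (l m : ℕ) (hI : l + m ≤ N)
    (α : NSJack.Comp N) (hα : NSJack.GeI (NSJack.interval N l m) α) :
    -- the polynomials `g_β` are well defined
    (∀ w ∈ NSJack.symI (NSJack.interval N l m),
      NSJack.gPoly k (NSJack.interval N l m) α (NSJack.act w α)
        = NSJack.perm w (NSJack.zeta k α)) ∧
    -- `j` is the unique invariant in `X`, up to scalar multiples
    NSJack.jPoly k l m α ∈ NSJack.spaceX k (NSJack.interval N l m) α ∧
    NSJack.jPoly k l m α ≠ 0 ∧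
    (∀ w ∈ NSJack.symI (NSJack.interval N l m),
      NSJack.perm w (NSJack.jPoly k l m α) = NSJack.jPoly k l m α) ∧
    (∀ f ∈ NSJack.spaceX k (NSJack.interval N l m) α,
      (∀ w ∈ NSJack.symI (NSJack.interval N l m), NSJack.perm w f = f) →
        ∃ c : ℝ, f = c • NSJack.jPoly k l m α) ∧
    -- its norm, its value at `1^N`, and its expansion
    (∀ B : LinearMap.BilinForm ℝ (NSJack.Poly N), NSJack.IsPermissible k B →
      B (NSJack.jPoly k l m α) (NSJack.jPoly k l m α)
        = ((NSJack.orbitI (NSJack.interval N l m) α).card : ℝ)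
          * NSJack.calE k 1 (NSJack.interval N l m) (NSJack.revI l m α)
          * B (NSJack.zeta k α) (NSJack.zeta k α)) ∧
    NSJack.evalOne (NSJack.jPoly k l m α)
      = ((NSJack.orbitI (NSJack.interval N l m) α).card : ℝ)
        * NSJack.evalOne (NSJack.zeta k α) ∧
    NSJack.jPoly k l m α
      = ∑ β ∈ NSJack.orbitI (NSJack.interval N l m) α,
          NSJack.gPoly k (NSJack.interval N l m) α β ∧
    -- the alternating polynomial, when all entries of `α` in `I` are distinct
    (NSJack.GtI (NSJack.interval N l m) α →
      NSJack.aPoly k l m α ∈ NSJack.spaceX k (NSJack.interval N l m) α ∧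
      NSJack.aPoly k l m α ≠ 0 ∧
      (∀ w ∈ NSJack.symI (NSJack.interval N l m),
        NSJack.perm w (NSJack.aPoly k l m α) = NSJack.sgn w • NSJack.aPoly k l m α) ∧
      (∀ f ∈ NSJack.spaceX k (NSJack.interval N l m) α,
        (∀ w ∈ NSJack.symI (NSJack.interval N l m),
          NSJack.perm w f = NSJack.sgn w • f) →
          ∃ c : ℝ, f = c • NSJack.aPoly k l m α) ∧
      (∀ B : LinearMap.BilinForm ℝ (NSJack.Poly N), NSJack.IsPermissible k B →
        B (NSJack.aPoly k l m α) (NSJack.aPoly k l m α)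
          = ((NSJack.symI (NSJack.interval N l m)).card : ℝ)
            * NSJack.calE k (-1) (NSJack.interval N l m) (NSJack.revI l m α)
            * B (NSJack.zeta k α) (NSJack.zeta k α)) ∧
      NSJack.aPoly k l m α
        = ∑ w ∈ NSJack.symI (NSJack.interval N l m),
            NSJack.sgn w • NSJack.gPoly k (NSJack.interval N l m) α (NSJack.act w α)) := by

  have hG := NSJack.noGap_interval (N := N) l m
  have hne : NSJack.jPoly k l m α ≠ 0 := fun e => by
    have := NSJack.jPoly_repr hk hI hα
    simp [e] at this
  refine ⟨fun w hw => ?_, NSJack.jPoly_mem hk l m α, hne, fun w hw => ?_, fun f hf he => ?_,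
    fun B hB => ?_, ?_, NSJack.jPoly_eq_sum_gPoly hk hI hα, fun hgt => ?_⟩
  · rw [NSJack.zeta_eq_monic hk, NSJack.gPoly_act hk hG hα hw]
  · simpa using NSJack.jPoly_equivariant hk l m α w hw
  · exact NSJack.equivariant_unique hk hG 1 (fun _ => by simp) (NSJack.jPoly_mem hk l m α) hne
      (NSJack.jPoly_equivariant hk l m α) hf fun w hw => by simpa using he w hw
  · rw [NSJack.zeta_eq_monic hk, NSJack.form_jPoly hk hI hα hB]
  · rw [NSJack.zeta_eq_monic hk, NSJack.evalOne_jPoly hk hI hα]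
  · have hne' : NSJack.aPoly k l m α ≠ 0 := fun e => by
      have := NSJack.aPoly_repr hk hI hgt
      rw [e, map_zero, Finsupp.zero_apply] at this
      exact NSJack.sgn_ne_zero _ this.symm
    refine ⟨NSJack.aPoly_mem hk l m α, hne', NSJack.aPoly_equivariant hk hgt, fun f hf he =>
      NSJack.equivariant_unique hk hG (NSJack.sgnHom N) NSJack.sgnHom_mul_self
        (NSJack.aPoly_mem hk l m α) hne' (NSJack.aPoly_equivariant hk hgt) hf he,
      fun B hB => ?_, ?_⟩
    · rw [NSJack.zeta_eq_monic hk, NSJack.form_aPoly hk hI hgt hB]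
    · rw [NSJack.aPoly_eq_sum_perm hk hI hgt]
      exact Finset.sum_congr rfl fun w hw => by rw [NSJack.gPoly_act hk hG hα hw]
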